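/- **Conventions.** All $C^*$-algebras are unital. A pair $(A,U)$ of a $C^*$-algebra $A$ and a unitary $U=(u_{ij})\in M_m(A)$ is a compact matrix quantum group if the entries of $U$ generate $A$, there is a $*$-homomorphism $\Delta_A:A\to A\otimes_{\min}A$ with $\Delta_A(u_{ij})=\sum_k u_{ik}\otimes u_{kj}$, and $\overline U=(u_{ij}^*)$ is invertible. An isomorphism of compact quantum groups from $(A,\Delta_A)$ to $(B,\Delta_B)$ is a $*$-isomorphism $\varphi:A\to B$ with $\Delta_B\circ\varphi=(\varphi\otimes\varphi)\circ\Delta_A$; it need not map fundamental corepresentation to fundamental corepresentation. For $n\ge 0$ let $A_o(n)$, and for $n\ge 1$ let $A_s(n),A_b(n),A_{s'}(n),A_{b'}(n)$, be the universal $C^*$-algebras generated by the entries of an $n\times n$ matrix $(u_{ij})$ such that $(u_{ij})=(u_{ij}^*)$ is unitary and, in addition, * $A_o(n)$: nothing more (so $A_o(0)=\mathbb C$); * $A_s(n)$: the $u_{ij}$ are partial isometries and every row and every column sums up to $1$; * $A_b(n)$: every row and every column sums up to $1$; * $A_{s'}(n)$: the $u_{ij}$ are partial isometries and all rows and all columns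 sum up to the same element; * $A_{b'}(n)$: all rows and all columns sum up to the same element. The full group $C^*$-algebra $C^*(\mathbb Z/2\mathbb Z)$ carries $\Delta(u_g)=u_g\otimes u_g$, and $C(S^1)$ carries $\Delta(z)=z\otimes z$, where $z=\mathrm{id}_{S^1}$ is the canonical generator. For compact matrix quantum groups $(A,U)$ and $(B,V)$, the direct sum is $A\otimes B=A\otimes_{\min}B$ with fundamental corepresentation $\mathrm{diag}(U\otimes 1,1\otimes V)$, and the free product is the universal (full, unital) free product $A*B$ with fundamental corepresentation $\mathrm{diag}(U,V)$; equivalently, the comultiplications are those for which the canonical embeddings of $A$ and $B$ are morphisms of quantum groups. The free complexification of $(A,U)$ is the $C^*$-subalgebra of $A*C(S^1)$ generated by the entries of $\widetilde U=(u_{ij}z)$, together with $\widetilde U$. Let $A_p(n)$ and $A_c(n)$ be the free complexifications of $A_s(n)$ and $A_b(n)$, respectively. **Theorem.** Let $n\ge 1$. All of the pairs below are compact matrix quantum groups, and there are the following isomorphisms of compact quantum groups (not necessarily preserving the fundamental corepresentation): 1. $A_b(n)\cong A_o(n-1)$; 2. $A_{s'}(n)\cong A_s(n)\otimes C^*(\mathbb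 Z/2\mathbb Z)$; 3. $A_{b'}(n)\cong A_b(n)*C^*(\mathbb Z/2\mathbb Z)$; 4. $A_p(n)\cong A_s(n)*C(S^1)$; 5. $A_c(n)\cong A_b(n)*C(S^1)$. -/

import Mathlib

open scoped TensorProduct

noncomputable section

namespace FreeQG

/-! ### C⋆-seminorms and their completions -/

/-- A C⋆-seminorm on a unital complex ⋆-algebra.  Together with submultiplicativity the last field
gives the usual identity `p (x⋆ x) = p x ^ 2`. -/
structure CStarSeminorm (𝒜 : Type) [Ring 𝒜] [StarRing 𝒜] [Algebra ℂ 𝒜]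
    extends Seminorm ℂ 𝒜 where
  mul_le' : ∀ x y, toFun (x * y) ≤ toFun x * toFun y
  mul_self_le' : ∀ x, toFun x * toFun x ≤ toFun (star x * x)

namespace CStarSeminorm

variable {𝒜 : Type} [Ring 𝒜] [StarRing 𝒜] [Algebra ℂ 𝒜]

instance : CoeFun (CStarSeminorm 𝒜) (fun _ => 𝒜 → ℝ) := ⟨fun p => p.toSeminorm⟩

theorem mul_le (p : CStarSeminorm 𝒜) (x y : 𝒜) : p (x * y) ≤ p x * p y := p.mul_le' x y

theorem mul_self_le (p : CStarSeminorm 𝒜) (x : 𝒜) : p x * p x ≤ p (star x * x) :=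
  p.mul_self_le' x

theorem nonneg (p : CStarSeminorm 𝒜) (x : 𝒜) : 0 ≤ p x := apply_nonneg p.toSeminorm x

theorem le_star (p : CStarSeminorm 𝒜) (x : 𝒜) : p x ≤ p (star x) := by
  have h := (p.mul_self_le x).trans (p.mul_le (star x) x)
  rcases (p.nonneg x).eq_or_lt with h0 | h0
  · rw [← h0]; exact p.nonneg _
  · exact le_of_mul_le_mul_right h h0

theorem star_eq (p : CStarSeminorm 𝒜) (x : 𝒜) : p (star x) = p x :=
  le_antisymm (by simpa using p.le_star (star x)) (p.le_star x)

/-- The C⋆-seminorm `x ↦ ‖f x‖` given by a ⋆-homomorphism into a C⋆-algebra. -/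
def ofHom {C : Type} [CStarAlgebra C] (f : 𝒜 →⋆ₐ[ℂ] C) : CStarSeminorm 𝒜 where
  toSeminorm := (normSeminorm ℂ C).comp f.toAlgHom.toLinearMap
  mul_le' x y := by
    change ‖f (x * y)‖ ≤ ‖f x‖ * ‖f y‖
    rw [map_mul]; exact norm_mul_le _ _
  mul_self_le' x := by
    change ‖f x‖ * ‖f x‖ ≤ ‖f (star x * x)‖
    rw [map_mul, map_star, CStarRing.norm_star_mul_self]

/-- The pointwise supremum of a pointwise bounded set of C⋆-seminorms
(the zero seminorm if the set is empty). -/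
def sup (S : Set (CStarSeminorm 𝒜)) (hS : ∀ x, BddAbove ((fun p : CStarSeminorm 𝒜 => p x) '' S)) :
    CStarSeminorm 𝒜 where
  toFun x := sSup ((fun p : CStarSeminorm 𝒜 => p x) '' S)
  map_zero' := by
    apply le_antisymm
    · apply Real.sSup_le _ le_rfl
      rintro _ ⟨p, -, rfl⟩
      exact (map_zero p.toSeminorm).le
    · apply Real.sSup_nonneg
      rintro _ ⟨p, -, rfl⟩
      exact p.nonneg _
  add_le' x y := by
    have hx : ∀ x, 0 ≤ sSup ((fun p : CStarSeminorm 𝒜 => p x) '' S) := fun x => by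
      apply Real.sSup_nonneg
      rintro _ ⟨p, -, rfl⟩
      exact p.nonneg _
    apply Real.sSup_le _ (add_nonneg (hx x) (hx y))
    rintro _ ⟨p, hp, rfl⟩
    exact (map_add_le_add p.toSeminorm x y).trans
      (add_le_add (le_csSup (hS x) ⟨p, hp, rfl⟩) (le_csSup (hS y) ⟨p, hp, rfl⟩))
  neg' x := by
    congr 1
    ext r
    simp only [Set.mem_image]
    refine exists_congr fun p => and_congr_right fun _ => ?_
    rw [show p (-x) = p x from map_neg_eq_map p.toSeminorm x]
  smul' a x := by
    rw [← smul_eq_mul, ← Real.sSup_smul_of_nonneg (norm_nonneg a)]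
    congr 1
    ext r
    simp only [Set.mem_image, Set.mem_smul_set]
    constructor
    · rintro ⟨p, hp, rfl⟩
      exact ⟨p x, ⟨p, hp, rfl⟩, (map_smul_eq_mul p.toSeminorm a x).symm⟩
    · rintro ⟨_, ⟨p, hp, rfl⟩, rfl⟩
      exact ⟨p, hp, map_smul_eq_mul p.toSeminorm a x⟩
  mul_le' x y := by
    have hx : ∀ x, 0 ≤ sSup ((fun p : CStarSeminorm 𝒜 => p x) '' S) := fun x => by
      apply Real.sSup_nonneg
      rintro _ ⟨p, -, rfl⟩
      exact p.nonneg _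
    apply Real.sSup_le _ (mul_nonneg (hx x) (hx y))
    rintro _ ⟨p, hp, rfl⟩
    exact (p.mul_le x y).trans (mul_le_mul (le_csSup (hS x) ⟨p, hp, rfl⟩)
      (le_csSup (hS y) ⟨p, hp, rfl⟩) (p.nonneg y) (hx x))
  mul_self_le' x := by
    have hx : ∀ x, 0 ≤ sSup ((fun p : CStarSeminorm 𝒜 => p x) '' S) := fun x => by
      apply Real.sSup_nonneg
      rintro _ ⟨p, -, rfl⟩
      exact p.nonneg _
    have h : sSup ((fun p : CStarSeminorm 𝒜 => p x) '' S) ≤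
        √(sSup ((fun p : CStarSeminorm 𝒜 => p (star x * x)) '' S)) := by
      apply Real.sSup_le _ (Real.sqrt_nonneg _)
      rintro _ ⟨p, hp, rfl⟩
      exact Real.le_sqrt_of_sq_le (by
        rw [pow_two]
        exact (p.mul_self_le x).trans (le_csSup (hS _) ⟨p, hp, rfl⟩))
    calc _ ≤ √(sSup ((fun p : CStarSeminorm 𝒜 => p (star x * x)) '' S)) *
          √(sSup ((fun p : CStarSeminorm 𝒜 => p (star x * x)) '' S)) :=
          mul_self_le_mul_self (hx x) h
      _ = _ := Real.mul_self_sqrt (hx _)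

/-- The ⋆-algebra `𝒜`, regarded as a seminormed algebra through `p`. -/
def Pre (_p : CStarSeminorm 𝒜) : Type := 𝒜

instance (p : CStarSeminorm 𝒜) : Ring p.Pre := inferInstanceAs (Ring 𝒜)
instance (p : CStarSeminorm 𝒜) : StarRing p.Pre := inferInstanceAs (StarRing 𝒜)
instance (p : CStarSeminorm 𝒜) : Algebra ℂ p.Pre := inferInstanceAs (Algebra ℂ 𝒜)
instance [StarModule ℂ 𝒜] (p : CStarSeminorm 𝒜) : StarModule ℂ p.Pre :=
  inferInstanceAs (StarModule ℂ 𝒜)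

instance (p : CStarSeminorm 𝒜) : SeminormedRing p.Pre where
  __ := (inferInstance : Ring p.Pre)
  __ := p.toSeminorm.toAddGroupSeminorm.toSeminormedAddCommGroup
  norm_mul_le x y := p.mul_le x y

instance (p : CStarSeminorm 𝒜) : NormedSpace ℂ p.Pre where
  norm_smul_le a x := (map_smul_eq_mul p.toSeminorm a x).le

theorem norm_pre_star (p : CStarSeminorm 𝒜) (x : p.Pre) : ‖star x‖ = ‖x‖ := p.star_eq x

instance (p : CStarSeminorm 𝒜) : NormedStarGroup p.Pre := ⟨fun x => (p.norm_pre_star x).le⟩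

/-- The C⋆-algebra obtained from `𝒜` by separation and completion with respect to `p`. -/
def Completion (p : CStarSeminorm 𝒜) : Type := UniformSpace.Completion p.Pre

namespace Completion

variable (p : CStarSeminorm 𝒜)

instance : NormedRing p.Completion := inferInstanceAs (NormedRing (UniformSpace.Completion p.Pre))
instance : CompleteSpace p.Completion :=
  inferInstanceAs (CompleteSpace (UniformSpace.Completion p.Pre))
instance : Algebra ℂ p.Completion :=
  inferInstanceAs (Algebra ℂ (UniformSpace.Completion p.Pre))

instance : NormedAlgebra ℂ p.Completion where
  norm_smul_le a x := norm_smul_le a (show UniformSpace.Completion p.Pre from x)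

theorem uniformContinuous_star : UniformContinuous (star : p.Pre → p.Pre) :=
  (AddMonoidHomClass.isometry_of_norm (starAddEquiv : p.Pre ≃+ p.Pre)
    p.norm_pre_star).uniformContinuous

instance : Star p.Completion :=
  ⟨(UniformSpace.Completion.map star : UniformSpace.Completion p.Pre → _)⟩

theorem continuous_star : Continuous (star : p.Completion → p.Completion) :=
  UniformSpace.Completion.continuous_map

/-- The canonical map of `𝒜` into the completion, as a function. -/
def of (x : 𝒜) : p.Completion := ((show p.Pre from x : p.Pre) : UniformSpace.Completion p.Pre)

variable {p} in
theorem induction {P : p.Completion → Prop} (x : p.Completion) (hc : IsClosed {x | P x})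
    (h : ∀ a, P (of p a)) : P x :=
  UniformSpace.Completion.induction_on (α := p.Pre) x hc h

variable {p} in
theorem induction₂ {P : p.Completion → p.Completion → Prop} (x y : p.Completion)
    (hc : IsClosed {x : p.Completion × p.Completion | P x.1 x.2})
    (h : ∀ a b, P (of p a) (of p b)) : P x y :=
  UniformSpace.Completion.induction_on₂ (α := p.Pre) (β := p.Pre) x y hc h

theorem star_of (a : 𝒜) : star (of p a) = of p (star a) :=
  UniformSpace.Completion.map_coe (uniformContinuous_star p) a
theorem of_mul (a b : 𝒜) : of p (a * b) = of p a * of p b :=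
  UniformSpace.Completion.coe_mul (α := p.Pre) a b
theorem of_add (a b : 𝒜) : of p (a + b) = of p a + of p b :=
  UniformSpace.Completion.coe_add (α := p.Pre) a b
theorem of_smul (c : ℂ) (a : 𝒜) : of p (c • a) = c • of p a :=
  UniformSpace.Completion.coe_smul (X := p.Pre) c a
theorem norm_of (a : 𝒜) : ‖of p a‖ = p a :=
  UniformSpace.Completion.norm_coe (E := p.Pre) a

instance : StarRing p.Completion where
  star_involutive x := by
    refine induction (P := fun x : p.Completion => star (star x) = x) x
      (isClosed_eq ((continuous_star p).comp (continuous_star p)) continuous_id) fun a => ?_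
    rw [star_of, star_of, star_star]
  star_mul x y := by
    refine induction₂ (P := fun x y : p.Completion => star (x * y) = star y * star x) x y
      (isClosed_eq ?_ ?_) fun a b => ?_
    · exact (continuous_star p).comp (continuous_fst.mul continuous_snd)
    · exact ((continuous_star p).comp continuous_snd).mul ((continuous_star p).comp continuous_fst)
    · rw [← of_mul, star_of, star_of, star_of, ← of_mul, star_mul]
  star_add x y := by
    refine induction₂ (P := fun x y : p.Completion => star (x + y) = star x + star y) x y
      (isClosed_eq ?_ ?_) fun a b => ?_
    · exact (continuous_star p).comp (continuous_fst.add continuous_snd)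
    · exact ((continuous_star p).comp continuous_fst).add ((continuous_star p).comp continuous_snd)
    · rw [← of_add, star_of, star_of, star_of, ← of_add, star_add]

instance : CStarRing p.Completion where
  norm_mul_self_le x := by
    refine induction (P := fun x : p.Completion => ‖x‖ * ‖x‖ ≤ ‖star x * x‖) x
      (isClosed_le (continuous_norm.mul continuous_norm) ?_) fun a => ?_
    · exact (((continuous_star p).mul continuous_id)).norm
    · rw [star_of, ← of_mul, norm_of, norm_of]
      exact p.mul_self_le a

instance [StarModule ℂ 𝒜] : StarModule ℂ p.Completion where
  star_smul c x := by
    refine induction (P := fun x : p.Completion => star (c • x) = star c • star x) x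
      (isClosed_eq ((continuous_star p).comp (continuous_const_smul c))
      ((continuous_star p).const_smul (star c))) fun a => ?_
    rw [← of_smul, star_of, star_of, ← of_smul, star_smul]

instance [StarModule ℂ 𝒜] : CStarAlgebra p.Completion where

end Completion

/-- The canonical ⋆-homomorphism of `𝒜` into the completion. -/
def toCompletion (p : CStarSeminorm 𝒜) : 𝒜 →⋆ₐ[ℂ] p.Completion where
  toFun := Completion.of p
  map_one' := rfl
  map_mul' := Completion.of_mul p
  map_zero' := rfl
  map_add' := Completion.of_add p
  commutes' _ := rfl
  map_star' a := (Completion.star_of p a).symm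

section lift

variable (p : CStarSeminorm 𝒜) {C : Type} [CStarAlgebra C] (f : 𝒜 →⋆ₐ[ℂ] C)

/-- `f` as a ring homomorphism on the seminormed algebra. -/
def preHom : p.Pre →+* C := (f : 𝒜 →+* C)

theorem continuous_preHom (hf : ∀ x, ‖f x‖ ≤ p x) : Continuous (p.preHom f) :=
  AddMonoidHomClass.continuous_of_bound (p.preHom f) 1 (fun x => by rw [one_mul]; exact hf x)

variable (hf : ∀ x, ‖f x‖ ≤ p x)

/-- The extension to the completion, as a ring homomorphism. -/
def liftRingHom : p.Completion →+* C :=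
  UniformSpace.Completion.extensionHom (p.preHom f) (p.continuous_preHom f hf)

theorem liftRingHom_of (a : 𝒜) : p.liftRingHom f hf (Completion.of p a) = f a :=
  UniformSpace.Completion.extensionHom_coe (p.preHom f) (p.continuous_preHom f hf) a

theorem continuous_liftRingHom : Continuous (p.liftRingHom f hf) :=
  UniformSpace.Completion.continuous_extension

/-- A ⋆-homomorphism dominated by `p` extends to the completion. -/
def lift : p.Completion →⋆ₐ[ℂ] C where
  __ := p.liftRingHom f hf
  commutes' r := (p.liftRingHom_of f hf (algebraMap ℂ 𝒜 r)).trans (AlgHomClass.commutes f r)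
  map_star' x := by
    refine Completion.induction
      (P := fun x : p.Completion => p.liftRingHom f hf (star x) = star (p.liftRingHom f hf x)) x
      (isClosed_eq ((p.continuous_liftRingHom f hf).comp (Completion.continuous_star p))
        (p.continuous_liftRingHom f hf).star) fun a => ?_
    rw [Completion.star_of, liftRingHom_of, liftRingHom_of, map_star]

end lift

end CStarSeminorm

/-! ### The free ⋆-algebra and universal C⋆-algebras -/

/-- The free unital complex ⋆-algebra on `X`: noncommutative polynomials in the variables `x` and
`x⋆`, which are the generators indexed by `Sum.inl x` and `Sum.inr x`. -/
def StarPoly (X : Type) : Type := FreeAlgebra ℂ (X ⊕ X)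

namespace StarPoly

variable {X : Type}

instance : Ring (StarPoly X) := inferInstanceAs (Ring (FreeAlgebra ℂ (X ⊕ X)))
instance : Algebra ℂ (StarPoly X) := inferInstanceAs (Algebra ℂ (FreeAlgebra ℂ (X ⊕ X)))

/-- The variable `x` (for `Sum.inl x`) or `x⋆` (for `Sum.inr x`). -/
def var (y : X ⊕ X) : StarPoly X := FreeAlgebra.ι ℂ y

/-- Evaluation of a noncommutative polynomial with values prescribed on all variables. -/
def evalAlg {C : Type} [Semiring C] [Algebra ℂ C] (g : X ⊕ X → C) : StarPoly X →ₐ[ℂ] C :=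
  FreeAlgebra.lift ℂ g

theorem evalAlg_var {C : Type} [Semiring C] [Algebra ℂ C] (g : X ⊕ X → C) (y : X ⊕ X) :
    evalAlg g (var y) = g y := FreeAlgebra.lift_ι_apply g y

theorem induction {P : StarPoly X → Prop} (hC : ∀ r, P (algebraMap ℂ _ r)) (hv : ∀ y, P (var y))
    (hm : ∀ a b, P a → P b → P (a * b)) (ha : ∀ a b, P a → P b → P (a + b)) (a : StarPoly X) :
    P a := FreeAlgebra.induction ℂ (X ⊕ X) hC hv hm ha a

/-- The opposite ring, with `r : ℂ` acting as its complex conjugate. -/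
def ConjOp (X : Type) : Type := (StarPoly X)ᵐᵒᵖ
instance : Ring (ConjOp X) := inferInstanceAs (Ring (StarPoly X)ᵐᵒᵖ)
instance : Algebra ℂ (ConjOp X) :=
  ((algebraMap ℂ (StarPoly X)ᵐᵒᵖ).comp (starRingEnd ℂ)).toAlgebra' fun r x =>
    Algebra.commutes (A := (StarPoly X)ᵐᵒᵖ) (starRingEnd ℂ r) x

/-- A polynomial as an element of the opposite ring. -/
def ConjOp.op (a : StarPoly X) : ConjOp X := MulOpposite.op a

/-- The conjugate-linear antimultiplicative map exchanging `x` and `x⋆`. -/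
def starAux : StarPoly X →ₐ[ℂ] ConjOp X := evalAlg fun y => ConjOp.op (var y.swap)

instance : Star (StarPoly X) := ⟨fun a => MulOpposite.unop (starAux a)⟩

theorem star_def (a : StarPoly X) : star a = MulOpposite.unop (starAux a) := rfl
theorem star_add' (a b : StarPoly X) : star (a + b) = star a + star b := by
  rw [star_def, map_add]; rfl
theorem star_mul' (a b : StarPoly X) : star (a * b) = star b * star a := by
  rw [star_def, map_mul]; rfl
theorem star_algebraMap' (r : ℂ) :
    star (algebraMap ℂ (StarPoly X) r) = algebraMap ℂ _ (starRingEnd ℂ r) := by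
  rw [star_def, AlgHom.commutes]; rfl
theorem star_var (y : X ⊕ X) : star (var y) = var y.swap := by
  rw [star_def, starAux, evalAlg_var]; rfl

instance : StarRing (StarPoly X) where
  star_involutive a := by
    refine induction (P := fun a => star (star a) = a) (fun r => ?_) (fun y => ?_)
      (fun a b ha hb => ?_) (fun a b ha hb => ?_) a
    · rw [star_algebraMap', star_algebraMap', Complex.conj_conj]
    · rw [star_var, star_var, Sum.swap_swap]
    · rw [star_mul', star_mul', ha, hb]
    · rw [star_add', star_add', ha, hb]
  star_mul := star_mul'
  star_add := star_add'

instance : StarModule ℂ (StarPoly X) where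
  star_smul r a := by
    rw [Algebra.smul_def, star_mul, star_algebraMap', Algebra.smul_def, Algebra.commutes]; rfl

/-- Evaluation of ⋆-polynomials at a family `f` of elements of a ⋆-algebra. -/
def eval {C : Type} [Ring C] [StarRing C] [Algebra ℂ C] [StarModule ℂ C] (f : X → C) :
    StarPoly X →⋆ₐ[ℂ] C where
  __ := evalAlg (Sum.elim f fun x => star (f x))
  map_star' a := by
    change evalAlg (Sum.elim f fun x => star (f x)) (star a) =
      star (evalAlg (Sum.elim f fun x => star (f x)) a)
    refine induction (P := fun a => evalAlg (Sum.elim f fun x => star (f x)) (star a) =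
      star (evalAlg (Sum.elim f fun x => star (f x)) a)) (fun r => ?_) (fun y => ?_)
      (fun a b ha hb => ?_) (fun a b ha hb => ?_) a
    · rw [star_algebraMap', AlgHom.commutes, AlgHom.commutes]; exact algebraMap_star_comm r
    · rw [star_var, evalAlg_var, evalAlg_var]
      cases y <;> simp
    · rw [star_mul, map_mul, map_mul, star_mul, ha, hb]
    · rw [star_add, map_add, map_add, star_add, ha, hb]

end StarPoly

/-- A condition on families `(f x)` in unital C⋆-algebras which bounds the norm of each `f x`. -/
structure Relations (X : Type) where
  Holds : ∀ (C : Type) [CStarAlgebra C], (X → C) → Prop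
  bound : X → ℝ
  norm_le : ∀ (C : Type) [CStarAlgebra C] (f : X → C), Holds C f → ∀ x, ‖f x‖ ≤ bound x

namespace Relations

variable {X : Type} (R : Relations X)

/-- The C⋆-seminorms `a ↦ ‖a(f)‖` on ⋆-polynomials, for all families `f` satisfying `R`. -/
def seminorms : Set (CStarSeminorm (StarPoly X)) :=
  {p | ∃ (C : Type) (_ : CStarAlgebra C) (f : X → C), R.Holds C f ∧
    p = CStarSeminorm.ofHom (StarPoly.eval f)}

theorem bddAbove (a : StarPoly X) :
    BddAbove ((fun p : CStarSeminorm (StarPoly X) => p a) '' R.seminorms) := by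
  suffices h : ∃ M : ℝ, 0 ≤ M ∧ ∀ (C : Type) [CStarAlgebra C] (f : X → C), R.Holds C f →
      ‖StarPoly.eval f a‖ ≤ M by
    obtain ⟨M, -, hM⟩ := h
    refine ⟨M, ?_⟩
    rintro _ ⟨_, ⟨C, _, f, hf, rfl⟩, rfl⟩
    exact hM C f hf
  refine StarPoly.induction (P := fun a => ∃ M : ℝ, 0 ≤ M ∧ ∀ (C : Type) [CStarAlgebra C]
    (f : X → C), R.Holds C f → ‖StarPoly.eval f a‖ ≤ M) (fun r => ?_) (fun y => ?_) ?_ ?_ a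
  · refine ⟨‖r‖, norm_nonneg _, fun C _ f _ => ?_⟩
    rw [AlgHomClass.commutes, Algebra.algebraMap_eq_smul_one]
    refine (norm_smul_le _ _).trans (mul_le_of_le_one_right (norm_nonneg _) ?_)
    rcases subsingleton_or_nontrivial C with h | h
    · rw [Subsingleton.elim (1 : C) 0, norm_zero]; exact zero_le_one
    · exact CStarRing.norm_one.le
  · refine ⟨|R.bound (y.elim id id)|, abs_nonneg _, fun C _ f hf => ?_⟩
    have h : StarPoly.eval f (StarPoly.var y) = (Sum.elim f fun x => star (f x)) y :=
      StarPoly.evalAlg_var _ y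
    rw [h]
    rcases y with x | x
    · exact (R.norm_le C f hf x).trans (le_abs_self _)
    · exact (norm_star (f x)).le.trans ((R.norm_le C f hf x).trans (le_abs_self _))
  · rintro a b ⟨M, hM, ha⟩ ⟨N, hN, hb⟩
    refine ⟨M * N, mul_nonneg hM hN, fun C _ f hf => ?_⟩
    rw [map_mul]
    exact (norm_mul_le _ _).trans (mul_le_mul (ha C f hf) (hb C f hf) (norm_nonneg _) hM)
  · rintro a b ⟨M, hM, ha⟩ ⟨N, hN, hb⟩
    refine ⟨M + N, add_nonneg hM hN, fun C _ f hf => ?_⟩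
    rw [map_add]
    exact (norm_add_le _ _).trans (add_le_add (ha C f hf) (hb C f hf))

/-- The universal C⋆-seminorm `‖a‖ = sup ‖a(f)‖`, over all families `f` in unital C⋆-algebras
that satisfy `R`. -/
def seminorm : CStarSeminorm (StarPoly X) := CStarSeminorm.sup R.seminorms R.bddAbove

/-- The universal unital C⋆-algebra `C⋆(X | R)` with generators `X` subject to `R`. -/
abbrev CStar : Type := R.seminorm.Completion

/-- The canonical generators of the universal C⋆-algebra. -/
def gen (x : X) : R.CStar := R.seminorm.toCompletion (StarPoly.var (Sum.inl x))

end Relations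

/-! ### The minimal tensor product -/

namespace MinTensor

/-- The C⋆-inequality for a bounded operator with a bounded formal adjoint. -/
theorem norm_mul_self_le_of_formal_adjoint {E : Type} [NormedAddCommGroup E]
    [InnerProductSpace ℂ E] (S T : E →L[ℂ] E)
    (h : ∀ ξ η : E, inner ℂ (S ξ) η = inner ℂ ξ (T η)) : ‖T‖ * ‖T‖ ≤ ‖S * T‖ := by
  have h : ‖T‖ ≤ √‖S * T‖ := by
    refine ContinuousLinearMap.opNorm_le_bound _ (Real.sqrt_nonneg _) fun ξ => ?_
    have h1 : ‖T ξ‖ ^ 2 ≤ ‖S * T‖ * ‖ξ‖ ^ 2 := by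
      calc ‖T ξ‖ ^ 2 = ‖(inner ℂ (T ξ) (T ξ) : ℂ)‖ := by
            rw [inner_self_eq_norm_sq_to_K]; simp
        _ = ‖(inner ℂ ((S * T) ξ) ξ : ℂ)‖ := by
            change _ = ‖(inner ℂ (S (T ξ)) ξ : ℂ)‖
            rw [h, norm_inner_symm]
        _ ≤ ‖(S * T) ξ‖ * ‖ξ‖ := norm_inner_le_norm _ _
        _ ≤ ‖S * T‖ * ‖ξ‖ * ‖ξ‖ := by
            gcongr; exact ContinuousLinearMap.le_opNorm _ _
        _ = _ := by ring
    calc ‖T ξ‖ ≤ √(‖S * T‖ * ‖ξ‖ ^ 2) := Real.le_sqrt_of_sq_le h1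
      _ = _ := by rw [Real.sqrt_mul (norm_nonneg _), Real.sqrt_sq (norm_nonneg _)]
  calc _ ≤ √‖S * T‖ * √‖S * T‖ := mul_self_le_mul_self (norm_nonneg _) h
    _ = _ := Real.mul_self_sqrt (norm_nonneg _)

section rep

variable {A B : Type} [CStarAlgebra A] [CStarAlgebra B]
variable {H K : Type} [NormedAddCommGroup H] [InnerProductSpace ℂ H] [CompleteSpace H]
  [NormedAddCommGroup K] [InnerProductSpace ℂ K] [CompleteSpace K]
variable (π : A →⋆ₐ[ℂ] (H →L[ℂ] H)) (ρ : B →⋆ₐ[ℂ] (K →L[ℂ] K))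

/-- The representation `π ⊗ ρ` of the algebraic tensor product, `a ⊗ b ↦ π a ⊗ ρ b`, by bounded
operators on the (uncompleted) tensor product of the Hilbert spaces. -/
def rep : A ⊗[ℂ] B →ₐ[ℂ] (H ⊗[ℂ] K →L[ℂ] H ⊗[ℂ] K) :=
  Algebra.TensorProduct.lift
    { toFun := fun a => TensorProduct.mapL (π a) (1 : K →L[ℂ] K)
      map_one' := by ext; simp
      map_mul' := fun a b => by rw [map_mul, ← TensorProduct.mapL_mul, one_mul]
      map_zero' := by simp
      map_add' := fun a b => by rw [map_add, TensorProduct.mapL_add_left]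
      commutes' := fun r => by
        rw [AlgHomClass.commutes, Algebra.algebraMap_eq_smul_one, TensorProduct.mapL_smul_left]
        ext; simp [Algebra.algebraMap_eq_smul_one] }
    { toFun := fun b => TensorProduct.mapL (1 : H →L[ℂ] H) (ρ b)
      map_one' := by ext; simp
      map_mul' := fun a b => by rw [map_mul, ← TensorProduct.mapL_mul, one_mul]
      map_zero' := by simp
      map_add' := fun a b => by rw [map_add, TensorProduct.mapL_add_right]
      commutes' := fun r => by
        rw [AlgHomClass.commutes, Algebra.algebraMap_eq_smul_one, TensorProduct.mapL_smul_right]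
        ext; simp [Algebra.algebraMap_eq_smul_one] }
    (fun a b => by
      change TensorProduct.mapL (π a) 1 * TensorProduct.mapL 1 (ρ b) =
        TensorProduct.mapL 1 (ρ b) * TensorProduct.mapL (π a) 1
      rw [← TensorProduct.mapL_mul, ← TensorProduct.mapL_mul, one_mul, mul_one, one_mul, mul_one])

theorem rep_tmul (a : A) (b : B) : rep π ρ (a ⊗ₜ b) = TensorProduct.mapL (π a) (ρ b) := by
  rw [rep, Algebra.TensorProduct.lift_tmul]
  change TensorProduct.mapL (π a) 1 * TensorProduct.mapL 1 (ρ b) = _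
  rw [← TensorProduct.mapL_mul, one_mul, mul_one]

theorem inner_rep (x : A ⊗[ℂ] B) (ξ η : H ⊗[ℂ] K) :
    inner ℂ (rep π ρ (star x) ξ) η = inner ℂ ξ (rep π ρ x η) := by
  induction x using TensorProduct.induction_on with
  | zero => simp
  | add x y hx hy => simp [inner_add_left, inner_add_right, hx, hy]
  | tmul a b =>
    rw [TensorProduct.star_tmul, rep_tmul, rep_tmul, map_star, map_star]
    induction ξ using TensorProduct.induction_on with
    | zero => simp
    | add x y hx hy => simp only [map_add, inner_add_left, hx, hy]
    | tmul h k =>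
      induction η using TensorProduct.induction_on with
      | zero => simp
      | add x y hx hy => simp only [map_add, inner_add_right, hx, hy]
      | tmul h' k' =>
        rw [TensorProduct.mapL_tmul, TensorProduct.mapL_tmul, TensorProduct.inner_tmul,
          TensorProduct.inner_tmul, ContinuousLinearMap.star_eq_adjoint,
          ContinuousLinearMap.star_eq_adjoint, ContinuousLinearMap.adjoint_inner_left,
          ContinuousLinearMap.adjoint_inner_left]

/-- The C⋆-seminorm `x ↦ ‖(π ⊗ ρ) x‖` (operator norm) on the algebraic tensor product. -/
def spatialSeminorm : CStarSeminorm (A ⊗[ℂ] B) where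
  toSeminorm := (normSeminorm ℂ (H ⊗[ℂ] K →L[ℂ] H ⊗[ℂ] K)).comp (rep π ρ).toLinearMap
  mul_le' x y := by
    change ‖rep π ρ (x * y)‖ ≤ ‖rep π ρ x‖ * ‖rep π ρ y‖
    rw [map_mul]; exact ContinuousLinearMap.opNorm_comp_le _ _
  mul_self_le' x := by
    change ‖rep π ρ x‖ * ‖rep π ρ x‖ ≤ ‖rep π ρ (star x * x)‖
    rw [map_mul]
    exact norm_mul_self_le_of_formal_adjoint _ _ (inner_rep π ρ x)

theorem spatialSeminorm_apply (x : A ⊗[ℂ] B) : spatialSeminorm π ρ x = ‖rep π ρ x‖ := rfl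

end rep

variable (A B : Type) [CStarAlgebra A] [CStarAlgebra B]

/-- All seminorms `x ↦ ‖(π ⊗ ρ) x‖`, for representations `π` of `A` and `ρ` of `B` on Hilbert
spaces. -/
def spatialSeminorms : Set (CStarSeminorm (A ⊗[ℂ] B)) :=
  {p | ∃ (H K : Type) (_ : NormedAddCommGroup H) (_ : InnerProductSpace ℂ H) (_ : CompleteSpace H)
    (_ : NormedAddCommGroup K) (_ : InnerProductSpace ℂ K) (_ : CompleteSpace K)
    (π : A →⋆ₐ[ℂ] (H →L[ℂ] H)) (ρ : B →⋆ₐ[ℂ] (K →L[ℂ] K)), p = spatialSeminorm π ρ}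

theorem bddAbove (x : A ⊗[ℂ] B) :
    BddAbove ((fun p : CStarSeminorm (A ⊗[ℂ] B) => p x) '' spatialSeminorms A B) := by
  suffices h : ∃ M : ℝ, ∀ p ∈ spatialSeminorms A B, p x ≤ M by
    obtain ⟨M, hM⟩ := h
    exact ⟨M, by rintro _ ⟨p, hp, rfl⟩; exact hM p hp⟩
  induction x using TensorProduct.induction_on with
  | zero => exact ⟨0, fun p _ => (map_zero p.toSeminorm).le⟩
  | add x y hx hy =>
    obtain ⟨M, hM⟩ := hx
    obtain ⟨N, hN⟩ := hy
    exact ⟨M + N, fun p hp =>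
      (map_add_le_add p.toSeminorm x y).trans (add_le_add (hM p hp) (hN p hp))⟩
  | tmul a b =>
    refine ⟨‖a‖ * ‖b‖, ?_⟩
    rintro _ ⟨H, K, _, _, _, _, _, _, π, ρ, rfl⟩
    rw [spatialSeminorm_apply, rep_tmul]
    exact (TensorProduct.norm_mapL_le _ _).trans (mul_le_mul
      (NonUnitalStarAlgHom.norm_apply_le π a) (NonUnitalStarAlgHom.norm_apply_le ρ b)
      (norm_nonneg _) (norm_nonneg _))

/-- The minimal (spatial) C⋆-norm on the algebraic tensor product. -/
def seminorm : CStarSeminorm (A ⊗[ℂ] B) :=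
  CStarSeminorm.sup (spatialSeminorms A B) (bddAbove A B)

end MinTensor

/-- The minimal tensor product `A ⊗_min B` of unital C⋆-algebras. -/
abbrev MinTensor (A B : Type) [CStarAlgebra A] [CStarAlgebra B] : Type :=
  (MinTensor.seminorm A B).Completion

namespace MinTensor

variable {A B A' B' : Type} [CStarAlgebra A] [CStarAlgebra B] [CStarAlgebra A'] [CStarAlgebra B']

/-- The elementary tensor `a ⊗ b` in `A ⊗_min B`. -/
def tmul (a : A) (b : B) : MinTensor A B := (seminorm A B).toCompletion (a ⊗ₜ b)

/-- `f ⊗ g` on the algebraic tensor products. -/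
def mapAlg (f : A →⋆ₐ[ℂ] A') (g : B →⋆ₐ[ℂ] B') : A ⊗[ℂ] B →⋆ₐ[ℂ] A' ⊗[ℂ] B' where
  __ := Algebra.TensorProduct.map f.toAlgHom g.toAlgHom
  map_star' x := by
    change Algebra.TensorProduct.map f.toAlgHom g.toAlgHom (star x) =
      star (Algebra.TensorProduct.map f.toAlgHom g.toAlgHom x)
    induction x using TensorProduct.induction_on with
    | zero => simp
    | add x y hx hy => rw [star_add, map_add, map_add, star_add, hx, hy]
    | tmul a b => simp [map_star]

theorem mapAlg_tmul (f : A →⋆ₐ[ℂ] A') (g : B →⋆ₐ[ℂ] B') (a : A) (b : B) :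
    mapAlg f g (a ⊗ₜ b) = f a ⊗ₜ g b := rfl

theorem seminorm_mapAlg_le (f : A →⋆ₐ[ℂ] A') (g : B →⋆ₐ[ℂ] B') (x : A ⊗[ℂ] B) :
    seminorm A' B' (mapAlg f g x) ≤ seminorm A B x := by
  refine Real.sSup_le ?_ ((seminorm A B).nonneg x)
  rintro _ ⟨_, ⟨H, K, _, _, _, _, _, _, π, ρ, rfl⟩, rfl⟩
  refine le_csSup (bddAbove A B x) ⟨spatialSeminorm (π.comp f) (ρ.comp g),
    ⟨H, K, _, _, _, _, _, _, _, _, rfl⟩, ?_⟩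
  simp only [spatialSeminorm_apply]
  congr 1
  induction x using TensorProduct.induction_on with
  | zero => simp
  | add x y hx hy => rw [map_add, map_add, map_add, hx, hy]
  | tmul a b => rw [mapAlg_tmul, rep_tmul, rep_tmul]; rfl

theorem norm_mapAlg_le (f : A →⋆ₐ[ℂ] A') (g : B →⋆ₐ[ℂ] B') (x : A ⊗[ℂ] B) :
    ‖((seminorm A' B').toCompletion.comp (mapAlg f g)) x‖ ≤ seminorm A B x :=
  (CStarSeminorm.Completion.norm_of _ _).le.trans (seminorm_mapAlg_le f g x)

/-- The ⋆-homomorphism `f ⊗ g : A ⊗_min B → A' ⊗_min B'`, `a ⊗ b ↦ f a ⊗ g b`. -/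
def map (f : A →⋆ₐ[ℂ] A') (g : B →⋆ₐ[ℂ] B') : MinTensor A B →⋆ₐ[ℂ] MinTensor A' B' :=
  (seminorm A B).lift ((seminorm A' B').toCompletion.comp (mapAlg f g)) (norm_mapAlg_le f g)

theorem map_tmul (f : A →⋆ₐ[ℂ] A') (g : B →⋆ₐ[ℂ] B') (a : A) (b : B) :
    map f g (tmul a b) = tmul (f a) (g b) :=
  CStarSeminorm.liftRingHom_of (seminorm A B) _ (norm_mapAlg_le f g) (a ⊗ₜ b)

end MinTensor

/-! ### Unital free products and group C⋆-algebras -/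

section FreeProduct

variable (A B : Type) [CStarAlgebra A] [CStarAlgebra B]

/-- Families indexed by `A ⊕ B` which consist of a pair of unital ⋆-homomorphisms. -/
def freeProductRelations : Relations (A ⊕ B) where
  Holds C _ f := ∃ (α : A →⋆ₐ[ℂ] C) (β : B →⋆ₐ[ℂ] C), f = Sum.elim α β
  bound := Sum.elim norm norm
  norm_le := by
    rintro C _ _ ⟨α, β, rfl⟩ (a | b)
    · exact NonUnitalStarAlgHom.norm_apply_le α a
    · exact NonUnitalStarAlgHom.norm_apply_le β b

/-- The (full, unital) free product `A * B`, the universal C⋆-algebra generated by copies of `A`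
and `B` with common unit. -/
abbrev FreeProduct : Type := (freeProductRelations A B).CStar

variable {A B}

/-- The copy of `a ∈ A` in `A * B`. -/
def FreeProduct.inl (a : A) : FreeProduct A B := (freeProductRelations A B).gen (Sum.inl a)

/-- The copy of `b ∈ B` in `A * B`. -/
def FreeProduct.inr (b : B) : FreeProduct A B := (freeProductRelations A B).gen (Sum.inr b)

end FreeProduct

theorem norm_le_one_of_mem_unitary {C : Type} [CStarAlgebra C] {u : C} (hu : u ∈ unitary C) :
    ‖u‖ ≤ 1 := by
  rcases subsingleton_or_nontrivial C with h | h
  · rw [Subsingleton.elim u 0, norm_zero]; exact zero_le_one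
  · exact (CStarRing.norm_of_mem_unitary hu).le

/-- Families indexed by a group which form a unitary representation. -/
def groupRelations (G : Type) [Group G] : Relations G where
  Holds C _ f := ∃ ρ : G →* unitary C, ∀ g, f g = ρ g
  bound _ := 1
  norm_le := by
    rintro C _ f ⟨ρ, hρ⟩ g
    rw [hρ g]
    exact norm_le_one_of_mem_unitary (ρ g).2

/-- The (full) group C⋆-algebra `C⋆(G)`. -/
abbrev GroupCStar (G : Type) [Group G] : Type := (groupRelations G).CStar

/-- The canonical unitary `u_g` in `C⋆(G)`. -/
def GroupCStar.u {G : Type} [Group G] (g : G) : GroupCStar G := (groupRelations G).gen g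

/-! ### Compact matrix quantum groups -/

/-- A unital C⋆-algebra with a square matrix over it. -/
structure MatrixPair (ι : Type) [Fintype ι] [DecidableEq ι] where
  A : Type
  [cstar : CStarAlgebra A]
  U : Matrix ι ι A

attribute [instance] MatrixPair.cstar

namespace MatrixPair

variable {ι κ : Type} [Fintype ι] [DecidableEq ι] [Fintype κ] [DecidableEq κ]

/-- `Δ` is the comultiplication of `(A, U)`: a ⋆-homomorphism `Δ : A → A ⊗_min A` with
`Δ(u_ij) = ∑ k, u_ik ⊗ u_kj`.  (It is unique when the entries of `U` generate `A`.) -/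
def IsComultiplication (G : MatrixPair ι) (Δ : G.A →⋆ₐ[ℂ] MinTensor G.A G.A) : Prop :=
  ∀ i j, Δ (G.U i j) = ∑ k, MinTensor.tmul (G.U i k) (G.U k j)

/-- `(A, U)` is a compact matrix quantum group: `U` is unitary, its entries generate the C⋆-algebra
`A`, there is a comultiplication, and the entrywise adjoint of `U` is invertible. -/
structure IsCompactMatrixQuantumGroup (G : MatrixPair ι) : Prop where
  unitary : G.U ∈ unitary (Matrix ι ι G.A)
  generated : (StarAlgebra.adjoin ℂ {x : G.A | ∃ i j, x = G.U i j}).topologicalClosure = ⊤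
  comultiplication : ∃ Δ : G.A →⋆ₐ[ℂ] MinTensor G.A G.A, G.IsComultiplication Δ
  conj_invertible : IsUnit (G.U.map star)

/-- `(A, U)` and `(B, V)` are compact matrix quantum groups, and they are isomorphic as compact
quantum groups: there is a ⋆-isomorphism `φ : A → B` with `Δ_B ∘ φ = (φ ⊗ φ) ∘ Δ_A`, which
need not map `U` to `V`. -/
def Isomorphic (G : MatrixPair ι) (H : MatrixPair κ) : Prop :=
  G.IsCompactMatrixQuantumGroup ∧ H.IsCompactMatrixQuantumGroup ∧
    ∃ (ΔG : G.A →⋆ₐ[ℂ] MinTensor G.A G.A) (ΔH : H.A →⋆ₐ[ℂ] MinTensor H.A H.A),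
      G.IsComultiplication ΔG ∧ H.IsComultiplication ΔH ∧
      ∃ φ : G.A ≃⋆ₐ[ℂ] H.A,
        ∀ x, ΔH (φ x) = MinTensor.map (φ : G.A →⋆ₐ[ℂ] H.A) (φ : G.A →⋆ₐ[ℂ] H.A) (ΔG x)

/-- The direct sum `(A, Δ_A) ⊗ (B, Δ_B)`: the algebra `A ⊗_min B` with the fundamental
corepresentation `diag(U ⊗ 1, 1 ⊗ V)`.  The formula for the comultiplication on its entries says
that `a ↦ a ⊗ 1` and `b ↦ 1 ⊗ b` respect the comultiplications. -/
def directSum (G : MatrixPair ι) (H : MatrixPair κ) : MatrixPair (ι ⊕ κ) where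
  A := MinTensor G.A H.A
  U := Matrix.fromBlocks (G.U.map fun a => MinTensor.tmul a 1) 0
    0 (H.U.map fun b => MinTensor.tmul 1 b)

/-- The free product `(A, Δ_A) * (B, Δ_B)`: the algebra `A * B` with the fundamental
corepresentation `diag(U, V)`.  The formula for the comultiplication on its entries says
that the inclusions of `A` and `B` respect the comultiplications. -/
def freeProduct (G : MatrixPair ι) (H : MatrixPair κ) : MatrixPair (ι ⊕ κ) where
  A := FreeProduct G.A H.A
  U := Matrix.fromBlocks (G.U.map FreeProduct.inl) 0 0 (H.U.map FreeProduct.inr)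

end MatrixPair

/-- `C⋆(ℤ/2ℤ)` with the `1 × 1` matrix whose entry is the unitary `u` of the generator;
`Δ(u) = u ⊗ u`. -/
def cstarZMod2 : MatrixPair Unit where
  A := GroupCStar (Multiplicative (ZMod 2))
  U := fun _ _ => GroupCStar.u (Multiplicative.ofAdd 1)

/-- The canonical generator `id : S¹ → ℂ` of `C(S¹)`. -/
def circleId : C(Circle, ℂ) := ⟨fun z => (z : ℂ), continuous_subtype_val⟩

/-- `C(S¹)` with the `1 × 1` matrix whose entry is the canonical generator `z`;
`Δ(z) = z ⊗ z`. -/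
def circle : MatrixPair Unit where
  A := C(Circle, ℂ)
  U := fun _ _ => circleId

/-! ### Orthogonal free quantum groups -/

section conditions

variable {C : Type} [CStarAlgebra C] {ι : Type} [Fintype ι] [DecidableEq ι]

/-- `u = (u_ij) = (u_ij⋆)` is unitary. -/
def IsOrthogonal (u : Matrix ι ι C) : Prop :=
  (∀ i j, star (u i j) = u i j) ∧ u ∈ unitary (Matrix ι ι C)

/-- All entries are partial isometries. -/
def HasPartialIsometryEntries (u : Matrix ι ι C) : Prop :=
  ∀ i j, u i j * star (u i j) * u i j = u i j

/-- Every row and every column sums up to `z`. -/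
def HasSums (z : C) (u : Matrix ι ι C) : Prop :=
  (∀ i, ∑ j, u i j = z) ∧ ∀ j, ∑ i, u i j = z

theorem norm_entry_le_one {u : Matrix ι ι C} (hu : u ∈ unitary (Matrix ι ι C)) (i j : ι) :
    ‖u i j‖ ≤ 1 := by
  let _ : PartialOrder C := CStarAlgebra.spectralOrder C
  let _ : StarOrderedRing C := CStarAlgebra.spectralOrderedRing C
  have h : CStarMatrix.ofMatrix u ∈ _root_.unitary (CStarMatrix ι ι C) := hu
  exact CStarMatrix.norm_entry_le_norm.trans (norm_le_one_of_mem_unitary h)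

end conditions

/-- A condition on `n × n` matrices over unital C⋆-algebras which implies orthogonality, as
relations for `n²` generators. -/
def matrixRelations (n : ℕ)
    (P : ∀ (C : Type) [CStarAlgebra C], Matrix (Fin n) (Fin n) C → Prop)
    (hP : ∀ (C : Type) [CStarAlgebra C] (u : Matrix (Fin n) (Fin n) C), P C u → IsOrthogonal u) :
    Relations (Fin n × Fin n) where
  Holds C _ f := P C (Matrix.of fun i j => f (i, j))
  bound _ := 1
  norm_le C _ _ hf x := norm_entry_le_one (hP C _ hf).2 x.1 x.2

/-- The universal unital C⋆-algebra generated by the entries of an `n × n` matrix `(u_ij)` subject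
to the condition `P`, with the matrix `(u_ij)`. -/
def universalPair (n : ℕ)
    (P : ∀ (C : Type) [CStarAlgebra C], Matrix (Fin n) (Fin n) C → Prop)
    (hP : ∀ (C : Type) [CStarAlgebra C] (u : Matrix (Fin n) (Fin n) C), P C u → IsOrthogonal u) :
    MatrixPair (Fin n) where
  A := (matrixRelations n P hP).CStar
  U := Matrix.of fun i j => (matrixRelations n P hP).gen (i, j)

/-- The free orthogonal Wang algebra `A_o(n)`. -/
def Ao (n : ℕ) : MatrixPair (Fin n) :=
  universalPair n (fun _ _ u => IsOrthogonal u) fun _ _ _ h => h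

/-- The quantum permutation group `A_s(n)`. -/
def As (n : ℕ) : MatrixPair (Fin n) :=
  universalPair n (fun _ _ u => IsOrthogonal u ∧ HasPartialIsometryEntries u ∧ HasSums 1 u)
    fun _ _ _ h => h.1

/-- The bistochastic quantum group `A_b(n)`. -/
def Ab (n : ℕ) : MatrixPair (Fin n) :=
  universalPair n (fun _ _ u => IsOrthogonal u ∧ HasSums 1 u) fun _ _ _ h => h.1

/-- The symmetrized bistochastic quantum group `A_b'(n)`. -/
def Ab' (n : ℕ) : MatrixPair (Fin n) :=
  universalPair n (fun _ _ u => IsOrthogonal u ∧ ∃ z, HasSums z u) fun _ _ _ h => h.1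

/-- The symmetrized quantum permutation group `A_s'(n)`. -/
def As' (n : ℕ) : MatrixPair (Fin n) :=
  universalPair n
    (fun _ _ u => IsOrthogonal u ∧ HasPartialIsometryEntries u ∧ ∃ z, HasSums z u)
    fun _ _ _ h => h.1

/-! ### Free complexifications -/

section complexification

variable {ι : Type} [Fintype ι] [DecidableEq ι] (G : MatrixPair ι)

/-- The matrix `(u_ij z)` over `A * C(S¹)`, where `z` is the canonical generator of `C(S¹)`. -/
def complexMatrix : Matrix ι ι (FreeProduct G.A C(Circle, ℂ)) :=
  Matrix.of fun i j => FreeProduct.inl (G.U i j) * FreeProduct.inr circleId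

/-- The sub-C⋆-algebra of `A * C(S¹)` generated by the elements `u_ij z`. -/
def complexSubalgebra : StarSubalgebra ℂ (FreeProduct G.A C(Circle, ℂ)) :=
  (StarAlgebra.adjoin ℂ {x | ∃ i j, x = complexMatrix G i j}).topologicalClosure

instance : IsClosed (complexSubalgebra G : Set (FreeProduct G.A C(Circle, ℂ))) :=
  StarSubalgebra.isClosed_topologicalClosure _

/-- The free complexification of `(A, U)`. -/
def freeComplexification : MatrixPair ι where
  A := complexSubalgebra G
  U := Matrix.of fun i j => ⟨complexMatrix G i j,
    StarSubalgebra.le_topologicalClosure _ (StarAlgebra.subset_adjoin ℂ _ ⟨i, j, rfl⟩)⟩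

end complexification

/-- `A_p(n)`, the free complexification of `A_s(n)`. -/
def Ap (n : ℕ) : MatrixPair (Fin n) := freeComplexification (As n)

/-- `A_c(n)`, the free complexification of `A_b(n)`. -/
def Ac (n : ℕ) : MatrixPair (Fin n) := freeComplexification (Ab n)

end FreeQG

end

/-!
A ⋆-homomorphism out of a universal C⋆-algebra is a matrix satisfying the defining relations
(`exists_hom_universalPair`), and it is determined by that matrix.  Each isomorphism is therefore
given by matrices in the two directions, and only one comultiplication has to be computed: if
`φ : A → B` is a ⋆-isomorphism and the fundamental corepresentation of `B` is the image of some
corepresentation of `A`, then `(φ ⊗ φ) ∘ Δ ∘ φ⁻¹` is the comultiplication of `B`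
(`isomorphic_of_homs`).

Let `u` be an orthogonal `n × n` matrix all of whose rows and columns sum up to `r`.  Then
`(1, …, 1)` is an eigenvector of `u` and of its transpose, with "eigenvalue" `r`, so `r` is a
self-adjoint unitary (`HasSums.mul_self`), and in an orthonormal basis containing
`(1, …, 1) / √n` the matrix `u` becomes `diag(r, v)` with `v` orthogonal.

* For `r = 1` the matrix `v` is an arbitrary orthogonal matrix of size `n - 1`, which gives
  `A_b(n) ≅ A_o(n-1)` (`isomorphic_bistochastic`; the basis is explicit, see `exists_isometry`).
* In general, replacing `r` by another self-adjoint unitary `s` amounts to adding `(s - r) / n` to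
  every entry (`changeSums`), and this respects corepresentations.  So `u` is the same as a
  bistochastic matrix together with a self-adjoint unitary `r`, without relations between the two,
  which gives `A_b'(n) ≅ A_b(n) * C⋆(ℤ/2ℤ)` (`isomorphic_freeProduct_zmod2`).
* If the entries of `u` are partial isometries, then different entries in one row are orthogonal,
  whence `u_ij r = u_ij² = r u_ij`.  So `r` is central and `u r` has sums `1`.  This gives a
  homomorphism from `A_s'(n)` to the minimal tensor product of `A_s(n)` and `C⋆(ℤ/2ℤ)`.  Its
  inverse has to be bounded for the minimal norm: the two characters of `ℤ/2ℤ` give slice maps to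
  `A_s(n)`, hence a ⋆-homomorphism to `A_s(n) × A_s(n)`, which is mapped to `A_s'(n)` by means of
  the central projection `(1 + r) / 2` (`isomorphic_directSum_zmod2`).  That slice maps exist on
  the minimal tensor product rests on the fact that representations on Hilbert spaces
  detect the norm of a C⋆-algebra (`exists_rep_norm_le`), which follows from the Hahn–Banach
  theorem and the GNS construction.
* A row of `(u_ij z)` sums up to `r z`; if `r = 1`, then the free complexification contains `z` and
  hence every `u_ij`, so it is the whole free product with `C(S¹)`
  (`isomorphic_freeComplexification`).
-/

noncomputable section

set_option linter.unusedSectionVars false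

namespace FreeQG

/-! ### Generating sets of C⋆-algebras -/

section Generates

variable {A B C : Type} [CStarAlgebra A] [CStarAlgebra B] [CStarAlgebra C]

theorem continuous_starAlgHom (φ : A →⋆ₐ[ℂ] B) : Continuous φ :=
  AddMonoidHomClass.continuous_of_bound φ 1 fun x => by
    rw [one_mul]; exact NonUnitalStarAlgHom.norm_apply_le φ x

/-- The set `S` generates `A` as a C⋆-algebra: the ⋆-subalgebra generated by `S` is dense. -/
def Generates (S : Set A) : Prop := (StarAlgebra.adjoin ℂ S).topologicalClosure = ⊤

/-- A closed ⋆-subalgebra that contains the image of a generating set under a ⋆-homomorphism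
contains the whole range. -/
theorem Generates.map_mem {S : Set A} (hS : Generates S) (φ : A →⋆ₐ[ℂ] B)
    (D : StarSubalgebra ℂ B) (hD : IsClosed (D : Set B)) (h : ∀ s ∈ S, φ s ∈ D) (a : A) :
    φ a ∈ D := by
  have h1 : (StarAlgebra.adjoin ℂ S).topologicalClosure ≤ D.comap φ :=
    StarSubalgebra.topologicalClosure_minimal (StarAlgebra.adjoin_le h)
      (hD.preimage (continuous_starAlgHom φ))
  have h2 : a ∈ (StarAlgebra.adjoin ℂ S).topologicalClosure := by
    rw [show (StarAlgebra.adjoin ℂ S).topologicalClosure = ⊤ from hS]; trivial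
  exact h1 h2

theorem Generates.mem {S : Set A} (hS : Generates S) (D : StarSubalgebra ℂ A)
    (hD : IsClosed (D : Set A)) (h : ∀ s ∈ S, s ∈ D) (a : A) : a ∈ D :=
  hS.map_mem (StarAlgHom.id ℂ A) D hD h a

theorem generates_of_forall_mem {S : Set A}
    (h : ∀ D : StarSubalgebra ℂ A, IsClosed (D : Set A) → (∀ s ∈ S, s ∈ D) → ∀ a, a ∈ D) :
    Generates S := by
  refine eq_top_iff.mpr fun a _ => h _ (StarSubalgebra.isClosed_topologicalClosure _) ?_ a
  exact fun s hs => StarSubalgebra.le_topologicalClosure _ (StarAlgebra.subset_adjoin ℂ _ hs)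

theorem generates_univ (A : Type) [CStarAlgebra A] : Generates (Set.univ : Set A) :=
  generates_of_forall_mem fun _ _ h a => h a trivial

theorem Generates.hom_ext {S : Set A} (hS : Generates S) {φ ψ : A →⋆ₐ[ℂ] B}
    (h : ∀ s ∈ S, φ s = ψ s) : φ = ψ := by
  ext a
  exact hS.mem (StarAlgHom.equalizer φ ψ)
    (isClosed_eq (continuous_starAlgHom φ) (continuous_starAlgHom ψ)) h a

/-- A self-adjoint element that commutes with a generating set is central. -/
theorem Generates.commute {S : Set A} (hS : Generates S) {r : A} (hr : star r = r)
    (h : ∀ s ∈ S, s * r = r * s) (a : A) : a * r = r * a := by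
  have := hS.mem (StarSubalgebra.centralizer ℂ {r}) (Set.isClosed_centralizer _) ?_ a
  · exact ((StarSubalgebra.mem_centralizer_iff ℂ).mp this r rfl).1.symm
  · intro s hs
    refine (StarSubalgebra.mem_centralizer_iff ℂ).mpr fun g hg => ?_
    obtain rfl : g = r := hg
    exact ⟨(h s hs).symm, by rw [hr]; exact (h s hs).symm⟩

end Generates

/-! ### Universal C⋆-algebras -/

theorem StarPoly.eval_var {X C : Type} [Ring C] [StarRing C] [Algebra ℂ C] [StarModule ℂ C]
    (f : X → C) (x : X) : StarPoly.eval f (StarPoly.var (Sum.inl x)) = f x :=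
  StarPoly.evalAlg_var _ _

theorem StarPoly.hom_ext {X C : Type} [Ring C] [StarRing C] [Algebra ℂ C]
    {φ ψ : StarPoly X →⋆ₐ[ℂ] C}
    (h : ∀ x, φ (StarPoly.var (Sum.inl x)) = ψ (StarPoly.var (Sum.inl x))) : φ = ψ := by
  ext a
  refine StarPoly.induction (P := fun a => φ a = ψ a) (fun r => ?_) (fun y => ?_)
    (fun a b ha hb => ?_) (fun a b ha hb => ?_) a
  · rw [AlgHomClass.commutes, AlgHomClass.commutes]
  · rcases y with x | x
    · exact h x
    · rw [show (StarPoly.var (Sum.inr x)) = star (StarPoly.var (Sum.inl x)) from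
        (StarPoly.star_var (Sum.inl x)).symm, map_star, map_star, h]
  · rw [map_mul, map_mul, ha, hb]
  · rw [map_add, map_add, ha, hb]

theorem CStarSeminorm.lift_of {𝒜 C : Type} [Ring 𝒜] [StarRing 𝒜] [Algebra ℂ 𝒜]
    [CStarAlgebra C] (p : CStarSeminorm 𝒜) (f : 𝒜 →⋆ₐ[ℂ] C) (hf : ∀ x, ‖f x‖ ≤ p x) (a : 𝒜) :
    p.lift f hf (p.toCompletion a) = f a := p.liftRingHom_of f hf a

namespace Relations

variable {X : Type} (R : Relations X)

theorem norm_eval_le {C : Type} [CStarAlgebra C] {f : X → C} (hf : R.Holds C f)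
    (a : StarPoly X) : ‖StarPoly.eval f a‖ ≤ R.seminorm a :=
  le_csSup (R.bddAbove a) ⟨CStarSeminorm.ofHom (StarPoly.eval f), ⟨C, _, f, hf, rfl⟩, rfl⟩

/-- The universal property of `C⋆(X | R)`. -/
def lift {C : Type} [CStarAlgebra C] (f : X → C) (hf : R.Holds C f) : R.CStar →⋆ₐ[ℂ] C :=
  R.seminorm.lift (StarPoly.eval f) (R.norm_eval_le hf)

@[simp]
theorem lift_gen {C : Type} [CStarAlgebra C] (f : X → C) (hf : R.Holds C f) (x : X) :
    R.lift f hf (R.gen x) = f x :=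
  (CStarSeminorm.lift_of _ _ _ _).trans (StarPoly.eval_var f x)

theorem eval_gen : StarPoly.eval R.gen = R.seminorm.toCompletion :=
  StarPoly.hom_ext fun x => StarPoly.eval_var _ x

/-- A polynomial identity valid for all families satisfying `R` is valid for the generators. -/
theorem eval_gen_eq {a b : StarPoly X}
    (h : ∀ (C : Type) [CStarAlgebra C] (f : X → C), R.Holds C f →
      StarPoly.eval f a = StarPoly.eval f b) :
    StarPoly.eval R.gen a = StarPoly.eval R.gen b := by
  rw [eval_gen, ← sub_eq_zero, ← map_sub, ← norm_le_zero_iff]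
  refine (CStarSeminorm.Completion.norm_of _ _).le.trans (Real.sSup_le ?_ le_rfl)
  rintro _ ⟨_, ⟨C, _, f, hf, rfl⟩, rfl⟩
  change ‖StarPoly.eval f (a - b)‖ ≤ 0
  rw [map_sub, h C f hf, sub_self, norm_zero]

theorem generates_gen : Generates (Set.range R.gen) := by
  refine generates_of_forall_mem fun D hD h a => ?_
  refine CStarSeminorm.Completion.induction (P := fun a => a ∈ D) a hD fun a => ?_
  change R.seminorm.toCompletion a ∈ D
  refine StarPoly.induction (P := fun a => R.seminorm.toCompletion a ∈ D) (fun r => ?_)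
    (fun y => ?_) (fun a b ha hb => ?_) (fun a b ha hb => ?_) a
  · rw [AlgHomClass.commutes]; exact algebraMap_mem D r
  · rcases y with x | x
    · exact h _ ⟨x, rfl⟩
    · rw [show (StarPoly.var (Sum.inr x)) = star (StarPoly.var (Sum.inl x)) from
        (StarPoly.star_var (Sum.inl x)).symm, map_star]
      exact star_mem (h _ ⟨x, rfl⟩)
  · rw [map_mul]; exact mul_mem ha hb
  · rw [map_add]; exact add_mem ha hb

theorem hom_ext {C : Type} [CStarAlgebra C] {φ ψ : R.CStar →⋆ₐ[ℂ] C}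
    (h : ∀ x, φ (R.gen x) = ψ (R.gen x)) : φ = ψ :=
  R.generates_gen.hom_ext (by rintro _ ⟨x, rfl⟩; exact h x)

end Relations

/-! ### Minimal tensor products -/

namespace MinTensor

variable {A B A' B' C : Type} [CStarAlgebra A] [CStarAlgebra B] [CStarAlgebra A']
  [CStarAlgebra B'] [CStarAlgebra C]

/-- The embedding `a ↦ a ⊗ 1`. -/
def inl : A →⋆ₐ[ℂ] MinTensor A B :=
  (seminorm A B).toCompletion.comp
    { (Algebra.TensorProduct.includeLeft : A →ₐ[ℂ] A ⊗[ℂ] B) with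
      map_star' := fun a => by
        change star a ⊗ₜ[ℂ] (1 : B) = star (a ⊗ₜ[ℂ] (1 : B))
        rw [TensorProduct.star_tmul, star_one] }

/-- The embedding `b ↦ 1 ⊗ b`. -/
def inr : B →⋆ₐ[ℂ] MinTensor A B :=
  (seminorm A B).toCompletion.comp
    { (Algebra.TensorProduct.includeRight : B →ₐ[ℂ] A ⊗[ℂ] B) with
      map_star' := fun b => by
        change (1 : A) ⊗ₜ[ℂ] star b = star ((1 : A) ⊗ₜ[ℂ] b)
        rw [TensorProduct.star_tmul, star_one] }

theorem inl_apply (a : A) : (inl a : MinTensor A B) = tmul a 1 := rfl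

theorem inr_apply (b : B) : (inr b : MinTensor A B) = tmul 1 b := rfl

theorem tmul_mul_tmul (a a' : A) (b b' : B) :
    (tmul a b * tmul a' b' : MinTensor A B) = tmul (a * a') (b * b') := by
  change (seminorm A B).toCompletion _ * (seminorm A B).toCompletion _ = _
  rw [← map_mul, Algebra.TensorProduct.tmul_mul_tmul]; rfl

theorem inl_mul_inr (a : A) (b : B) : (inl a * inr b : MinTensor A B) = tmul a b := by
  rw [inl_apply, inr_apply, tmul_mul_tmul, one_mul, mul_one]

theorem inr_mul_inl (a : A) (b : B) : (inr b * inl a : MinTensor A B) = tmul a b := by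
  rw [inl_apply, inr_apply, tmul_mul_tmul, one_mul, mul_one]

theorem commute_inl_inr (a : A) (b : B) : Commute (inl a : MinTensor A B) (inr b) :=
  (inl_mul_inr a b).trans (inr_mul_inl a b).symm

@[simp]
theorem map_inl (f : A →⋆ₐ[ℂ] A') (g : B →⋆ₐ[ℂ] B') (a : A) :
    map f g (inl a) = inl (f a) := by
  rw [inl_apply, map_tmul, map_one]; rfl

@[simp]
theorem map_inr (f : A →⋆ₐ[ℂ] A') (g : B →⋆ₐ[ℂ] B') (b : B) :
    map f g (inr b) = inr (g b) := by
  rw [inr_apply, map_tmul, map_one]; rfl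

theorem generates_of_generates {S : Set A} {T : Set B} (hS : Generates S) (hT : Generates T) :
    Generates ((inl '' S ∪ inr '' T : Set (MinTensor A B))) := by
  refine generates_of_forall_mem fun D hD h x => ?_
  have hl : ∀ a : A, inl a ∈ D :=
    hS.map_mem inl D hD fun s hs => h _ (Or.inl ⟨s, hs, rfl⟩)
  have hr : ∀ b : B, inr b ∈ D :=
    hT.map_mem inr D hD fun s hs => h _ (Or.inr ⟨s, hs, rfl⟩)
  refine CStarSeminorm.Completion.induction (P := fun a => a ∈ D) x hD fun x => ?_
  change (seminorm A B).toCompletion x ∈ D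
  induction x using TensorProduct.induction_on with
  | zero => rw [map_zero]; exact zero_mem D
  | add x y hx hy => rw [map_add]; exact add_mem hx hy
  | tmul a b =>
    change tmul a b ∈ D
    rw [← inl_mul_inr]; exact mul_mem (hl a) (hr b)

theorem hom_ext {φ ψ : MinTensor A B →⋆ₐ[ℂ] C} (hl : φ.comp inl = ψ.comp inl)
    (hr : φ.comp inr = ψ.comp inr) : φ = ψ := by
  refine (generates_of_generates (generates_univ A) (generates_univ B)).hom_ext ?_
  rintro _ (⟨a, -, rfl⟩ | ⟨b, -, rfl⟩)
  · exact DFunLike.congr_fun hl a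
  · exact DFunLike.congr_fun hr b

theorem map_map {A'' B'' : Type} [CStarAlgebra A''] [CStarAlgebra B'']
    (f : A →⋆ₐ[ℂ] A') (g : B →⋆ₐ[ℂ] B') (f' : A' →⋆ₐ[ℂ] A'') (g' : B' →⋆ₐ[ℂ] B'')
    (x : MinTensor A B) : map f' g' (map f g x) = map (f'.comp f) (g'.comp g) x := by
  have : (map f' g').comp (map f g) = map (f'.comp f) (g'.comp g) :=
    hom_ext (by ext; simp) (by ext; simp)
  exact DFunLike.congr_fun this x

theorem map_id (x : MinTensor A B) : map (StarAlgHom.id ℂ A) (StarAlgHom.id ℂ B) x = x := by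
  have : map (StarAlgHom.id ℂ A) (StarAlgHom.id ℂ B) = StarAlgHom.id ℂ (MinTensor A B) :=
    hom_ext (by ext; simp) (by ext; simp)
  exact DFunLike.congr_fun this x

end MinTensor

/-! ### Free products -/

namespace FreeProduct

variable {A B C : Type} [CStarAlgebra A] [CStarAlgebra B] [CStarAlgebra C]

/-- A ⋆-polynomial identity that holds for all pairs of ⋆-homomorphisms holds for the generators of
`A * B`. -/
theorem gen_eq {a b : StarPoly (A ⊕ B)}
    (h : ∀ (C : Type) [CStarAlgebra C] (α : A →⋆ₐ[ℂ] C) (β : B →⋆ₐ[ℂ] C),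
      StarPoly.eval (Sum.elim α β) a = StarPoly.eval (Sum.elim α β) b) :
    StarPoly.eval (freeProductRelations A B).gen a =
      StarPoly.eval (freeProductRelations A B).gen b := by
  refine Relations.eval_gen_eq _ ?_
  rintro C _ _ ⟨α, β, rfl⟩
  exact h C α β

/-- The inclusion of `A` into `A * B` as a ⋆-homomorphism. -/
def inlHom : A →⋆ₐ[ℂ] FreeProduct A B where
  toFun := inl
  map_one' := by
    have := gen_eq (a := StarPoly.var (.inl (.inl (1 : A)))) (b := (1 : StarPoly (A ⊕ B)))
      fun C _ α β => by simp [StarPoly.eval_var]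
    simpa [inl, StarPoly.eval_var] using this
  map_mul' x y := by
    have := gen_eq (B := B) (a := StarPoly.var (.inl (.inl (x * y))))
      (b := StarPoly.var (.inl (.inl x)) * StarPoly.var (.inl (.inl y)))
      fun C _ α β => by simp [StarPoly.eval_var]
    simpa [inl, StarPoly.eval_var] using this
  map_zero' := by
    have := gen_eq (a := StarPoly.var (.inl (.inl (0 : A)))) (b := (0 : StarPoly (A ⊕ B)))
      fun C _ α β => by simp [StarPoly.eval_var]
    simpa [inl, StarPoly.eval_var] using this
  map_add' x y := by
    have := gen_eq (B := B) (a := StarPoly.var (.inl (.inl (x + y))))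
      (b := StarPoly.var (.inl (.inl x)) + StarPoly.var (.inl (.inl y)))
      fun C _ α β => by simp [StarPoly.eval_var]
    simpa [inl, StarPoly.eval_var] using this
  commutes' r := by
    have := gen_eq (B := B) (a := StarPoly.var (.inl (.inl (algebraMap ℂ A r))))
      (b := algebraMap ℂ _ r)
      fun C _ α β => by simp only [StarPoly.eval_var, AlgHomClass.commutes, Sum.elim_inl]
    simpa only [inl, StarPoly.eval_var, AlgHomClass.commutes] using this
  map_star' x := by
    have := gen_eq (B := B) (a := StarPoly.var (.inl (.inl (star x))))
      (b := star (StarPoly.var (.inl (.inl x))))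
      fun C _ α β => by simp [StarPoly.eval_var, map_star]
    simpa [inl, StarPoly.eval_var, map_star] using this

/-- The inclusion of `B` into `A * B` as a ⋆-homomorphism. -/
def inrHom : B →⋆ₐ[ℂ] FreeProduct A B where
  toFun := inr
  map_one' := by
    have := gen_eq (a := StarPoly.var (.inl (.inr (1 : B)))) (b := (1 : StarPoly (A ⊕ B)))
      fun C _ α β => by simp [StarPoly.eval_var]
    simpa [inr, StarPoly.eval_var] using this
  map_mul' x y := by
    have := gen_eq (A := A) (a := StarPoly.var (.inl (.inr (x * y))))
      (b := StarPoly.var (.inl (.inr x)) * StarPoly.var (.inl (.inr y)))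
      fun C _ α β => by simp [StarPoly.eval_var]
    simpa [inr, StarPoly.eval_var] using this
  map_zero' := by
    have := gen_eq (a := StarPoly.var (.inl (.inr (0 : B)))) (b := (0 : StarPoly (A ⊕ B)))
      fun C _ α β => by simp [StarPoly.eval_var]
    simpa [inr, StarPoly.eval_var] using this
  map_add' x y := by
    have := gen_eq (A := A) (a := StarPoly.var (.inl (.inr (x + y))))
      (b := StarPoly.var (.inl (.inr x)) + StarPoly.var (.inl (.inr y)))
      fun C _ α β => by simp [StarPoly.eval_var]
    simpa [inr, StarPoly.eval_var] using this
  commutes' r := by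
    have := gen_eq (A := A) (a := StarPoly.var (.inl (.inr (algebraMap ℂ B r))))
      (b := algebraMap ℂ _ r)
      fun C _ α β => by simp only [StarPoly.eval_var, AlgHomClass.commutes, Sum.elim_inr]
    simpa only [inr, StarPoly.eval_var, AlgHomClass.commutes] using this
  map_star' x := by
    have := gen_eq (A := A) (a := StarPoly.var (.inl (.inr (star x))))
      (b := star (StarPoly.var (.inl (.inr x))))
      fun C _ α β => by simp [StarPoly.eval_var, map_star]
    simpa [inr, StarPoly.eval_var, map_star] using this

/-- The universal property of `A * B`. -/
def lift (α : A →⋆ₐ[ℂ] C) (β : B →⋆ₐ[ℂ] C) : FreeProduct A B →⋆ₐ[ℂ] C :=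
  (freeProductRelations A B).lift (Sum.elim α β) ⟨α, β, rfl⟩

@[simp]
theorem lift_inl (α : A →⋆ₐ[ℂ] C) (β : B →⋆ₐ[ℂ] C) (a : A) : lift α β (inlHom a) = α a :=
  Relations.lift_gen _ _ _ _

@[simp]
theorem lift_inr (α : A →⋆ₐ[ℂ] C) (β : B →⋆ₐ[ℂ] C) (b : B) : lift α β (inrHom b) = β b :=
  Relations.lift_gen _ _ _ _

theorem hom_ext {φ ψ : FreeProduct A B →⋆ₐ[ℂ] C} (hl : φ.comp inlHom = ψ.comp inlHom)
    (hr : φ.comp inrHom = ψ.comp inrHom) : φ = ψ := by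
  refine Relations.hom_ext _ ?_
  rintro (a | b)
  · exact DFunLike.congr_fun hl a
  · exact DFunLike.congr_fun hr b

theorem generates_of_generates {S : Set A} {T : Set B} (hS : Generates S) (hT : Generates T) :
    Generates ((inlHom '' S ∪ inrHom '' T : Set (FreeProduct A B))) := by
  refine generates_of_forall_mem fun D hD h => ?_
  refine (freeProductRelations A B).generates_gen.mem D hD ?_
  rintro _ ⟨a | b, rfl⟩
  · exact hS.map_mem inlHom D hD (fun s hs => h _ (Or.inl ⟨s, hs, rfl⟩)) a
  · exact hT.map_mem inrHom D hD (fun s hs => h _ (Or.inr ⟨s, hs, rfl⟩)) b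

end FreeProduct

/-! ### The group C⋆-algebra of `ℤ/2ℤ` -/

namespace GroupCStar

variable {C : Type} [CStarAlgebra C]

/-- The unitary representation of `ℤ/2ℤ` given by a self-adjoint unitary. -/
def zmod2Rep (r : C) (hr : star r = r) (hr2 : r * r = 1) :
    Multiplicative (ZMod 2) →* unitary C where
  toFun g := if g = 1 then 1 else ⟨r, by rw [Unitary.mem_iff, hr]; exact ⟨hr2, hr2⟩⟩
  map_one' := if_pos rfl
  map_mul' g h := by
    have h01 : ∀ g : Multiplicative (ZMod 2), g = 1 ∨ g = Multiplicative.ofAdd 1 := by decide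
    have hne : Multiplicative.ofAdd (1 : ZMod 2) ≠ 1 := by decide
    have hm : Multiplicative.ofAdd (1 : ZMod 2) * Multiplicative.ofAdd (1 : ZMod 2) = 1 := by
      decide
    rcases h01 g with rfl | rfl <;> rcases h01 h with rfl | rfl
    · simp
    · simp
    · simp
    · rw [hm, if_pos rfl, if_neg hne]
      exact Subtype.ext hr2.symm

/-- The ⋆-homomorphism from `C⋆(ℤ/2ℤ)` given by a self-adjoint unitary. -/
def zmod2Lift (r : C) (hr : star r = r) (hr2 : r * r = 1) :
    GroupCStar (Multiplicative (ZMod 2)) →⋆ₐ[ℂ] C :=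
  (groupRelations _).lift (fun g => zmod2Rep r hr hr2 g) ⟨zmod2Rep r hr hr2, fun _ => rfl⟩

/-- The canonical self-adjoint unitary generating `C⋆(ℤ/2ℤ)`. -/
abbrev g2 : GroupCStar (Multiplicative (ZMod 2)) := u (Multiplicative.ofAdd 1)

@[simp]
theorem zmod2Lift_g2 (r : C) (hr : star r = r) (hr2 : r * r = 1) :
    zmod2Lift r hr hr2 g2 = r := by
  refine (Relations.lift_gen _ _ _ _).trans ?_
  have hne : Multiplicative.ofAdd (1 : ZMod 2) ≠ 1 := by decide
  change ((if _ then _ else _ : unitary C) : C) = r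
  rw [if_neg hne]

/-- A ⋆-polynomial identity that holds for all unitary representations of `G` holds for the
generators of `C⋆(G)`. -/
theorem gen_eq {G : Type} [Group G] {a b : StarPoly G}
    (h : ∀ (C : Type) [CStarAlgebra C] (ρ : G →* unitary C),
      StarPoly.eval (fun g => (ρ g : C)) a = StarPoly.eval (fun g => (ρ g : C)) b) :
    StarPoly.eval (groupRelations G).gen a = StarPoly.eval (groupRelations G).gen b := by
  refine Relations.eval_gen_eq _ ?_
  rintro C _ f ⟨ρ, hρ⟩
  obtain rfl : f = fun g => (ρ g : C) := funext hρ
  exact h C ρ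

theorem u_one {G : Type} [Group G] : (u 1 : GroupCStar G) = 1 := by
  have := gen_eq (G := G) (a := StarPoly.var (.inl 1)) (b := 1)
    fun C _ ρ => by simp [StarPoly.eval_var]
  simpa [u, StarPoly.eval_var] using this

theorem u_mul {G : Type} [Group G] (g h : G) : (u (g * h) : GroupCStar G) = u g * u h := by
  have := gen_eq (G := G) (a := StarPoly.var (.inl (g * h)))
    (b := StarPoly.var (.inl g) * StarPoly.var (.inl h))
    fun C _ ρ => by simp [StarPoly.eval_var]
  simpa [u, StarPoly.eval_var] using this

theorem star_u {G : Type} [Group G] (g : G) : star (u g : GroupCStar G) = u g⁻¹ := by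
  have := gen_eq (G := G) (a := star (StarPoly.var (.inl g)))
    (b := StarPoly.var (.inl g⁻¹))
    fun C _ ρ => by simp [StarPoly.eval_var, map_star, ← Unitary.star_eq_inv]
  simpa [u, StarPoly.eval_var, map_star] using this

theorem star_g2 : star g2 = g2 := by
  rw [star_u]; congr 1

theorem g2_mul_g2 : g2 * g2 = 1 := by
  rw [← u_mul, ← u_one]; congr 1

theorem generates_g2 : Generates ({g2} : Set (GroupCStar (Multiplicative (ZMod 2)))) := by
  refine generates_of_forall_mem fun D hD h => ?_
  refine (groupRelations _).generates_gen.mem D hD ?_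
  rintro _ ⟨g, rfl⟩
  have h01 : ∀ g : Multiplicative (ZMod 2), g = 1 ∨ g = Multiplicative.ofAdd 1 := by decide
  rcases h01 g with rfl | rfl
  · rw [show (groupRelations (Multiplicative (ZMod 2))).gen 1 = 1 from u_one]
    exact one_mem D
  · exact h _ rfl

end GroupCStar

/-! ### States and slice maps -/

section States

variable {A : Type} [CStarAlgebra A]

open scoped ComplexOrder

/-- The norm of a positive element is attained by a state.  For positive `x`, the element `‖x‖ - x`
is not an interior point of the set of elements with positive real part, and the state is a
functional that separates it from the interior. -/
theorem exists_state_apply_eq_norm [PartialOrder A] [StarOrderedRing A] [Nontrivial A]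
    (x : A) (hx : 0 ≤ x) : ∃ f : A →ₚ[ℂ] ℂ, f 1 = 1 ∧ f x = ‖x‖ := by
  -- `S` contains `±I • h` for all self-adjoint `h`, so that a functional whose real part has a
  -- sign on `S` takes real values on self-adjoint elements.
  let S : Set A := {b | 0 ≤ b + star b}
  have hSadd : ∀ a b, a ∈ S → b ∈ S → a + b ∈ S := fun a b ha hb => by
    change 0 ≤ a + b + star (a + b)
    have := add_nonneg (show 0 ≤ a + star a from ha) (show 0 ≤ b + star b from hb)
    rw [star_add]; convert this using 1; abel
  have hSsmul : ∀ (t : ℝ) a, 0 ≤ t → a ∈ S → t • a ∈ S := fun t a ht ha => by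
    change 0 ≤ t • a + star (t • a)
    rw [star_smul, star_trivial, ← smul_add]
    exact smul_nonneg ht ha
  have hSconv : Convex ℝ S := fun a ha b hb s t hs ht _ =>
    hSadd _ _ (hSsmul s a hs ha) (hSsmul t b ht hb)
  have hSpos : ∀ a, 0 ≤ a → a ∈ S := fun a ha => by
    change 0 ≤ a + star a
    rw [(IsSelfAdjoint.of_nonneg ha).star_eq]; exact add_nonneg ha ha
  have h1int : (1 : A) ∈ interior S := by
    rw [mem_interior_iff_mem_nhds]
    refine Filter.mem_of_superset (Metric.closedBall_mem_nhds (1 : A) one_pos) fun b hb => ?_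
    have hb1 : ‖b - 1‖ ≤ 1 := by rwa [← dist_eq_norm]
    have h0 : IsSelfAdjoint ((b - 1) + star (b - 1)) := IsSelfAdjoint.add_star_self _
    have h1 := h0.neg_algebraMap_norm_le_self
    have h2 : ‖(b - 1) + star (b - 1)‖ ≤ 2 :=
      (norm_add_le _ _).trans (by rw [norm_star]; linarith)
    have h3 := algebraMap_mono A h2
    have h4 := (neg_le_neg h3).trans h1
    change 0 ≤ b + star b
    rw [map_ofNat] at h4
    have h5 : b + star b = (b - 1 + star (b - 1)) - (-2) := by
      rw [star_sub, star_one, ← one_add_one_eq_two]; abel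
    rw [h5]; exact sub_nonneg.mpr h4
  set c : ℝ := ‖x‖ with hc
  have hcx : 0 ≤ algebraMap ℝ A c - x :=
    sub_nonneg.mpr (IsSelfAdjoint.of_nonneg hx).le_algebraMap_norm_self
  have hnot : algebraMap ℝ A c - x ∉ interior S := by
    intro h
    rw [mem_interior_iff_mem_nhds] at h
    have hcont : Continuous fun t : ℝ => algebraMap ℝ A c - x - algebraMap ℝ A t := by
      simp only [Algebra.algebraMap_eq_smul_one]; fun_prop
    have hev : ∀ᶠ t : ℝ in nhds 0, algebraMap ℝ A c - x - algebraMap ℝ A t ∈ S := by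
      refine hcont.continuousAt.eventually ?_
      simpa using h
    obtain ⟨ε, hε, hball⟩ := Metric.eventually_nhds_iff_ball.mp hev
    have hm := hball (ε / 2) (by
      rw [mem_ball_zero_iff, Real.norm_of_nonneg (half_pos hε).le]; exact half_lt_self hε)
    have hsa : star (algebraMap ℝ A c - x - algebraMap ℝ A (ε / 2)) =
        algebraMap ℝ A c - x - algebraMap ℝ A (ε / 2) := by
      rw [star_sub, star_sub, (IsSelfAdjoint.of_nonneg hx).star_eq, ← algebraMap_star_comm,
        ← algebraMap_star_comm, star_trivial, star_trivial]
    have hm' : x ≤ algebraMap ℝ A (c - ε / 2) := by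
      have h2 : 0 ≤ algebraMap ℝ A c - x - algebraMap ℝ A (ε / 2) +
        star (algebraMap ℝ A c - x - algebraMap ℝ A (ε / 2)) := hm
      rw [hsa, ← two_smul ℝ] at h2
      have h3 := smul_nonneg (show (0 : ℝ) ≤ 1 / 2 by norm_num) h2
      rw [smul_smul] at h3
      norm_num at h3
      rw [map_sub]
      exact sub_nonneg.mp (by convert sub_nonneg.mpr h3 using 1; abel)
    have hle : 0 ≤ c - ε / 2 := by
      by_contra! hlt
      have h4 : algebraMap ℝ A (c - ε / 2) ≤ 0 := by
        rw [← map_zero (algebraMap ℝ A)]; exact algebraMap_mono A hlt.le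
      have h5 := le_antisymm h4 (hx.trans hm')
      rw [map_eq_zero_iff _ (FaithfulSMul.algebraMap_injective ℝ A)] at h5
      exact hlt.ne h5
    have := (CStarAlgebra.norm_le_iff_le_algebraMap x hle hx).mpr hm'
    linarith
  obtain ⟨f, hf⟩ := RCLike.geometric_hahn_banach_open_point (𝕜 := ℂ) hSconv.interior
    isOpen_interior hnot
  set y := algebraMap ℝ A c - x with hy
  have hfy : ∀ a ∈ interior S, (f a).re < (f y).re := hf
  have hfsmul : ∀ (t : ℝ) a, (f (t • a)).re = t * (f a).re := fun t a => by
    rw [← Complex.coe_smul, map_smul, smul_eq_mul, Complex.re_ofReal_mul]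
  have hneg : ∀ a ∈ S, (f a).re ≤ 0 := by
    intro a ha
    by_contra! hpos
    have key : ∀ t : ℝ, 0 ≤ t → (f 1).re + t * (f a).re < (f y).re := fun t ht => by
      have hmem : 1 + t • a ∈ interior S := by
        refine interior_maximal (s := S) (t := (fun b => b + t • a) '' interior S) ?_
          ((Homeomorph.addRight (t • a)).isOpenMap _ isOpen_interior) ⟨1, h1int, rfl⟩
        rintro _ ⟨b, hb, rfl⟩
        exact hSadd _ _ (interior_subset hb) (hSsmul t a ht ha)
      have := hfy _ hmem
      rwa [map_add, Complex.add_re, hfsmul] at this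
    have h0 := key 0 le_rfl
    have h1 := key (((f y).re - (f 1).re) / (f a).re) (div_nonneg (by linarith) hpos.le)
    rw [div_mul_cancel₀ _ hpos.ne'] at h1
    linarith
  have hf1y := hfy 1 h1int
  have hy0 : (f y).re = 0 := by
    refine le_antisymm (hneg y (hSpos y hcx)) ?_
    by_contra! hlt
    have hf1 : (f 1).re < 0 := hf1y.trans hlt
    have hmem : ((f y).re / (f 1).re) • (1 : A) ∈ interior S := by
      have ht : 0 < (f y).re / (f 1).re := div_pos_of_neg_of_neg hlt hf1
      refine interior_maximal (s := S)
        (t := (fun b => ((f y).re / (f 1).re) • b) '' interior S) ?_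
        ((Homeomorph.smulOfNeZero _ ht.ne').isOpenMap _ isOpen_interior) ⟨1, h1int, rfl⟩
      rintro _ ⟨b, hb, rfl⟩
      exact hSsmul _ _ ht.le (interior_subset hb)
    have := hfy _ hmem
    rw [hfsmul, div_mul_cancel₀ _ hf1.ne] at this
    exact lt_irrefl _ this
  rw [hy0] at hf1y
  have hreal : ∀ a, star a = a → (f a).im = 0 := by
    intro a ha
    have hI : ∀ s : ℝ, ((s : ℂ) * Complex.I) • a ∈ S := fun s => by
      change 0 ≤ _ + star _
      rw [star_smul, ha, ← add_smul]
      simp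
    have h1 := hneg _ (hI 1)
    have h2 := hneg _ (hI (-1))
    rw [map_smul] at h1 h2
    simp at h1 h2
    linarith
  set d := (f 1).re with hd
  have hf1 : f 1 = d := Complex.ext rfl (by rw [hreal 1 (star_one A)]; simp)
  have hfy0 : f y = 0 := Complex.ext hy0 (by
    rw [hreal y (IsSelfAdjoint.of_nonneg hcx).star_eq]; rfl)
  have hd0 : (d : ℂ) ≠ 0 := by exact_mod_cast hf1y.ne
  refine ⟨PositiveLinearMap.mk₀ ((d : ℂ)⁻¹ • (f : A →ₗ[ℂ] ℂ)) fun a ha => ?_, ?_, ?_⟩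
  · have hfa : f a = (f a).re :=
      Complex.ext rfl (by rw [hreal a (IsSelfAdjoint.of_nonneg ha).star_eq]; simp)
    change 0 ≤ (d : ℂ)⁻¹ * f a
    rw [hfa, ← Complex.ofReal_inv, ← Complex.ofReal_mul, Complex.zero_le_real]
    exact mul_nonneg_of_nonpos_of_nonpos (inv_nonpos.mpr hf1y.le) (hneg a (hSpos a ha))
  · change (d : ℂ)⁻¹ * f 1 = 1
    rw [hf1, inv_mul_cancel₀ hd0]
  · change (d : ℂ)⁻¹ * f x = c
    have hx' : x = (c : ℂ) • 1 - y := by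
      rw [hy, Algebra.algebraMap_eq_smul_one, Complex.coe_smul]; abel
    rw [hx', map_sub, map_smul, hfy0, hf1, smul_eq_mul, sub_zero]
    field_simp

/-- Representations on Hilbert spaces detect the norm: take the GNS representation of a state `f`
with `f (x⋆ x) = ‖x‖ ^ 2`. -/
theorem exists_rep_norm_le [Nontrivial A] (x : A) :
    ∃ (H : Type) (_ : NormedAddCommGroup H) (_ : InnerProductSpace ℂ H) (_ : CompleteSpace H)
      (π : A →⋆ₐ[ℂ] (H →L[ℂ] H)), ‖x‖ ≤ ‖π x‖ := by
  let _ : PartialOrder A := CStarAlgebra.spectralOrder A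
  let _ : StarOrderedRing A := CStarAlgebra.spectralOrderedRing A
  obtain ⟨f, hf1, hf⟩ := exists_state_apply_eq_norm (star x * x) (star_mul_self_nonneg x)
  refine ⟨f.GNS, inferInstance, inferInstance, inferInstance, f.gnsStarAlgHom, ?_⟩
  let ξ : f.PreGNS := f.toPreGNS 1
  have h1 : ‖(ξ : f.GNS)‖ = 1 := by
    rw [UniformSpace.Completion.norm_coe, f.preGNS_norm_def]
    simp [ξ, hf1]
  have h2 : ‖f.gnsStarAlgHom x (ξ : f.GNS)‖ = ‖x‖ := by
    have : f.gnsStarAlgHom x (ξ : f.GNS) = ((f.toPreGNS x : f.PreGNS) : f.GNS) := by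
      change f.gnsNonUnitalStarAlgHom x (ξ : f.GNS) = _
      rw [f.gnsNonUnitalStarAlgHom_apply_coe]
      simp [ξ]
    rw [this, UniformSpace.Completion.norm_coe, f.preGNS_norm_def]
    simp only [f.ofPreGNS_toPreGNS, hf, Complex.ofReal_re]
    rw [CStarRing.norm_star_mul_self, Real.sqrt_mul_self (norm_nonneg x)]
  calc ‖x‖ = ‖f.gnsStarAlgHom x (ξ : f.GNS)‖ := h2.symm
    _ ≤ ‖f.gnsStarAlgHom x‖ * ‖(ξ : f.GNS)‖ := ContinuousLinearMap.le_opNorm _ _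
    _ = _ := by rw [h1, mul_one]

end States

namespace MinTensor

variable {A B : Type} [CStarAlgebra A] [CStarAlgebra B]

/-- The slice map `a ⊗ b ↦ χ(b) a` on the algebraic tensor product. -/
def sliceAlg (χ : B →⋆ₐ[ℂ] ℂ) : A ⊗[ℂ] B →⋆ₐ[ℂ] A where
  __ := Algebra.TensorProduct.lift (AlgHom.id ℂ A) ((Algebra.ofId ℂ A).comp χ.toAlgHom)
    fun a b => Algebra.commute_algebraMap_right (χ b) a
  map_star' x := by
    induction x using TensorProduct.induction_on with
    | zero => 
      rw [star_zero]
      exact (map_zero _).trans ((star_zero A).symm.trans (congrArg star (map_zero _).symm))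
    | add x y hx hy =>
      rw [star_add]
      refine (map_add _ _ _).trans ((congrArg₂ (· + ·) hx hy).trans ?_)
      rw [← star_add]
      exact congrArg star (map_add _ _ _).symm
    | tmul a b =>
      rw [TensorProduct.star_tmul]
      change star a * algebraMap ℂ A (χ (star b)) = star (a * algebraMap ℂ A (χ b))
      rw [star_mul, map_star, ← algebraMap_star_comm]
      exact (Algebra.commutes _ _).symm

theorem sliceAlg_tmul (χ : B →⋆ₐ[ℂ] ℂ) (a : A) (b : B) :
    sliceAlg χ (a ⊗ₜ[ℂ] b) = a * algebraMap ℂ A (χ b) := rfl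

/-- Slice maps are bounded for the minimal norm: if `π` is a representation of `A`, then
`π ∘ (id ⊗ χ)` is unitarily equivalent to `π ⊗ χ` acting on `H ⊗ ℂ`. -/
theorem norm_sliceAlg_le (χ : B →⋆ₐ[ℂ] ℂ) (x : A ⊗[ℂ] B) :
    ‖sliceAlg χ x‖ ≤ seminorm A B x := by
  rcases subsingleton_or_nontrivial A with h | h
  · rw [Subsingleton.elim (sliceAlg χ x) 0, norm_zero]; exact (seminorm A B).nonneg x
  obtain ⟨H, _, _, _, π, hπ⟩ := exists_rep_norm_le (sliceAlg χ x)
  let ρ : B →⋆ₐ[ℂ] (ℂ →L[ℂ] ℂ) := StarAlgHom.comp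
    { Algebra.ofId ℂ (ℂ →L[ℂ] ℂ) with
      map_star' := fun z => algebraMap_star_comm (A := ℂ →L[ℂ] ℂ) z } χ
  have hρ : ∀ b z, ρ b z = χ b * z := fun b z => by
    change (algebraMap ℂ (ℂ →L[ℂ] ℂ) (χ b)) z = _
    rw [Algebra.algebraMap_eq_smul_one]; rfl
  refine hπ.trans (le_trans ?_ (le_csSup (bddAbove A B x) ⟨spatialSeminorm π ρ,
    ⟨H, ℂ, _, _, inferInstance, _, _, inferInstance, π, ρ, rfl⟩, rfl⟩))
  change _ ≤ ‖rep π ρ x‖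
  refine ContinuousLinearMap.opNorm_le_bound _ (rep π ρ x).opNorm_nonneg fun ξ => ?_
  have key : rep π ρ x (ξ ⊗ₜ (1 : ℂ)) = (π (sliceAlg χ x) ξ) ⊗ₜ (1 : ℂ) := by
    clear hπ
    induction x using TensorProduct.induction_on with
    | zero => simp
    | add x y hx hy =>
      rw [map_add, map_add, map_add, add_apply, add_apply, hx, hy,
        TensorProduct.add_tmul]
    | tmul a b =>
      rw [rep_tmul, TensorProduct.mapL_tmul, hρ, sliceAlg_tmul, ← Algebra.commutes,
        ← Algebra.smul_def, map_smul, ← smul_eq_mul, ← TensorProduct.smul_tmul]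
      rfl
  have h1 : ∀ η : H, ‖η ⊗ₜ[ℂ] (1 : ℂ)‖ = ‖η‖ := fun η => by
    rw [TensorProduct.norm_tmul, norm_one, mul_one]
  rw [← h1, ← key, ← h1 ξ]
  exact ContinuousLinearMap.le_opNorm _ _

/-- The slice map `a ⊗ b ↦ χ(b) a` on the minimal tensor product. -/
def slice (χ : B →⋆ₐ[ℂ] ℂ) : MinTensor A B →⋆ₐ[ℂ] A :=
  (seminorm A B).lift (sliceAlg χ) (norm_sliceAlg_le χ)

theorem slice_tmul (χ : B →⋆ₐ[ℂ] ℂ) (a : A) (b : B) :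
    slice χ (tmul a b) = a * algebraMap ℂ A (χ b) :=
  CStarSeminorm.lift_of _ _ _ _

end MinTensor

/-! ### Matrices over C⋆-algebras -/

section Matrices

variable {A B : Type} [CStarAlgebra A] [CStarAlgebra B] {ι κ : Type} [Fintype ι] [DecidableEq ι]
  [Fintype κ] [DecidableEq κ]

theorem star_map_matrix (φ : A →⋆ₐ[ℂ] B) (W : Matrix ι ι A) :
    star (W.map φ) = (star W).map φ := by
  ext i j
  exact (map_star φ _).symm

theorem map_mem_unitary (φ : A →⋆ₐ[ℂ] B) {W : Matrix ι ι A} (hW : W ∈ unitary (Matrix ι ι A)) :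
    W.map φ ∈ unitary (Matrix ι ι B) := by
  rw [Unitary.mem_iff] at hW ⊢
  have h1 : (1 : Matrix ι ι A).map φ = 1 := Matrix.map_one φ (map_zero φ) (map_one φ)
  rw [star_map_matrix, ← Matrix.map_mul, ← Matrix.map_mul, hW.1, hW.2]
  exact ⟨h1, h1⟩

theorem isUnit_map_star_of_map (φ : A →⋆ₐ[ℂ] B) {W : Matrix ι ι A} (hW : IsUnit (W.map star)) :
    IsUnit ((W.map φ).map star) := by
  have h : (W.map φ).map star = (W.map star).map φ := by
    ext i j
    exact (map_star φ _).symm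
  rw [h]
  exact hW.map (φ : A →+* B).mapMatrix

theorem fromBlocks_mem_unitary {X : Matrix ι ι A} {Y : Matrix κ κ A}
    (hX : X ∈ unitary (Matrix ι ι A)) (hY : Y ∈ unitary (Matrix κ κ A)) :
    Matrix.fromBlocks X 0 0 Y ∈ unitary (Matrix (ι ⊕ κ) (ι ⊕ κ) A) := by
  rw [Unitary.mem_iff, Matrix.star_eq_conjTranspose] at *
  rw [Matrix.fromBlocks_conjTranspose, Matrix.fromBlocks_multiply, Matrix.fromBlocks_multiply]
  simp [hX.1, hX.2, hY.1, hY.2]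

theorem isUnit_map_star_fromBlocks {X : Matrix ι ι A} {Y : Matrix κ κ A}
    (hX : IsUnit (X.map star)) (hY : IsUnit (Y.map star)) :
    IsUnit ((Matrix.fromBlocks X 0 0 Y).map star) := by
  obtain ⟨X', h1, h2⟩ := isUnit_iff_exists.mp hX
  obtain ⟨Y', h3, h4⟩ := isUnit_iff_exists.mp hY
  have h0 : ∀ (m n : Type), (0 : Matrix m n A).map star = 0 := fun m n => by ext; simp
  rw [Matrix.fromBlocks_map, h0, h0]
  refine isUnit_iff_exists.mpr ⟨Matrix.fromBlocks X' 0 0 Y', ?_, ?_⟩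
  · rw [Matrix.fromBlocks_multiply]; simp [h1, h3]
  · rw [Matrix.fromBlocks_multiply]; simp [h2, h4]

theorem IsOrthogonal.map_star_eq {u : Matrix ι ι A} (hu : IsOrthogonal u) : u.map star = u := by
  ext i j; exact hu.1 i j

theorem IsOrthogonal.isUnit_map_star {u : Matrix ι ι A} (hu : IsOrthogonal u) :
    IsUnit (u.map star) := by
  rw [hu.map_star_eq]
  exact isUnit_iff_exists.mpr ⟨star u, (Unitary.mem_iff.mp hu.2).2, (Unitary.mem_iff.mp hu.2).1⟩

theorem IsOrthogonal.star_eq_transpose {u : Matrix ι ι A} (hu : IsOrthogonal u) :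
    star u = u.transpose := by
  ext i j; exact hu.1 j i

theorem IsOrthogonal.mul_transpose {u : Matrix ι ι A} (hu : IsOrthogonal u) :
    u * u.transpose = 1 := by
  rw [← hu.star_eq_transpose]; exact (Unitary.mem_iff.mp hu.2).2

theorem IsOrthogonal.transpose_mul {u : Matrix ι ι A} (hu : IsOrthogonal u) :
    u.transpose * u = 1 := by
  rw [← hu.star_eq_transpose]; exact (Unitary.mem_iff.mp hu.2).1

theorem isOrthogonal_iff {u : Matrix ι ι A} :
    IsOrthogonal u ↔ (∀ i j, star (u i j) = u i j) ∧ u.transpose * u = 1 ∧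
      u * u.transpose = 1 := by
  refine ⟨fun h => ⟨h.1, h.transpose_mul, h.mul_transpose⟩, fun h => ⟨h.1, ?_⟩⟩
  have : star u = u.transpose := by ext i j; exact h.1 j i
  rw [Unitary.mem_iff, this]; exact h.2

theorem map_fromBlocks_diag (φ : A →⋆ₐ[ℂ] B) (X : Matrix ι ι A) (Y : Matrix κ κ A) :
    (Matrix.fromBlocks X 0 0 Y).map φ = Matrix.fromBlocks (X.map φ) 0 0 (Y.map φ) := by
  rw [Matrix.fromBlocks_map, Matrix.map_zero _ (map_zero φ), Matrix.map_zero _ (map_zero φ)]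

/-- The matrix `(∑ k, u_ik ⊗ u_kj)` over `A ⊗_min A`. -/
def comulMatrix (u : Matrix ι ι A) : Matrix ι ι (MinTensor A A) :=
  u.map MinTensor.inl * u.map MinTensor.inr

theorem comulMatrix_apply (u : Matrix ι ι A) (i j : ι) :
    comulMatrix u i j = ∑ k, MinTensor.tmul (u i k) (u k j) := by
  rw [comulMatrix, Matrix.mul_apply]
  exact Finset.sum_congr rfl fun k _ => MinTensor.inl_mul_inr _ _

theorem comulMatrix_map (φ : A →⋆ₐ[ℂ] B) (u : Matrix ι ι A) :
    comulMatrix (u.map φ) = (comulMatrix u).map (MinTensor.map φ φ) := by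
  rw [comulMatrix, comulMatrix, Matrix.map_mul, Matrix.map_map, Matrix.map_map, Matrix.map_map,
    Matrix.map_map]
  congr 1 <;> ext i j <;> simp

theorem comulMatrix_fromBlocks (X : Matrix ι ι A) (Y : Matrix κ κ A) :
    comulMatrix (Matrix.fromBlocks X 0 0 Y) =
      Matrix.fromBlocks (comulMatrix X) 0 0 (comulMatrix Y) := by
  simp [comulMatrix, Matrix.fromBlocks_map, Matrix.fromBlocks_multiply, Matrix.map_zero]

theorem IsOrthogonal.comulMatrix {u : Matrix ι ι A} (hu : IsOrthogonal u) :
    IsOrthogonal (comulMatrix u) := by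
  refine ⟨fun i j => ?_, mul_mem (map_mem_unitary _ hu.2) (map_mem_unitary _ hu.2)⟩
  rw [FreeQG.comulMatrix, Matrix.mul_apply, star_sum]
  refine Finset.sum_congr rfl fun k _ => ?_
  rw [star_mul, Matrix.map_apply, Matrix.map_apply, ← map_star, ← map_star, hu.1, hu.1]
  exact (MinTensor.commute_inl_inr _ _).eq.symm

theorem HasSums.comulMatrix {u : Matrix ι ι A} {z : A} (hu : HasSums z u) :
    HasSums (MinTensor.tmul z z) (comulMatrix u) := by
  simp only [HasSums, FreeQG.comulMatrix, Matrix.mul_apply, Matrix.map_apply]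
  refine ⟨fun i => ?_, fun j => ?_⟩
  · rw [Finset.sum_comm]
    simp_rw [← Finset.mul_sum, ← map_sum, hu.1, ← Finset.sum_mul, ← map_sum, hu.1,
      MinTensor.inl_mul_inr]
  · rw [Finset.sum_comm]
    simp_rw [← Finset.sum_mul, ← map_sum, hu.2, ← Finset.mul_sum, ← map_sum, hu.2,
      MinTensor.inl_mul_inr]

end Matrices

/-! ### Compact matrix quantum groups and their corepresentations -/

/-- `W` is a corepresentation for `Δ`: `Δ(w_ij) = ∑ k, w_ik ⊗ w_kj`. -/
def IsCorep {A : Type} [CStarAlgebra A] {ι : Type} [Fintype ι] [DecidableEq ι]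
    (Δ : A →⋆ₐ[ℂ] MinTensor A A) (W : Matrix ι ι A) : Prop :=
  W.map Δ = comulMatrix W

theorem isCorep_unit {A : Type} [CStarAlgebra A] {Δ : A →⋆ₐ[ℂ] MinTensor A A} {r : A} :
    IsCorep Δ (Matrix.of fun _ _ : Unit => r) ↔ Δ r = MinTensor.tmul r r := by
  refine ⟨fun h => ?_, fun h => ?_⟩
  · have := congrFun (congrFun h ()) ()
    rw [comulMatrix_apply] at this
    simpa using this
  · ext i j
    rw [comulMatrix_apply]
    simpa using h

/-- Morphisms of quantum groups map corepresentations to corepresentations. -/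
theorem IsCorep.map {A B : Type} [CStarAlgebra A] [CStarAlgebra B] {ι : Type} [Fintype ι]
    [DecidableEq ι] {ΔA : A →⋆ₐ[ℂ] MinTensor A A} {ΔB : B →⋆ₐ[ℂ] MinTensor B B}
    {W : Matrix ι ι A} (hW : IsCorep ΔA W) (φ : A →⋆ₐ[ℂ] B)
    (hφ : ∀ x, ΔB (φ x) = MinTensor.map φ φ (ΔA x)) : IsCorep ΔB (W.map φ) := by
  rw [IsCorep, comulMatrix_map, ← show W.map ΔA = _ from hW]
  ext i j
  exact hφ _

theorem isCorep_fromBlocks_iff {A : Type} [CStarAlgebra A] {ι κ : Type} [Fintype ι]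
    [DecidableEq ι] [Fintype κ] [DecidableEq κ] {Δ : A →⋆ₐ[ℂ] MinTensor A A} {X : Matrix ι ι A}
    {Y : Matrix κ κ A} :
    IsCorep Δ (Matrix.fromBlocks X 0 0 Y) ↔ IsCorep Δ X ∧ IsCorep Δ Y := by
  rw [IsCorep, comulMatrix_fromBlocks, map_fromBlocks_diag, Matrix.fromBlocks_inj]
  simp [IsCorep]

/-- The sum of a row or column is group-like. -/
theorem IsCorep.apply_sum {A : Type} [CStarAlgebra A] {ι : Type} [Fintype ι] [DecidableEq ι]
    {Δ : A →⋆ₐ[ℂ] MinTensor A A} {W : Matrix ι ι A} (hW : IsCorep Δ W) {z : A}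
    (hz : HasSums z W) [Nonempty ι] : Δ z = MinTensor.tmul z z := by
  obtain ⟨i⟩ := ‹Nonempty ι›
  have h : Δ (∑ j, W i j) = _ := (map_sum Δ _ _).trans
    ((Finset.sum_congr rfl fun j _ => congrFun (congrFun hW i) j).trans (hz.comulMatrix.1 i))
  rwa [hz.1 i] at h

namespace MatrixPair

variable {ι κ : Type} [Fintype ι] [DecidableEq ι] [Fintype κ] [DecidableEq κ]

theorem isComultiplication_iff {G : MatrixPair ι} {Δ : G.A →⋆ₐ[ℂ] MinTensor G.A G.A} :
    G.IsComultiplication Δ ↔ IsCorep Δ G.U := by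
  refine ⟨fun h => ?_, fun h i j => ?_⟩
  · ext i j
    rw [comulMatrix_apply]; exact h i j
  · rw [← comulMatrix_apply]; exact congrFun (congrFun h i) j

/-- The set of entries of the fundamental corepresentation. -/
def entries (G : MatrixPair ι) : Set G.A := {x | ∃ i j, x = G.U i j}

/-- The structure of a compact matrix quantum group is transported along a ⋆-isomorphism `ψ`, with
inverse `ψ'`, that maps some corepresentation `V` of `G` to the fundamental corepresentation of `H`. -/
theorem isomorphic_of_homs {G : MatrixPair ι} {H : MatrixPair κ}
    (hG : G.IsCompactMatrixQuantumGroup) (ψ : G.A →⋆ₐ[ℂ] H.A) (ψ' : H.A →⋆ₐ[ℂ] G.A)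
    (h1 : ψ'.comp ψ = StarAlgHom.id ℂ G.A) (h2 : ψ.comp ψ' = StarAlgHom.id ℂ H.A)
    (V : Matrix κ κ G.A)
    (hV : V.map ψ = H.U) (hcorep : ∀ Δ, G.IsComultiplication Δ → IsCorep Δ V)
    (hgen : Generates H.entries) (hunit : H.U ∈ unitary (Matrix κ κ H.A))
    (hconj : IsUnit (H.U.map star)) : G.Isomorphic H := by
  obtain ⟨ΔG, hΔG⟩ := hG.comultiplication
  let ΔH : H.A →⋆ₐ[ℂ] MinTensor H.A H.A := ((MinTensor.map ψ ψ).comp ΔG).comp ψ'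
  have hφ : ∀ x, ΔH (ψ x) = MinTensor.map ψ ψ (ΔG x) := fun x => by
    change MinTensor.map ψ ψ (ΔG ((ψ'.comp ψ) x)) = _
    rw [h1]; rfl
  have hΔH : H.IsComultiplication ΔH := by
    rw [isComultiplication_iff, ← hV]
    exact (hcorep ΔG hΔG).map ψ hφ
  exact ⟨hG, ⟨hunit, hgen, ⟨ΔH, hΔH⟩, hconj⟩, ΔG, ΔH, hΔG, hΔH,
    StarAlgEquiv.ofStarAlgHom ψ ψ' h1 h2, hφ⟩

theorem Isomorphic.symm {G : MatrixPair ι} {H : MatrixPair κ} (h : G.Isomorphic H) :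
    H.Isomorphic G := by
  obtain ⟨hG, hH, ΔG, ΔH, hΔG, hΔH, φ, hφ⟩ := h
  refine ⟨hH, hG, ΔH, ΔG, hΔH, hΔG, φ.symm, fun y => ?_⟩
  obtain ⟨x, rfl⟩ : ∃ x, φ x = y := ⟨φ.symm y, φ.apply_symm_apply y⟩
  have h1 : (φ.symm : H.A →⋆ₐ[ℂ] G.A).comp (φ : G.A →⋆ₐ[ℂ] H.A) = StarAlgHom.id ℂ G.A := by
    ext x; exact φ.symm_apply_apply x
  rw [hφ, MinTensor.map_map, h1, MinTensor.map_id, φ.symm_apply_apply]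

/-- ⋆-homomorphisms are determined by their values on the entries. -/
theorem hom_ext {G : MatrixPair ι} (hG : Generates G.entries) {C : Type} [CStarAlgebra C]
    {φ ψ : G.A →⋆ₐ[ℂ] C} (h : G.U.map φ = G.U.map ψ) : φ = ψ :=
  hG.hom_ext (by rintro _ ⟨i, j, rfl⟩; exact congrFun (congrFun h i) j)

theorem generates_freeProduct {G : MatrixPair ι} {H : MatrixPair κ} (hG : Generates G.entries)
    (hH : Generates H.entries) : Generates (G.freeProduct H).entries := by
  refine generates_of_forall_mem fun D hD h => ?_
  refine (FreeProduct.generates_of_generates hG hH).mem D hD ?_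
  rintro _ (⟨_, ⟨i, j, rfl⟩, rfl⟩ | ⟨_, ⟨i, j, rfl⟩, rfl⟩)
  · exact h _ ⟨Sum.inl i, Sum.inl j, rfl⟩
  · exact h _ ⟨Sum.inr i, Sum.inr j, rfl⟩

theorem generates_directSum {G : MatrixPair ι} {H : MatrixPair κ} (hG : Generates G.entries)
    (hH : Generates H.entries) : Generates (G.directSum H).entries := by
  refine generates_of_forall_mem fun D hD h => ?_
  refine (MinTensor.generates_of_generates hG hH).mem D hD ?_
  rintro _ (⟨_, ⟨i, j, rfl⟩, rfl⟩ | ⟨_, ⟨i, j, rfl⟩, rfl⟩)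
  · exact h _ ⟨Sum.inl i, Sum.inl j, rfl⟩
  · exact h _ ⟨Sum.inr i, Sum.inr j, rfl⟩

theorem freeProduct_U_mem_unitary {G : MatrixPair ι} {H : MatrixPair κ}
    (hG : G.U ∈ unitary (Matrix ι ι G.A)) (hH : H.U ∈ unitary (Matrix κ κ H.A)) :
    (G.freeProduct H).U ∈ unitary (Matrix (ι ⊕ κ) (ι ⊕ κ) (G.freeProduct H).A) :=
  fromBlocks_mem_unitary (map_mem_unitary FreeProduct.inlHom hG)
    (map_mem_unitary FreeProduct.inrHom hH)

theorem isUnit_freeProduct_U_map_star {G : MatrixPair ι} {H : MatrixPair κ}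
    (hG : IsUnit (G.U.map star)) (hH : IsUnit (H.U.map star)) :
    IsUnit ((G.freeProduct H).U.map star) :=
  isUnit_map_star_fromBlocks (isUnit_map_star_of_map FreeProduct.inlHom hG)
    (isUnit_map_star_of_map FreeProduct.inrHom hH)

theorem directSum_U_mem_unitary {G : MatrixPair ι} {H : MatrixPair κ}
    (hG : G.U ∈ unitary (Matrix ι ι G.A)) (hH : H.U ∈ unitary (Matrix κ κ H.A)) :
    (G.directSum H).U ∈ unitary (Matrix (ι ⊕ κ) (ι ⊕ κ) (G.directSum H).A) :=
  fromBlocks_mem_unitary (map_mem_unitary MinTensor.inl hG) (map_mem_unitary MinTensor.inr hH)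

theorem isUnit_directSum_U_map_star {G : MatrixPair ι} {H : MatrixPair κ}
    (hG : IsUnit (G.U.map star)) (hH : IsUnit (H.U.map star)) :
    IsUnit ((G.directSum H).U.map star) :=
  isUnit_map_star_fromBlocks (isUnit_map_star_of_map MinTensor.inl hG)
    (isUnit_map_star_of_map MinTensor.inr hH)

theorem isomorphic_freeProduct_of_homs {ν : Type} [Fintype ν] [DecidableEq ν]
    {G : MatrixPair ν} {K : MatrixPair ι} {L : MatrixPair κ}
    (hG : G.IsCompactMatrixQuantumGroup) (ψ : G.A →⋆ₐ[ℂ] FreeProduct K.A L.A)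
    (ψ' : FreeProduct K.A L.A →⋆ₐ[ℂ] G.A)
    (h1 : ψ'.comp ψ = StarAlgHom.id ℂ G.A)
    (h2 : ψ.comp ψ' = StarAlgHom.id ℂ (FreeProduct K.A L.A))
    (X : Matrix ι ι G.A) (Y : Matrix κ κ G.A) (hX : X.map ψ = K.U.map FreeProduct.inlHom)
    (hY : Y.map ψ = L.U.map FreeProduct.inrHom)
    (hcorep : ∀ Δ, G.IsComultiplication Δ → IsCorep Δ X ∧ IsCorep Δ Y)
    (hKgen : Generates K.entries) (hLgen : Generates L.entries)
    (hKunit : K.U ∈ unitary (Matrix ι ι K.A)) (hLunit : L.U ∈ unitary (Matrix κ κ L.A))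
    (hKconj : IsUnit (K.U.map star)) (hLconj : IsUnit (L.U.map star)) :
    G.Isomorphic (K.freeProduct L) := by
  refine isomorphic_of_homs (H := K.freeProduct L) hG ψ ψ' h1 h2 (Matrix.fromBlocks X 0 0 Y) ?_
    (fun Δ hΔ => isCorep_fromBlocks_iff.mpr (hcorep Δ hΔ))
    (generates_freeProduct hKgen hLgen) (freeProduct_U_mem_unitary hKunit hLunit)
    (isUnit_freeProduct_U_map_star hKconj hLconj)
  have h := map_fromBlocks_diag ψ X Y
  rw [hX, hY] at h
  exact h

theorem isomorphic_directSum_of_homs {ν : Type} [Fintype ν] [DecidableEq ν]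
    {G : MatrixPair ν} {K : MatrixPair ι} {L : MatrixPair κ}
    (hG : G.IsCompactMatrixQuantumGroup) (ψ : G.A →⋆ₐ[ℂ] MinTensor K.A L.A)
    (ψ' : MinTensor K.A L.A →⋆ₐ[ℂ] G.A)
    (h1 : ψ'.comp ψ = StarAlgHom.id ℂ G.A)
    (h2 : ψ.comp ψ' = StarAlgHom.id ℂ (MinTensor K.A L.A))
    (X : Matrix ι ι G.A) (Y : Matrix κ κ G.A) (hX : X.map ψ = K.U.map MinTensor.inl)
    (hY : Y.map ψ = L.U.map MinTensor.inr)
    (hcorep : ∀ Δ, G.IsComultiplication Δ → IsCorep Δ X ∧ IsCorep Δ Y)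
    (hKgen : Generates K.entries) (hLgen : Generates L.entries)
    (hKunit : K.U ∈ unitary (Matrix ι ι K.A)) (hLunit : L.U ∈ unitary (Matrix κ κ L.A))
    (hKconj : IsUnit (K.U.map star)) (hLconj : IsUnit (L.U.map star)) :
    G.Isomorphic (K.directSum L) := by
  refine isomorphic_of_homs (H := K.directSum L) hG ψ ψ' h1 h2 (Matrix.fromBlocks X 0 0 Y) ?_
    (fun Δ hΔ => isCorep_fromBlocks_iff.mpr (hcorep Δ hΔ))
    (generates_directSum hKgen hLgen) (directSum_U_mem_unitary hKunit hLunit)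
    (isUnit_directSum_U_map_star hKconj hLconj)
  have h := map_fromBlocks_diag ψ X Y
  rw [hX, hY] at h
  exact h

theorem IsCompactMatrixQuantumGroup.freeProduct {G : MatrixPair ι} {H : MatrixPair κ}
    (hG : G.IsCompactMatrixQuantumGroup) (hH : H.IsCompactMatrixQuantumGroup) :
    (G.freeProduct H).IsCompactMatrixQuantumGroup where
  unitary := freeProduct_U_mem_unitary hG.unitary hH.unitary
  generated := generates_freeProduct hG.generated hH.generated
  conj_invertible := isUnit_freeProduct_U_map_star hG.conj_invertible hH.conj_invertible
  comultiplication := by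
    obtain ⟨ΔG, hΔG⟩ := hG.comultiplication
    obtain ⟨ΔH, hΔH⟩ := hH.comultiplication
    rw [isComultiplication_iff] at hΔG hΔH
    refine ⟨FreeProduct.lift
      ((MinTensor.map FreeProduct.inlHom FreeProduct.inlHom).comp ΔG)
      ((MinTensor.map FreeProduct.inrHom FreeProduct.inrHom).comp ΔH), ?_⟩
    refine isComultiplication_iff.mpr ((isCorep_fromBlocks_iff (A := FreeProduct G.A H.A)
      (X := G.U.map (FreeProduct.inlHom : G.A →⋆ₐ[ℂ] FreeProduct G.A H.A))
      (Y := H.U.map (FreeProduct.inrHom : H.A →⋆ₐ[ℂ] FreeProduct G.A H.A))).mpr ⟨?_, ?_⟩)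
    · exact hΔG.map _ fun _ => FreeProduct.lift_inl _ _ _
    · exact hΔH.map _ fun _ => FreeProduct.lift_inr _ _ _

end MatrixPair

/-- If the relations `P` pass to `(∑ k, u_ik ⊗ u_kj)`, then the comultiplication exists by the
universal property. -/
theorem isCompactMatrixQuantumGroup_universalPair (n : ℕ)
    (P : ∀ (C : Type) [CStarAlgebra C], Matrix (Fin n) (Fin n) C → Prop)
    (hP : ∀ (C : Type) [CStarAlgebra C] (u : Matrix (Fin n) (Fin n) C), P C u → IsOrthogonal u)
    (hgen : P _ (universalPair n P hP).U) (hΔ : P _ (comulMatrix (universalPair n P hP).U)) :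
    (universalPair n P hP).IsCompactMatrixQuantumGroup where
  unitary := (hP _ _ hgen).2
  generated := by
    refine generates_of_forall_mem fun D hD h => ?_
    refine (matrixRelations n P hP).generates_gen.mem D hD ?_
    rintro _ ⟨⟨i, j⟩, rfl⟩
    exact h _ ⟨i, j, rfl⟩
  conj_invertible := (hP _ _ hgen).isUnit_map_star
  comultiplication := by
    refine ⟨(matrixRelations n P hP).lift (fun x => comulMatrix (universalPair n P hP).U x.1 x.2)
      hΔ, MatrixPair.isComultiplication_iff.mpr ?_⟩
    ext i j
    exact Relations.lift_gen _ _ hΔ _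

/-! ### Universal orthogonal matrices -/

section universalPair

variable {n : ℕ} {P : ∀ (C : Type) [CStarAlgebra C], Matrix (Fin n) (Fin n) C → Prop}
  {hP : ∀ (C : Type) [CStarAlgebra C] (u : Matrix (Fin n) (Fin n) C), P C u → IsOrthogonal u}

/-- The universal property of a universal pair. -/
theorem exists_hom_universalPair {C : Type} [CStarAlgebra C] (v : Matrix (Fin n) (Fin n) C)
    (hv : P C v) :
    ∃ φ : (universalPair n P hP).A →⋆ₐ[ℂ] C, (universalPair n P hP).U.map φ = v := by
  refine ⟨(matrixRelations n P hP).lift (fun x => v x.1 x.2) hv, ?_⟩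
  ext i j
  exact Relations.lift_gen _ _ hv _

/-- A ⋆-polynomial identity for the entries of `u` that follows from `P u` holds for the
universal `u`. -/
theorem universalPair_eq {a b : StarPoly (Fin n × Fin n)}
    (h : ∀ (C : Type) [CStarAlgebra C] (u : Matrix (Fin n) (Fin n) C), P C u →
      StarPoly.eval (fun x => u x.1 x.2) a = StarPoly.eval (fun x => u x.1 x.2) b) :
    StarPoly.eval (fun x => (universalPair n P hP).U x.1 x.2) a =
      StarPoly.eval (fun x => (universalPair n P hP).U x.1 x.2) b :=
  (matrixRelations n P hP).eval_gen_eq fun C _ f hf => h C (Matrix.of fun i j => f (i, j)) hf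

/-- The universal matrix is orthogonal. -/
theorem isOrthogonal_universalPair : IsOrthogonal (universalPair n P hP).U := by
  have hv : ∀ {C : Type} [CStarAlgebra C] (u : Matrix (Fin n) (Fin n) C) (i j : Fin n),
      StarPoly.eval (fun x : Fin n × Fin n => u x.1 x.2) (StarPoly.var (.inl (i, j))) = u i j :=
    fun u i j => StarPoly.eval_var _ _
  have h1 : ∀ i j, star ((universalPair n P hP).U i j) = (universalPair n P hP).U i j :=
    fun i j => by
      have := universalPair_eq (hP := hP) (a := star (StarPoly.var (.inl (i, j))))
        (b := StarPoly.var (.inl (i, j)))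
        fun C _ u hu => by rw [map_star, hv, (hP C u hu).1]
      rwa [map_star, hv] at this
  refine isOrthogonal_iff.mpr ⟨h1, ?_, ?_⟩
  · ext i j
    have := universalPair_eq (hP := hP)
      (a := ∑ k, StarPoly.var (.inl (k, i)) * StarPoly.var (.inl (k, j)))
      (b := if i = j then 1 else 0) fun C _ u hu => by
        have := congrFun (congrFun (hP C u hu).transpose_mul i) j
        rw [Matrix.mul_apply, Matrix.one_apply] at this
        simp only [Matrix.transpose_apply] at this
        simp only [map_sum, map_mul, hv, this]
        split_ifs <;> simp
    simp only [map_sum, map_mul, hv] at this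
    rw [Matrix.mul_apply, Matrix.one_apply]
    refine this.trans ?_
    split_ifs <;> simp
  · ext i j
    have := universalPair_eq (hP := hP)
      (a := ∑ k, StarPoly.var (.inl (i, k)) * StarPoly.var (.inl (j, k)))
      (b := if i = j then 1 else 0) fun C _ u hu => by
        have := congrFun (congrFun (hP C u hu).mul_transpose i) j
        rw [Matrix.mul_apply, Matrix.one_apply] at this
        simp only [Matrix.transpose_apply] at this
        simp only [map_sum, map_mul, hv, this]
        split_ifs <;> simp
    simp only [map_sum, map_mul, hv] at this
    rw [Matrix.mul_apply, Matrix.one_apply]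
    refine this.trans ?_
    split_ifs <;> simp

theorem hasPartialIsometryEntries_universalPair
    (h : ∀ (C : Type) [CStarAlgebra C] (u : Matrix (Fin n) (Fin n) C), P C u →
      HasPartialIsometryEntries u) : HasPartialIsometryEntries (universalPair n P hP).U :=
    fun i j => by
  have := universalPair_eq (hP := hP)
    (a := StarPoly.var (.inl (i, j)) * star (StarPoly.var (.inl (i, j))) *
      StarPoly.var (.inl (i, j)))
    (b := StarPoly.var (.inl (i, j)))
    fun C _ u hu => by simpa [map_star, StarPoly.eval_var] using h C u hu i j
  simpa [map_star, StarPoly.eval_var] using this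

theorem hasSums_one_universalPair
    (h : ∀ (C : Type) [CStarAlgebra C] (u : Matrix (Fin n) (Fin n) C), P C u →
      HasSums 1 u) : HasSums 1 (universalPair n P hP).U := by
  refine ⟨fun i => ?_, fun j => ?_⟩
  · have := universalPair_eq (hP := hP) (a := ∑ j, StarPoly.var (.inl (i, j))) (b := 1)
      fun C _ u hu => by simpa [StarPoly.eval_var] using (h C u hu).1 i
    simpa [StarPoly.eval_var] using this
  · have := universalPair_eq (hP := hP) (a := ∑ i, StarPoly.var (.inl (i, j))) (b := 1)
      fun C _ u hu => by simpa [StarPoly.eval_var] using (h C u hu).2 j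
    simpa [StarPoly.eval_var] using this

theorem exists_hasSums_universalPair (hn : 1 ≤ n)
    (h : ∀ (C : Type) [CStarAlgebra C] (u : Matrix (Fin n) (Fin n) C), P C u →
      ∃ z, HasSums z u) : ∃ z, HasSums z (universalPair n P hP).U := by
  let i₀ : Fin n := ⟨0, hn⟩
  refine ⟨∑ j, (universalPair n P hP).U i₀ j, fun i => ?_, fun j => ?_⟩
  · have := universalPair_eq (hP := hP) (a := ∑ j, StarPoly.var (.inl (i, j)))
      (b := ∑ j, StarPoly.var (.inl (i₀, j)))
      fun C _ u hu => by
        obtain ⟨z, hz⟩ := h C u hu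
        simpa [StarPoly.eval_var] using (hz.1 i).trans (hz.1 i₀).symm
    simpa [StarPoly.eval_var] using this
  · have := universalPair_eq (hP := hP) (a := ∑ i, StarPoly.var (.inl (i, j)))
      (b := ∑ j, StarPoly.var (.inl (i₀, j)))
      fun C _ u hu => by
        obtain ⟨z, hz⟩ := h C u hu
        simpa [StarPoly.eval_var] using (hz.2 j).trans (hz.1 i₀).symm
    simpa [StarPoly.eval_var] using this

end universalPair

/-! ### The duals of `ℤ` and `ℤ/2ℤ` -/

section circle

variable {C : Type} [CStarAlgebra C]

/-- The ⋆-homomorphism from `C(S¹)` given by a unitary: continuous functional calculus. -/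
def circleLift (w : C) (hw : w ∈ unitary C) : C(Circle, ℂ) →⋆ₐ[ℂ] C :=
  have : IsStarNormal w := ⟨by
    rw [Commute, SemiconjBy, (Unitary.mem_iff.mp hw).1, (Unitary.mem_iff.mp hw).2]⟩
  (cfcHom (R := ℂ) (a := w) this).comp (ContinuousMap.compStarAlgHom' ℂ ℂ
    ⟨fun x : spectrum ℂ w => (⟨x.1, spectrum.subset_circle_of_unitary hw x.2⟩ : Circle),
      by fun_prop⟩)

@[simp]
theorem circleLift_circleId (w : C) (hw : w ∈ unitary C) : circleLift w hw circleId = w := by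
  have : IsStarNormal w := ⟨by
    rw [Commute, SemiconjBy, (Unitary.mem_iff.mp hw).1, (Unitary.mem_iff.mp hw).2]⟩
  exact cfcHom_id (R := ℂ) (a := w) this

theorem circleId_mem_unitary : circleId ∈ unitary C(Circle, ℂ) := by
  rw [Unitary.mem_iff]
  constructor
  · ext z
    change star (z : ℂ) * z = 1
    simp [← Complex.normSq_eq_conj_mul_self]
  · ext z
    change (z : ℂ) * star (z : ℂ) = 1
    simp [Complex.mul_conj]

theorem generates_circleId : Generates ({circleId} : Set C(Circle, ℂ)) := by
  refine ContinuousMap.starSubalgebra_topologicalClosure_eq_top_of_separatesPoints _ ?_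
  intro x y hxy
  refine ⟨_, ⟨circleId, StarAlgebra.subset_adjoin ℂ _ rfl, rfl⟩, ?_⟩
  exact fun h => hxy (Circle.ext h)

end circle

theorem unit_mem_unitary {A : Type} [CStarAlgebra A] {z : A} (hz : z ∈ unitary A) :
    (Matrix.of fun _ _ : Unit => z) ∈ unitary (Matrix Unit Unit A) := by
  rw [Unitary.mem_iff] at *
  constructor
  · ext i j; simpa [Matrix.mul_apply] using hz.1
  · ext i j; simpa [Matrix.mul_apply] using hz.2

theorem isUnit_map_star_unit {A : Type} [CStarAlgebra A] {z : A} (hz : z ∈ unitary A) :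
    IsUnit ((Matrix.of fun _ _ : Unit => z).map star) := by
  have h : (Matrix.of fun _ _ : Unit => z).map star = star (Matrix.of fun _ _ : Unit => z) := by
    ext i j; rfl
  rw [h]
  have := Unitary.mem_iff.mp (unit_mem_unitary hz)
  exact isUnit_iff_exists.mpr ⟨_, this.1, this.2⟩

theorem generates_entries_unit {A : Type} [CStarAlgebra A] {z : A}
    (hz : Generates ({z} : Set A)) : Generates {x : A | ∃ _ _ : Unit, x = z} := by
  refine generates_of_forall_mem fun D hD h => hz.mem D hD ?_
  rintro _ rfl
  exact h _ ⟨(), (), rfl⟩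

theorem isCompactMatrixQuantumGroup_circle : circle.IsCompactMatrixQuantumGroup where
  unitary := unit_mem_unitary circleId_mem_unitary
  generated := generates_entries_unit generates_circleId
  conj_invertible := isUnit_map_star_unit circleId_mem_unitary
  comultiplication := by
    have hw : (MinTensor.tmul circleId circleId : MinTensor C(Circle, ℂ) C(Circle, ℂ)) ∈
        unitary _ := by
      rw [← MinTensor.inl_mul_inr]
      exact mul_mem (Unitary.map_mem MinTensor.inl circleId_mem_unitary)
        (Unitary.map_mem MinTensor.inr circleId_mem_unitary)
    exact ⟨circleLift _ hw, MatrixPair.isComultiplication_iff.mpr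
      (isCorep_unit.mpr (circleLift_circleId _ hw))⟩

theorem g2_mem_unitary : GroupCStar.g2 ∈ unitary (GroupCStar (Multiplicative (ZMod 2))) := by
  rw [Unitary.mem_iff, GroupCStar.star_g2]
  exact ⟨GroupCStar.g2_mul_g2, GroupCStar.g2_mul_g2⟩

theorem generates_entries_cstarZMod2 : Generates cstarZMod2.entries :=
  generates_entries_unit GroupCStar.generates_g2

theorem cstarZMod2_U_mem_unitary : cstarZMod2.U ∈ unitary (Matrix Unit Unit cstarZMod2.A) :=
  unit_mem_unitary g2_mem_unitary

theorem isUnit_cstarZMod2_U_map_star : IsUnit (cstarZMod2.U.map star) :=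
  isUnit_map_star_unit g2_mem_unitary

/-! ### Orthogonal matrices with partial isometries or constant sums -/

section OrthogonalMatrices

variable {A B : Type} [CStarAlgebra A] [CStarAlgebra B] {ι : Type} [Fintype ι] [DecidableEq ι]

theorem IsOrthogonal.map {u : Matrix ι ι A} (hu : IsOrthogonal u) (φ : A →⋆ₐ[ℂ] B) :
    IsOrthogonal (u.map φ) :=
  ⟨fun i j => (map_star φ _).symm.trans (congrArg φ (hu.1 i j)), map_mem_unitary φ hu.2⟩

theorem HasPartialIsometryEntries.map {u : Matrix ι ι A} (hu : HasPartialIsometryEntries u)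
    (φ : A →⋆ₐ[ℂ] B) : HasPartialIsometryEntries (u.map φ) := fun i j => by
  simp only [Matrix.map_apply]
  rw [← map_star, ← map_mul, ← map_mul, hu i j]

theorem HasSums.map {u : Matrix ι ι A} {z : A} (hu : HasSums z u) (φ : A →⋆ₐ[ℂ] B) :
    HasSums (φ z) (u.map φ) :=
  ⟨fun i => by simp only [Matrix.map_apply]; rw [← map_sum, hu.1 i],
    fun j => by simp only [Matrix.map_apply]; rw [← map_sum, hu.2 j]⟩

/-- Projections in a C⋆-algebra that sum up to `1` are pairwise orthogonal: the positive elements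
`p j * p k * p j` sum up to `p j`, which is already the term for `k = j`. -/
theorem mul_eq_zero_of_sum_eq_one {p : ι → A} (hstar : ∀ i, star (p i) = p i)
    (hidem : ∀ i, p i * p i = p i) (hsum : ∑ i, p i = 1) {i j : ι} (hij : i ≠ j) :
    p i * p j = 0 := by
  let _ : PartialOrder A := CStarAlgebra.spectralOrder A
  let _ : StarOrderedRing A := CStarAlgebra.spectralOrderedRing A
  have hterm : ∀ k, star (p k * p j) * (p k * p j) = p j * p k * p j := fun k => by
    rw [star_mul, hstar, hstar, mul_assoc, ← mul_assoc (p k), hidem, mul_assoc]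
  have h1 : ∑ k, star (p k * p j) * (p k * p j) = p j := by
    simp_rw [hterm, ← Finset.sum_mul, ← Finset.mul_sum, hsum, mul_one, hidem]
  rw [← Finset.add_sum_erase _ _ (Finset.mem_univ j), hterm j, hidem, hidem, add_eq_left] at h1
  have h2 := (Finset.sum_eq_zero_iff_of_nonneg fun k _ => star_mul_self_nonneg _).mp h1 i
    (Finset.mem_erase.mpr ⟨hij, Finset.mem_univ i⟩)
  exact (CStarRing.star_mul_self_eq_zero_iff _).mp h2

theorem IsOrthogonal.mul_mul_self {u : Matrix ι ι A} (hu : IsOrthogonal u)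
    (hp : HasPartialIsometryEntries u) (i j : ι) : u i j * u i j * u i j = u i j := by
  have := hp i j
  rwa [hu.1] at this

/-- Different entries in a row of an orthogonal matrix of partial isometries are orthogonal. -/
theorem IsOrthogonal.mul_eq_zero {u : Matrix ι ι A} (hu : IsOrthogonal u)
    (hp : HasPartialIsometryEntries u) (i : ι) {j k : ι} (hjk : j ≠ k) :
    u i j * u i k = 0 := by
  have h3 := hu.mul_mul_self hp
  have h := mul_eq_zero_of_sum_eq_one (p := fun j => u i j * u i j)
    (fun j => by rw [star_mul, hu.1]) (fun j => by rw [← mul_assoc, h3])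
    (by simpa [Matrix.mul_apply] using congrFun (congrFun hu.mul_transpose i) i) hjk
  calc u i j * u i k = u i j * u i j * u i j * (u i k * u i k * u i k) := by rw [h3, h3]
    _ = u i j * (u i j * u i j * (u i k * u i k)) * u i k := by noncomm_ring
    _ = 0 := by rw [h, mul_zero, zero_mul]

theorem HasPartialIsometryEntries.comulMatrix {u : Matrix ι ι A}
    (hp : HasPartialIsometryEntries u) (hu : IsOrthogonal u) :
    HasPartialIsometryEntries (comulMatrix u) := fun i j => by
  rw [hu.comulMatrix.1, comulMatrix_apply]
  have h0 : ∀ k l, k ≠ l → (MinTensor.tmul (u i k) (u k j) * MinTensor.tmul (u i l) (u l j) :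
      MinTensor A A) = 0 := fun k l hkl => by
    rw [MinTensor.tmul_mul_tmul, hu.mul_eq_zero hp i hkl, ← MinTensor.inl_mul_inr, map_zero,
      zero_mul]
  have h2 : (∑ k, MinTensor.tmul (u i k) (u k j) : MinTensor A A) *
      ∑ k, MinTensor.tmul (u i k) (u k j) =
      ∑ k, MinTensor.tmul (u i k) (u k j) * MinTensor.tmul (u i k) (u k j) := by
    rw [Finset.sum_mul_sum]
    exact Finset.sum_congr rfl fun k _ => Finset.sum_eq_single k
      (fun l _ hl => h0 k l hl.symm) fun h => absurd (Finset.mem_univ k) h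
  rw [h2, Finset.sum_mul_sum]
  refine Finset.sum_congr rfl fun k _ => (Finset.sum_eq_single k
      (fun l _ hl => ?_) fun h => absurd (Finset.mem_univ k) h).trans ?_
  · rw [mul_assoc, h0 k l hl.symm, mul_zero]
  · rw [MinTensor.tmul_mul_tmul, MinTensor.tmul_mul_tmul, hu.mul_mul_self hp,
      hu.mul_mul_self hp]

theorem HasSums.star_eq [Nonempty ι] {u : Matrix ι ι A} {z : A} (hz : HasSums z u)
    (hu : IsOrthogonal u) : star z = z := by
  obtain ⟨i⟩ := ‹Nonempty ι›
  rw [← hz.1 i, star_sum]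
  exact Finset.sum_congr rfl fun j _ => hu.1 i j

/-- The isometry `u` maps the vector `(1, …, 1)` to its multiple by `z`, so `z` is unitary. -/
theorem HasSums.mul_self [Nonempty ι] {u : Matrix ι ι A} {z : A} (hz : HasSums z u)
    (hu : IsOrthogonal u) : z * z = 1 := by
  obtain ⟨j⟩ := ‹Nonempty ι›
  calc z * z = ∑ k, (u.transpose * u) j k := by
        simp_rw [Matrix.mul_apply]
        rw [Finset.sum_comm]
        simp_rw [← Finset.mul_sum, hz.1, ← Finset.sum_mul, Matrix.transpose_apply, hz.2]
    _ = 1 := by rw [hu.transpose_mul]; simp [Matrix.one_apply]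

/-! ### Multiplication of the entries by a unitary -/

theorem map_mul_right_eq (u : Matrix ι ι A) (r : A) :
    u.map (· * r) = u * Matrix.diagonal fun _ => r := by
  ext i j; rw [Matrix.mul_diagonal]; rfl

theorem diagonal_mem_unitary {r : A} (hr : r ∈ unitary A) :
    (Matrix.diagonal fun _ => r : Matrix ι ι A) ∈ unitary (Matrix ι ι A) := by
  rw [Unitary.mem_iff, Matrix.star_eq_conjTranspose, Matrix.diagonal_conjTranspose,
    Matrix.diagonal_mul_diagonal, Matrix.diagonal_mul_diagonal]
  simp [(Unitary.mem_iff.mp hr).1, (Unitary.mem_iff.mp hr).2]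

theorem map_mul_right_mem_unitary {u : Matrix ι ι A} (hu : u ∈ unitary (Matrix ι ι A)) {r : A}
    (hr : r ∈ unitary A) : u.map (· * r) ∈ unitary (Matrix ι ι A) := by
  rw [map_mul_right_eq]; exact mul_mem hu (diagonal_mem_unitary hr)

theorem isUnit_map_star_map_mul_right {u : Matrix ι ι A} (hu : IsUnit (u.map star)) {r : A}
    (hr : r ∈ unitary A) : IsUnit ((u.map (· * r)).map star) := by
  have h : (u.map (· * r)).map star = (Matrix.diagonal fun _ => star r) * u.map star := by
    ext i j; rw [Matrix.diagonal_mul]; exact star_mul _ _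
  rw [h]
  have h2 := Unitary.mem_iff.mp (diagonal_mem_unitary (ι := ι) (Unitary.star_mem hr))
  exact (isUnit_iff_exists.mpr ⟨_, h2.2, h2.1⟩).mul hu

theorem mem_unitary_of_mul_self {r : A} (hr : star r = r) (hr2 : r * r = 1) : r ∈ unitary A := by
  rw [Unitary.mem_iff, hr]; exact ⟨hr2, hr2⟩

theorem IsOrthogonal.map_mul_right {u : Matrix ι ι A} (hu : IsOrthogonal u) {r : A}
    (hr : star r = r) (hr2 : r * r = 1) (hc : ∀ i j, u i j * r = r * u i j) :
    IsOrthogonal (u.map (· * r)) :=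
  ⟨fun i j => by simp only [Matrix.map_apply]; rw [star_mul, hu.1, hr, hc],
    map_mul_right_mem_unitary hu.2 (mem_unitary_of_mul_self hr hr2)⟩

theorem HasPartialIsometryEntries.map_mul_right {u : Matrix ι ι A}
    (hu : HasPartialIsometryEntries u) {r : A}
    (hr : star r = r) (hr2 : r * r = 1) :
    HasPartialIsometryEntries (u.map (· * r)) := fun i j => by
  simp only [Matrix.map_apply]
  calc u i j * r * star (u i j * r) * (u i j * r)
      = u i j * (r * r) * star (u i j) * (u i j * r) := by rw [star_mul, hr]; noncomm_ring
    _ = u i j * r := by rw [hr2, mul_one, ← mul_assoc, hu i j]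

theorem HasSums.map_mul_right {u : Matrix ι ι A} {z : A} (hz : HasSums z u) (r : A) :
    HasSums (z * r) (u.map (· * r)) :=
  ⟨fun i => by simp only [Matrix.map_apply]; rw [← Finset.sum_mul, hz.1],
    fun j => by simp only [Matrix.map_apply]; rw [← Finset.sum_mul, hz.2]⟩

theorem IsCorep.map_mul_right {Δ : A →⋆ₐ[ℂ] MinTensor A A} {u : Matrix ι ι A}
    (hu : IsCorep Δ u) {r : A} (hr : Δ r = MinTensor.tmul r r) : IsCorep Δ (u.map (· * r)) := by
  ext i j
  have h : Δ (u i j) = _ := congrFun (congrFun hu i) j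
  rw [comulMatrix_apply] at h ⊢
  simp only [Matrix.map_apply, map_mul]
  rw [h, hr, Finset.sum_mul]
  simp only [MinTensor.tmul_mul_tmul]

/-! ### Changing the sums of the rows and columns -/

/-- Adding the same element to all entries so that the sums change from `r` to `s`: on the
subspace spanned by `(1, …, 1)`, the matrix `u` is replaced by `s`. -/
def changeSums (u : Matrix ι ι A) (r s : A) : Matrix ι ι A :=
  u.map (· + (Fintype.card ι : ℂ)⁻¹ • (s - r))

theorem changeSums_apply (u : Matrix ι ι A) (r s : A) (i j : ι) :
    changeSums u r s i j = u i j + (Fintype.card ι : ℂ)⁻¹ • (s - r) := rfl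

theorem changeSums_map (φ : A →⋆ₐ[ℂ] B) (u : Matrix ι ι A) (r s : A) :
    (changeSums u r s).map φ = changeSums (u.map φ) (φ r) (φ s) := by
  ext i j
  simp [changeSums_apply, map_smul]

theorem changeSums_changeSums (u : Matrix ι ι A) (r s t : A) :
    changeSums (changeSums u r s) s t = changeSums u r t := by
  ext i j
  rw [changeSums_apply, changeSums_apply, changeSums_apply, add_assoc, ← smul_add]
  congr 2; abel

theorem changeSums_self (u : Matrix ι ι A) (r : A) : changeSums u r r = u := by
  ext i j
  rw [changeSums_apply, sub_self, smul_zero, add_zero]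

variable [Nonempty ι]

theorem card_smul_inv_smul (x : A) :
    Fintype.card ι • (Fintype.card ι : ℂ)⁻¹ • x = x := by
  have : (Fintype.card ι : ℂ) ≠ 0 := Nat.cast_ne_zero.mpr Fintype.card_ne_zero
  rw [← Nat.cast_smul_eq_nsmul ℂ, smul_smul, mul_inv_cancel₀ this, one_smul]

theorem HasSums.changeSums {u : Matrix ι ι A} {r : A} (hr : HasSums r u) (s : A) :
    HasSums s (changeSums u r s) := by
  constructor <;> intro i
  · simp only [changeSums_apply]
    rw [Finset.sum_add_distrib, hr.1, Finset.sum_const, Finset.card_univ, card_smul_inv_smul]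
    abel
  · simp only [changeSums_apply]
    rw [Finset.sum_add_distrib, hr.2, Finset.sum_const, Finset.card_univ, card_smul_inv_smul]
    abel

/-- The computation behind `changeSums`: if `a` and `b` sum up to `x` and `y`, shifting both by
`(x' - x) / n` and `(y' - y) / n` changes `∑ a b` by `(x' y' - x y) / n`. -/
theorem sum_shift_mul_shift {a b : ι → A} {x y : A} (ha : ∑ k, a k = x) (hb : ∑ k, b k = y)
    (x' y' : A) :
    ∑ k, (a k + (Fintype.card ι : ℂ)⁻¹ • (x' - x)) * (b k + (Fintype.card ι : ℂ)⁻¹ • (y' - y)) =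
      ∑ k, a k * b k + (Fintype.card ι : ℂ)⁻¹ • (x' * y' - x * y) := by
  simp_rw [add_mul, mul_add, Finset.sum_add_distrib, ← Finset.sum_mul, ← Finset.mul_sum, ha, hb]
  rw [Finset.sum_const, Finset.card_univ, card_smul_inv_smul, mul_smul_comm, mul_smul_comm, smul_mul_assoc,
    add_assoc, ← smul_add, ← smul_add]
  congr 2
  noncomm_ring

theorem IsOrthogonal.changeSums {u : Matrix ι ι A} (hu : IsOrthogonal u) {r s : A}
    (hr : HasSums r u) (hs : star s = s) (hs2 : s * s = 1) :
    IsOrthogonal (changeSums u r s) := by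
  refine isOrthogonal_iff.mpr ⟨fun i j => ?_, ?_, ?_⟩
  · rw [changeSums_apply, star_add, hu.1, star_smul, star_sub, hs, hr.star_eq hu]
    simp
  · ext i j
    rw [Matrix.mul_apply]
    simp only [Matrix.transpose_apply, changeSums_apply]
    rw [sum_shift_mul_shift (hr.2 i) (hr.2 j), hs2, hr.mul_self hu, sub_self, smul_zero, add_zero,
      ← hu.transpose_mul, Matrix.mul_apply]
    rfl
  · ext i j
    rw [Matrix.mul_apply]
    simp only [Matrix.transpose_apply, changeSums_apply]
    rw [sum_shift_mul_shift (hr.1 i) (hr.1 j), hs2, hr.mul_self hu, sub_self, smul_zero, add_zero,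
      ← hu.mul_transpose, Matrix.mul_apply]
    rfl

theorem IsCorep.changeSums {Δ : A →⋆ₐ[ℂ] MinTensor A A} {u : Matrix ι ι A}
    (hu : IsCorep Δ u) {r s : A} (hr : HasSums r u) (hs : Δ s = MinTensor.tmul s s) :
    IsCorep Δ (changeSums u r s) := by
  ext i j
  have h : Δ (u i j) = _ := congrFun (congrFun hu i) j
  rw [comulMatrix_apply] at h ⊢
  simp only [Matrix.map_apply, changeSums_apply, map_add, map_smul, map_sub, h, hs,
    hu.apply_sum hr, ← MinTensor.inl_mul_inr]
  exact (sum_shift_mul_shift (by rw [← map_sum, hr.1]) (by rw [← map_sum, hr.2]) _ _).symm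

end OrthogonalMatrices

/-! ### The universal orthogonal quantum groups -/

section Universal

theorem isOrthogonal_Ao (n : ℕ) : IsOrthogonal (Ao n).U := isOrthogonal_universalPair
theorem isOrthogonal_As (n : ℕ) : IsOrthogonal (As n).U := isOrthogonal_universalPair
theorem isOrthogonal_Ab (n : ℕ) : IsOrthogonal (Ab n).U := isOrthogonal_universalPair
theorem isOrthogonal_As' (n : ℕ) : IsOrthogonal (As' n).U := isOrthogonal_universalPair
theorem isOrthogonal_Ab' (n : ℕ) : IsOrthogonal (Ab' n).U := isOrthogonal_universalPair

theorem hasPartialIsometryEntries_As (n : ℕ) : HasPartialIsometryEntries (As n).U :=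
  hasPartialIsometryEntries_universalPair fun _ _ _ h => h.2.1
theorem hasPartialIsometryEntries_As' (n : ℕ) : HasPartialIsometryEntries (As' n).U :=
  hasPartialIsometryEntries_universalPair fun _ _ _ h => h.2.1

theorem hasSums_As (n : ℕ) : HasSums 1 (As n).U :=
  hasSums_one_universalPair fun _ _ _ h => h.2.2
theorem hasSums_Ab (n : ℕ) : HasSums 1 (Ab n).U :=
  hasSums_one_universalPair fun _ _ _ h => h.2
theorem exists_hasSums_As' {n : ℕ} (hn : 1 ≤ n) : ∃ z, HasSums z (As' n).U :=
  exists_hasSums_universalPair hn fun _ _ _ h => h.2.2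
theorem exists_hasSums_Ab' {n : ℕ} (hn : 1 ≤ n) : ∃ z, HasSums z (Ab' n).U :=
  exists_hasSums_universalPair hn fun _ _ _ h => h.2

theorem isCompactMatrixQuantumGroup_Ao (n : ℕ) : (Ao n).IsCompactMatrixQuantumGroup :=
  isCompactMatrixQuantumGroup_universalPair n _ _ (isOrthogonal_Ao n)
    (isOrthogonal_Ao n).comulMatrix

theorem isCompactMatrixQuantumGroup_As (n : ℕ) : (As n).IsCompactMatrixQuantumGroup :=
  isCompactMatrixQuantumGroup_universalPair n _ _
    ⟨isOrthogonal_As n, hasPartialIsometryEntries_As n, hasSums_As n⟩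
    ⟨(isOrthogonal_As n).comulMatrix,
      (hasPartialIsometryEntries_As n).comulMatrix (isOrthogonal_As n), (hasSums_As n).comulMatrix⟩

theorem isCompactMatrixQuantumGroup_Ab (n : ℕ) : (Ab n).IsCompactMatrixQuantumGroup :=
  isCompactMatrixQuantumGroup_universalPair n _ _
    ⟨isOrthogonal_Ab n, hasSums_Ab n⟩
    ⟨(isOrthogonal_Ab n).comulMatrix, (hasSums_Ab n).comulMatrix⟩

theorem isCompactMatrixQuantumGroup_As' {n : ℕ} (hn : 1 ≤ n) :
    (As' n).IsCompactMatrixQuantumGroup :=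
  isCompactMatrixQuantumGroup_universalPair n _ _
    ⟨isOrthogonal_As' n, hasPartialIsometryEntries_As' n, exists_hasSums_As' hn⟩
    ⟨(isOrthogonal_As' n).comulMatrix,
      (hasPartialIsometryEntries_As' n).comulMatrix (isOrthogonal_As' n),
      (exists_hasSums_As' hn).imp' _ fun _ h => h.comulMatrix⟩

theorem isCompactMatrixQuantumGroup_Ab' {n : ℕ} (hn : 1 ≤ n) :
    (Ab' n).IsCompactMatrixQuantumGroup :=
  isCompactMatrixQuantumGroup_universalPair n _ _
    ⟨isOrthogonal_Ab' n, exists_hasSums_Ab' hn⟩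
    ⟨(isOrthogonal_Ab' n).comulMatrix, (exists_hasSums_Ab' hn).imp' _ fun _ h => h.comulMatrix⟩

end Universal

open MatrixPair

/-! ### Symmetrization: free product with `ℤ/2ℤ` -/

/-- If `G` and `K` are universal for orthogonal matrices with constant sums and with sums `1`,
then `G` is the free product of `K` and the dual of `ℤ/2ℤ`: on the span of `(1, …, 1)` the matrix
`u` of `G` is the generator of `ℤ/2ℤ`, on the complement it is the matrix of `K`. -/
theorem isomorphic_freeProduct_zmod2 {ι : Type} [Fintype ι] [DecidableEq ι] [Nonempty ι]
    {G K : MatrixPair ι} (hG : G.IsCompactMatrixQuantumGroup) (hK : Generates K.entries)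
    (hW : IsOrthogonal G.U) {r : G.A} (hr : HasSums r G.U)
    (hKo : IsOrthogonal K.U) (hK1 : HasSums 1 K.U)
    (liftG : ∀ (C : Type) [CStarAlgebra C] (v : Matrix ι ι C), IsOrthogonal v →
      (∃ z, HasSums z v) → ∃ φ : G.A →⋆ₐ[ℂ] C, G.U.map φ = v)
    (liftK : ∀ (C : Type) [CStarAlgebra C] (v : Matrix ι ι C), IsOrthogonal v →
      HasSums 1 v → ∃ φ : K.A →⋆ₐ[ℂ] C, K.U.map φ = v) :
    G.Isomorphic (K.freeProduct cstarZMod2) := by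
  have hrs := hr.star_eq hW
  have hr2 := hr.mul_self hW
  let g : FreeProduct K.A (GroupCStar (Multiplicative (ZMod 2))) :=
    FreeProduct.inrHom GroupCStar.g2
  have hgs : star g = g := (map_star _ _).symm.trans (congrArg _ GroupCStar.star_g2)
  have hg2 : g * g = 1 := (map_mul _ _ _).symm.trans
    ((congrArg _ GroupCStar.g2_mul_g2).trans (map_one _))
  let w : Matrix ι ι (FreeProduct K.A (GroupCStar (Multiplicative (ZMod 2)))) :=
    K.U.map FreeProduct.inlHom
  have hw : IsOrthogonal w := hKo.map _
  have hw1 : HasSums 1 w := by simpa using hK1.map FreeProduct.inlHom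
  obtain ⟨Φ, hΦ⟩ : ∃ Φ : G.A →⋆ₐ[ℂ] FreeProduct K.A
      (GroupCStar (Multiplicative (ZMod 2))), G.U.map Φ = changeSums w 1 g :=
    liftG _ _ (hw.changeSums hw1 hgs hg2) ⟨g, hw1.changeSums g⟩
  obtain ⟨α, hα⟩ : ∃ α : K.A →⋆ₐ[ℂ] G.A, K.U.map α = changeSums G.U r 1 :=
    liftK _ _ (hW.changeSums hr (star_one _) (one_mul 1)) (hr.changeSums 1)
  obtain ⟨Ψ, hΨα, hΨg⟩ : ∃ Ψ : FreeProduct K.A (GroupCStar (Multiplicative (ZMod 2)))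
      →⋆ₐ[ℂ] G.A, (∀ a, Ψ (FreeProduct.inlHom a) = α a) ∧ Ψ g = r :=
    ⟨FreeProduct.lift α (GroupCStar.zmod2Lift r hrs hr2), FreeProduct.lift_inl _ _,
      (FreeProduct.lift_inr _ _ _).trans (GroupCStar.zmod2Lift_g2 r hrs hr2)⟩
  have hΨw : w.map Ψ = changeSums G.U r 1 := by
    rw [← hα]; ext i j; exact hΨα _
  have hΦr : Φ r = g := by
    obtain ⟨i⟩ := ‹Nonempty ι›
    rw [← (hr.map Φ).1 i, hΦ, (hw1.changeSums g).1 i]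
  have hΦα : (changeSums G.U r 1).map Φ = w := by
    rw [changeSums_map, map_one, hΦr, hΦ, changeSums_changeSums, changeSums_self]
  have hΨΦ : (changeSums w 1 g).map Ψ = G.U := by
    rw [changeSums_map, map_one, hΨg, hΨw, changeSums_changeSums, changeSums_self]
  have h1 : Ψ.comp Φ = StarAlgHom.id ℂ _ := by
    refine hom_ext hG.generated ?_
    rw [← hΦ] at hΨΦ
    exact hΨΦ
  have h2 : Φ.comp Ψ = StarAlgHom.id ℂ _ := by
    refine FreeProduct.hom_ext (hom_ext hK ?_)
      (GroupCStar.generates_g2.hom_ext ?_)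
    · rw [← hΨw] at hΦα
      exact hΦα
    · rintro _ rfl
      change Φ (Ψ g) = g
      rw [hΨg, hΦr]
  have hY : (Matrix.of fun _ _ : Unit => r).map Φ = cstarZMod2.U.map FreeProduct.inrHom := by
    ext i j
    exact hΦr
  refine isomorphic_freeProduct_of_homs (L := cstarZMod2) hG Φ Ψ h1 h2 _ _ hΦα hY (fun Δ hΔ => ?_)
    hK generates_entries_cstarZMod2 hKo.2 cstarZMod2_U_mem_unitary hKo.isUnit_map_star
    isUnit_cstarZMod2_U_map_star
  rw [isComultiplication_iff] at hΔ
  exact ⟨hΔ.changeSums hr (map_one Δ), isCorep_unit.mpr (hΔ.apply_sum hr)⟩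

/-! ### Symmetrization: tensor product with `ℤ/2ℤ` -/

/-- A central projection `p` decomposes `B` into a direct sum; two copies of `α` on the two
summands give a ⋆-homomorphism on `A × A`. -/
def centralSum {A B : Type} [CStarAlgebra A] [CStarAlgebra B] (α : A →⋆ₐ[ℂ] B) (p : B)
    (hp : star p = p) (hp2 : p * p = p) (hc : ∀ b, b * p = p * b) : A × A →⋆ₐ[ℂ] B where
  toFun x := α x.1 * p + α x.2 * (1 - p)
  map_one' := by simp
  map_mul' x y := by
    have hq : ∀ b, b * (1 - p) = (1 - p) * b := fun b => by rw [mul_sub, sub_mul, hc]; simp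
    have hpq : p * (1 - p) = 0 := by rw [mul_sub, hp2, mul_one, sub_self]
    have hqp : (1 - p) * p = 0 := by rw [sub_mul, hp2, one_mul, sub_self]
    have hq2 : (1 - p) * (1 - p) = 1 - p := by rw [sub_mul, hpq, one_mul, sub_zero]
    have key : ∀ (a b s t : B), (∀ b, b * s = s * b) → (a * s) * (b * t) = a * b * (s * t) :=
      fun a b s t hs => by rw [mul_assoc, ← mul_assoc s, ← hs, mul_assoc, mul_assoc]
    rw [add_mul, mul_add, mul_add, key _ _ _ _ hc, key _ _ _ _ hc, key _ _ _ _ hq, key _ _ _ _ hq,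
      hp2, hpq, hqp, hq2, mul_zero, mul_zero, add_zero, zero_add, Prod.fst_mul, Prod.snd_mul,
      map_mul, map_mul]
  map_zero' := by simp
  map_add' x y := by simp only [Prod.fst_add, Prod.snd_add, map_add]; noncomm_ring
  commutes' c := by
    change α (algebraMap ℂ A c) * p + α (algebraMap ℂ A c) * (1 - p) = _
    rw [← mul_add, add_sub_cancel, mul_one, AlgHomClass.commutes]
  map_star' x := by
    rw [star_add, star_mul, star_mul, star_sub, star_one, hp, Prod.fst_star, Prod.snd_star,
      map_star, map_star, mul_sub, sub_mul, hc]
    rw [hc (star (α x.2)), mul_one, one_mul]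

/-- The slice map for the character of `ℤ/2ℤ` with value `t` at the generator. -/
theorem exists_slice_zmod2 {A : Type} [CStarAlgebra A] (t : ℂ) (ht : star t = t)
    (ht2 : t * t = 1) :
    ∃ σ : MinTensor A (GroupCStar (Multiplicative (ZMod 2))) →⋆ₐ[ℂ] A,
      (∀ a, σ (MinTensor.inl a) = a) ∧ σ (MinTensor.inr GroupCStar.g2) = algebraMap ℂ A t := by
  refine ⟨MinTensor.slice (GroupCStar.zmod2Lift t ht ht2), fun a => ?_, ?_⟩
  · rw [MinTensor.inl_apply, MinTensor.slice_tmul, map_one, map_one, mul_one]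
  · rw [MinTensor.inr_apply, MinTensor.slice_tmul, GroupCStar.zmod2Lift_g2, one_mul]

/-- If `G` and `K` are universal for orthogonal matrices of partial isometries with constant sums
and with sums `1`, then `G` is the direct sum of `K` and the dual of `ℤ/2ℤ`: the sum `r` of a row
of `u` is a central self-adjoint unitary, and `u r` is the matrix of `K`. -/
theorem isomorphic_directSum_zmod2 {ι : Type} [Fintype ι] [DecidableEq ι] [Nonempty ι]
    {G K : MatrixPair ι} (hG : G.IsCompactMatrixQuantumGroup) (hK : Generates K.entries)
    (hW : IsOrthogonal G.U) (hWp : HasPartialIsometryEntries G.U) {r : G.A} (hr : HasSums r G.U)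
    (hKo : IsOrthogonal K.U) (hKp : HasPartialIsometryEntries K.U) (hK1 : HasSums 1 K.U)
    (liftG : ∀ (C : Type) [CStarAlgebra C] (v : Matrix ι ι C), IsOrthogonal v →
      HasPartialIsometryEntries v → (∃ z, HasSums z v) →
      ∃ φ : G.A →⋆ₐ[ℂ] C, G.U.map φ = v)
    (liftK : ∀ (C : Type) [CStarAlgebra C] (v : Matrix ι ι C), IsOrthogonal v →
      HasPartialIsometryEntries v → HasSums 1 v → ∃ φ : K.A →⋆ₐ[ℂ] C, K.U.map φ = v) :
    G.Isomorphic (K.directSum cstarZMod2) := by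
  have hrs := hr.star_eq hW
  have hr2 := hr.mul_self hW
  have hrl : ∀ i j, r * G.U i j = G.U i j * G.U i j := fun i j => by
    rw [← hr.1 i, Finset.sum_mul]
    exact Finset.sum_eq_single j (fun k _ hk => hW.mul_eq_zero hWp i hk)
      fun h => absurd (Finset.mem_univ j) h
  have hrr : ∀ i j, G.U i j * r = G.U i j * G.U i j := fun i j => by
    rw [← hr.1 i, Finset.mul_sum]
    exact Finset.sum_eq_single j (fun k _ hk => hW.mul_eq_zero hWp i hk.symm)
      fun h => absurd (Finset.mem_univ j) h
  have hc : ∀ i j, G.U i j * r = r * G.U i j := fun i j =>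
    (hrr i j).trans (hrl i j).symm
  have hcentral : ∀ a, a * r = r * a :=
    Generates.commute (S := G.entries) hG.generated hrs
      (by rintro _ ⟨i, j, rfl⟩; exact hc i j)
  let g : MinTensor K.A (GroupCStar (Multiplicative (ZMod 2))) :=
    MinTensor.inr GroupCStar.g2
  have hgs : star g = g := (map_star _ _).symm.trans (congrArg _ GroupCStar.star_g2)
  have hg2 : g * g = 1 := (map_mul _ _ _).symm.trans
    ((congrArg _ GroupCStar.g2_mul_g2).trans (map_one _))
  let w : Matrix ι ι (MinTensor K.A (GroupCStar (Multiplicative (ZMod 2)))) :=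
    K.U.map MinTensor.inl
  have hw : IsOrthogonal w := hKo.map _
  have hwp : HasPartialIsometryEntries w := hKp.map _
  have hw1 : HasSums 1 w := by simpa using hK1.map MinTensor.inl
  have hwg : ∀ i j, w i j * g = g * w i j := fun i j => MinTensor.commute_inl_inr _ _
  obtain ⟨Φ, hΦ'⟩ : ∃ Φ : G.A →⋆ₐ[ℂ] MinTensor K.A
      (GroupCStar (Multiplicative (ZMod 2))), G.U.map Φ = w.map (· * g) :=
    liftG _ _ (hw.map_mul_right hgs hg2 hwg) (hwp.map_mul_right hgs hg2)
      ⟨1 * g, hw1.map_mul_right g⟩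
  obtain ⟨α, hα'⟩ : ∃ α : K.A →⋆ₐ[ℂ] G.A,
      K.U.map α = G.U.map (· * r) :=
    liftK _ _ (hW.map_mul_right hrs hr2 hc) (hWp.map_mul_right hrs hr2) (by
      simpa only [hr2] using hr.map_mul_right r)
  have hΦ : ∀ i j, Φ (G.U i j) = w i j * g := fun i j => congrFun (congrFun hΦ' i) j
  have hα : ∀ i j, α (K.U i j) = G.U i j * r := fun i j =>
    congrFun (congrFun hα' i) j
  have hstar2 : star (2⁻¹ : ℂ) = 2⁻¹ := by simp
  obtain ⟨p, hpr⟩ : ∃ p : G.A, p = (2⁻¹ : ℂ) • (1 + r) := ⟨_, rfl⟩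
  have hp : star p = p := by
    rw [hpr, star_smul, star_add, star_one, hrs, hstar2]
  have hp2 : p * p = p := by
    have : (1 + r) * (1 + r) = (2 : ℂ) • (1 + r) := by
      rw [add_mul, mul_add, mul_add, hr2, two_smul]; simp only [one_mul, mul_one]; abel
    rw [hpr, smul_mul_smul_comm, this, smul_smul]; norm_num
  have hpc : ∀ b, b * p = p * b := fun b => by
    rw [hpr, mul_smul_comm, smul_mul_assoc, mul_add, add_mul, hcentral, mul_one, one_mul]
  -- the slice maps of the two characters of `ℤ/2ℤ` identify `A ⊗ C⋆(ℤ/2ℤ)` with `A × A`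
  obtain ⟨σ₁, h11, h1l⟩ := exists_slice_zmod2 (A := K.A) 1 (star_one _) (one_mul _)
  obtain ⟨σ₂, h21, h2l⟩ := exists_slice_zmod2 (A := K.A) (-1) (by simp) (by simp)
  obtain ⟨Ψ, hΨ⟩ : ∃ Ψ : MinTensor K.A (GroupCStar (Multiplicative (ZMod 2)))
      →⋆ₐ[ℂ] G.A, ∀ x, Ψ x = α (σ₁ x) * p + α (σ₂ x) * (1 - p) :=
    ⟨(centralSum α p hp hp2 hpc).comp (StarAlgHom.prod σ₁ σ₂), fun _ => rfl⟩
  have hΨl : ∀ a, Ψ (MinTensor.inl a) = α a := fun a => by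
    rw [hΨ, h11, h21, ← mul_add, add_sub_cancel, mul_one]
  have hΨg : Ψ g = r := by
    have h2 : (2⁻¹ : ℂ) • (1 + r) + (2⁻¹ : ℂ) • (1 + r) = 1 + r := by
      rw [← add_smul]; norm_num
    rw [hΨ, h1l, h2l, map_one, map_neg, map_one, map_neg, map_one, one_mul, neg_mul, map_one,
      one_mul, neg_sub, ← add_sub_assoc, hpr, h2, add_sub_cancel_left]
  have hΦr : Φ r = g := by
    obtain ⟨i⟩ := ‹Nonempty ι›
    rw [← hr.1 i, map_sum]
    simp_rw [hΦ]
    rw [← Finset.sum_mul, hw1.1, one_mul]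
  have hΦα : ∀ i j, Φ (α (K.U i j)) = w i j := fun i j => by
    rw [hα, map_mul, hΦ, hΦr, mul_assoc, hg2, mul_one]
  have h1 : Ψ.comp Φ = StarAlgHom.id ℂ _ := by
    refine hom_ext hG.generated (Matrix.ext fun i j => ?_)
    change Ψ (Φ (G.U i j)) = G.U i j
    rw [hΦ, map_mul, hΨg]
    change Ψ (MinTensor.inl (K.U i j)) * r = _
    rw [hΨl, hα, mul_assoc, hr2, mul_one]
  have h2 : Φ.comp Ψ = StarAlgHom.id ℂ _ := by
    refine MinTensor.hom_ext (hom_ext hK (Matrix.ext fun i j => ?_))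
      (GroupCStar.generates_g2.hom_ext ?_)
    · change Φ (Ψ (MinTensor.inl (K.U i j))) = w i j
      rw [hΨl, hΦα]
    · rintro _ rfl
      change Φ (Ψ g) = g
      rw [hΨg, hΦr]
  have hX : (G.U.map (· * r)).map Φ = w := by
    ext i j
    exact (congrArg Φ (hα i j)).symm.trans (hΦα i j)
  have hY : (Matrix.of fun _ _ : Unit => r).map Φ = cstarZMod2.U.map MinTensor.inr := by
    ext i j
    exact hΦr
  refine isomorphic_directSum_of_homs (L := cstarZMod2) hG Φ Ψ h1 h2 _ _ hX hY (fun Δ hΔ => ?_)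
    hK generates_entries_cstarZMod2 hKo.2 cstarZMod2_U_mem_unitary hKo.isUnit_map_star
    isUnit_cstarZMod2_U_map_star
  rw [isComultiplication_iff] at hΔ
  exact ⟨hΔ.map_mul_right (hΔ.apply_sum hr), isCorep_unit.mpr (hΔ.apply_sum hr)⟩

/-! ### Free complexification -/

section Complexification

variable {ι : Type} [Fintype ι] [DecidableEq ι] [Nonempty ι]

theorem mem_complexSubalgebra {K : MatrixPair ι} (hK : K.IsCompactMatrixQuantumGroup)
    (h1 : HasSums 1 K.U) (x : FreeProduct K.A C(Circle, ℂ)) : x ∈ complexSubalgebra K := by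
  have hmem : ∀ i j, FreeProduct.inlHom (K.U i j) * FreeProduct.inrHom circleId ∈
      complexSubalgebra K := fun i j =>
    StarSubalgebra.le_topologicalClosure _ (StarAlgebra.subset_adjoin ℂ _ ⟨i, j, rfl⟩)
  have hz : FreeProduct.inrHom circleId ∈ complexSubalgebra K := by
    obtain ⟨i⟩ := ‹Nonempty ι›
    have h := sum_mem fun j (_ : j ∈ Finset.univ) => hmem i j
    rwa [← Finset.sum_mul, ← map_sum, h1.1, map_one, one_mul] at h
  refine (FreeProduct.generates_of_generates hK.generated generates_circleId).mem _
    (StarSubalgebra.isClosed_topologicalClosure _) ?_ x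
  rintro _ (⟨_, ⟨i, j, rfl⟩, rfl⟩ | ⟨_, rfl, rfl⟩)
  · have h := mul_mem (hmem i j) (star_mem hz)
    rwa [mul_assoc, ← map_star, ← map_mul, (Unitary.mem_iff.mp circleId_mem_unitary).2, map_one,
      mul_one] at h
  · exact hz

/-- The sum of a row of `(u_ij z)` is `z`, so that the free complexification is the whole free
product `A * C(S¹)`. -/
theorem isomorphic_freeComplexification {K : MatrixPair ι}
    (hK : K.IsCompactMatrixQuantumGroup) (h1 : HasSums 1 K.U) :
    (freeComplexification K).Isomorphic (K.freeProduct circle) := by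
  have hG := hK.freeProduct isCompactMatrixQuantumGroup_circle
  let F := FreeProduct K.A C(Circle, ℂ)
  let Φ : F →⋆ₐ[ℂ] complexSubalgebra K :=
    (StarAlgHom.id ℂ F).codRestrict _ (mem_complexSubalgebra hK h1)
  let z : F := FreeProduct.inrHom circleId
  have hz : z ∈ unitary F := Unitary.map_mem FreeProduct.inrHom circleId_mem_unitary
  let w : Matrix ι ι F := K.U.map FreeProduct.inlHom
  let V : Matrix ι ι F := w.map (· * z)
  have hV : V.map Φ = (freeComplexification K).U := rfl
  have hVunit : V ∈ unitary (Matrix ι ι F) :=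
    map_mul_right_mem_unitary (map_mem_unitary _ hK.unitary) hz
  have hVconj : IsUnit (V.map star) :=
    isUnit_map_star_map_mul_right (isUnit_map_star_of_map _ hK.conj_invertible) hz
  refine Isomorphic.symm (isomorphic_of_homs hG Φ (complexSubalgebra K).subtype rfl rfl V hV ?_ ?_ ?_ ?_)
  · intro Δ hΔ
    have h := isCorep_fromBlocks_iff.mp (isComultiplication_iff.mp hΔ)
    exact h.1.map_mul_right (isCorep_unit.mp h.2)
  · have hgen : Generates {x : F | ∃ i j, x = V i j} :=
      eq_top_iff.mpr fun x _ => mem_complexSubalgebra hK h1 x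
    refine generates_of_forall_mem fun D hD h (y : complexSubalgebra K) => ?_
    have := hgen.map_mem Φ D hD (by rintro _ ⟨i, j, rfl⟩; exact h _ ⟨i, j, rfl⟩) y.1
    exact this
  · exact map_mem_unitary Φ hVunit
  · exact isUnit_map_star_of_map Φ hVconj

end Complexification

/-! ### Bistochastic and orthogonal quantum groups -/

/-- The columns of `S` are an explicit orthonormal basis, with real coordinates, of the orthogonal
complement of `(1, …, 1)` in `ℂ^(m+1)`. -/
theorem exists_isometry (m : ℕ) : ∃ S : Matrix (Fin (m + 1)) (Fin m) ℂ,
    (∀ i j, star (S i j) = S i j) ∧ S.transpose * S = 1 ∧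
      S * S.transpose = 1 - Matrix.of fun _ _ => ((m + 1 : ℕ) : ℂ)⁻¹ := by
  -- the basis comes from the reflection that exchanges `-e₀` and `(1, …, 1) / √(m + 1)`
  let c : ℝ := (√(m + 1 : ℝ))⁻¹
  let d : ℝ := c ^ 2 / (1 + c)
  have hm : (0 : ℝ) < m + 1 := by positivity
  have hc0 : 0 < c := inv_pos.mpr (Real.sqrt_pos.mpr hm)
  have hc : (m + 1) * c ^ 2 = 1 := by
    rw [inv_pow, Real.sq_sqrt hm.le, mul_inv_cancel₀ hm.ne']
  have hd : d * (1 + c) = c ^ 2 := div_mul_cancel₀ _ (by positivity)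
  have hmd : m * d = 1 - c := by
    have h : (m * d - (1 - c)) * (1 + c) = 0 := by linear_combination (m : ℝ) * hd + hc
    rcases mul_eq_zero.mp h with h | h
    · linarith
    · linarith
  have hC : ((m : ℂ) + 1) * (c : ℂ) ^ 2 = 1 := by exact_mod_cast hc
  have hD : (d : ℂ) * (1 + c) = (c : ℂ) ^ 2 := by exact_mod_cast hd
  have hMD : (m : ℂ) * d = 1 - c := by exact_mod_cast hmd
  have hinv : ((m + 1 : ℕ) : ℂ)⁻¹ = (c : ℂ) ^ 2 := by
    push_cast; exact inv_eq_of_mul_eq_one_right hC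
  let S : Matrix (Fin (m + 1)) (Fin m) ℂ :=
    Matrix.of fun a j => Fin.cases (-(c : ℂ)) (fun i => (if i = j then 1 else 0) - (d : ℂ)) a
  have hS0 : ∀ j, S 0 j = -(c : ℂ) := fun _ => rfl
  have hSs : ∀ i j, S (Fin.succ i) j = (if i = j then 1 else 0) - (d : ℂ) := fun _ _ => rfl
  refine ⟨S, fun a j => ?_, ?_, ?_⟩
  · refine Fin.cases ?_ (fun i => ?_) a
    · rw [hS0]; simp
    · rw [hSs]; split_ifs <;> simp
  · ext j k
    rw [Matrix.mul_apply, Fin.sum_univ_succ]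
    simp only [Matrix.transpose_apply, hS0, hSs, sub_mul, mul_sub, Finset.sum_sub_distrib,
      ite_mul, mul_ite, one_mul, mul_one, zero_mul, mul_zero, Finset.sum_ite_eq',
      Finset.mem_univ, if_true, Finset.sum_const, Finset.card_univ, Fintype.card_fin,
      nsmul_eq_mul, Matrix.one_apply, eq_comm (a := k)]
    linear_combination (d : ℂ) * hMD - hD
  · ext a b
    rw [Matrix.mul_apply, Matrix.sub_apply, Matrix.of_apply, hinv]
    refine Fin.cases ?_ (fun i => ?_) a <;> refine Fin.cases ?_ (fun k => ?_) b
    · simp only [Matrix.transpose_apply, hS0, Finset.sum_const, Finset.card_univ,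
        Fintype.card_fin, nsmul_eq_mul, Matrix.one_apply, if_true]
      linear_combination hC
    · simp only [Matrix.transpose_apply, hS0, hSs, mul_sub, Finset.sum_sub_distrib, mul_ite,
        mul_one, mul_zero, Finset.sum_ite_eq, Finset.mem_univ, if_true, Finset.sum_const,
        Finset.card_univ, Fintype.card_fin, nsmul_eq_mul, Matrix.one_apply,
        (Fin.succ_ne_zero k).symm, if_false]
      linear_combination (c : ℂ) * hMD
    · simp only [Matrix.transpose_apply, hS0, hSs, sub_mul, Finset.sum_sub_distrib, ite_mul,
        one_mul, zero_mul, Finset.sum_ite_eq, Finset.mem_univ, if_true, Finset.sum_const,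
        Finset.card_univ, Fintype.card_fin, nsmul_eq_mul, Matrix.one_apply,
        Fin.succ_ne_zero i, if_false]
      linear_combination (c : ℂ) * hMD
    · simp only [Matrix.transpose_apply, hSs, sub_mul, mul_sub, Finset.sum_sub_distrib,
        ite_mul, mul_ite, one_mul, mul_one, zero_mul, mul_zero, Finset.sum_ite_eq,
        Finset.mem_univ, if_true, Finset.sum_const, Finset.card_univ, Fintype.card_fin,
        nsmul_eq_mul, Matrix.one_apply, Fin.succ_inj]
      linear_combination (d : ℂ) * hMD - hD

section ScalarMatrix

variable {A B : Type} [CStarAlgebra A] [CStarAlgebra B] {ι κ : Type} [Fintype ι] [DecidableEq ι]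
  [Fintype κ] [DecidableEq κ]

variable (A) in
/-- A complex matrix, regarded as a matrix over the C⋆-algebra `A`. -/
def scalarMatrix (S : Matrix ι κ ℂ) : Matrix ι κ A := S.map (algebraMap ℂ A)

theorem scalarMatrix_mul {ν : Type} (S : Matrix ι κ ℂ) (T : Matrix κ ν ℂ) :
    scalarMatrix A (S * T) = scalarMatrix A S * scalarMatrix A T := Matrix.map_mul

theorem scalarMatrix_one : scalarMatrix A (1 : Matrix ι ι ℂ) = 1 :=
  Matrix.map_one _ (map_zero _) (map_one _)

theorem scalarMatrix_sub (S T : Matrix ι κ ℂ) :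
    scalarMatrix A (S - T) = scalarMatrix A S - scalarMatrix A T :=
  Matrix.map_sub _ (map_sub _) S T

theorem scalarMatrix_map (φ : A →⋆ₐ[ℂ] B) (S : Matrix ι κ ℂ) :
    (scalarMatrix A S).map φ = scalarMatrix B S := by
  ext i j; exact AlgHomClass.commutes φ _

theorem scalarMatrix_conjTranspose {S : Matrix ι κ ℂ} (hS : ∀ i j, star (S i j) = S i j) :
    (scalarMatrix A S).conjTranspose = scalarMatrix A S.transpose := by
  ext i j
  change star (algebraMap ℂ A (S j i)) = algebraMap ℂ A (S j i)
  rw [← algebraMap_star_comm, hS]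

/-- Conjugation by a real matrix preserves matrices with self-adjoint entries. -/
theorem star_scalarMatrix_conj {S : Matrix ι κ ℂ} (hS : ∀ i j, star (S i j) = S i j)
    {u : Matrix ι ι A} (hu : ∀ i j, star (u i j) = u i j) (i j : κ) :
    star ((scalarMatrix A S.transpose * u * scalarMatrix A S) i j) =
      (scalarMatrix A S.transpose * u * scalarMatrix A S) i j := by
  simp only [Matrix.mul_apply, star_sum, star_mul, Finset.sum_mul]
  refine Finset.sum_congr rfl fun b _ => ?_
  refine Finset.sum_congr rfl fun a _ => ?_
  change star (algebraMap ℂ A (S b j)) * (star (u a b) * star (algebraMap ℂ A (S a i))) =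
    algebraMap ℂ A (S a i) * u a b * algebraMap ℂ A (S b j)
  rw [← algebraMap_star_comm, ← algebraMap_star_comm, hS, hS, hu, Algebra.commutes (S b j),
    Algebra.commutes (S a i)]

variable (A ι) in
/-- The projection onto `(1, …, 1)`. -/
def meanMatrix : Matrix ι ι A :=
  scalarMatrix A (Matrix.of fun _ _ => (Fintype.card ι : ℂ)⁻¹)

theorem mul_meanMatrix_apply (u : Matrix ι ι A) (i j : ι) :
    (u * meanMatrix A ι) i j = (Fintype.card ι : ℂ)⁻¹ • ∑ k, u i k := by
  rw [Matrix.mul_apply, Finset.smul_sum]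
  refine Finset.sum_congr rfl fun k _ => ?_
  rw [Algebra.smul_def, Algebra.commutes]; rfl

theorem meanMatrix_mul_apply (u : Matrix ι ι A) (i j : ι) :
    (meanMatrix A ι * u) i j = (Fintype.card ι : ℂ)⁻¹ • ∑ k, u k j := by
  rw [Matrix.mul_apply, Finset.smul_sum]
  refine Finset.sum_congr rfl fun k _ => ?_
  rw [Algebra.smul_def]; rfl

theorem hasSums_one_iff [Nonempty ι] {u : Matrix ι ι A} :
    HasSums 1 u ↔ u * meanMatrix A ι = meanMatrix A ι ∧ meanMatrix A ι * u = meanMatrix A ι := by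
  have hn : (Fintype.card ι : ℂ)⁻¹ ≠ 0 :=
    inv_ne_zero (Nat.cast_ne_zero.mpr Fintype.card_ne_zero)
  have hJ : ∀ i j, meanMatrix A ι i j = (Fintype.card ι : ℂ)⁻¹ • (1 : A) := fun i j =>
    Algebra.algebraMap_eq_smul_one _
  refine ⟨fun h => ⟨?_, ?_⟩, fun h => ⟨fun i => ?_, fun j => ?_⟩⟩
  · ext i j; rw [mul_meanMatrix_apply, h.1, hJ]
  · ext i j; rw [meanMatrix_mul_apply, h.2, hJ]
  · have := congrFun (congrFun h.1 i) i
    rw [mul_meanMatrix_apply, hJ] at this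
    exact smul_right_injective A hn this
  · have := congrFun (congrFun h.2 j) j
    rw [meanMatrix_mul_apply, hJ] at this
    exact smul_right_injective A hn this

end ScalarMatrix

/-- In an orthonormal basis that contains a multiple of `(1, …, 1)`, the orthogonal matrices with
sums `1` are the matrices `diag(1, v)` with `v` orthogonal.  The other basis vectors are the
columns of `S`. -/
theorem isomorphic_bistochastic {ι κ : Type} [Fintype ι] [DecidableEq ι] [Nonempty ι]
    [Fintype κ] [DecidableEq κ] {G : MatrixPair ι} {H : MatrixPair κ}
    (hG : G.IsCompactMatrixQuantumGroup) (hH : H.IsCompactMatrixQuantumGroup)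
    {S : Matrix ι κ ℂ} (hSstar : ∀ i j, star (S i j) = S i j) (hS1 : S.transpose * S = 1)
    (hS2 : S * S.transpose = 1 - Matrix.of fun _ _ => (Fintype.card ι : ℂ)⁻¹)
    (hu : IsOrthogonal G.U) (hu1 : HasSums 1 G.U) (hv : IsOrthogonal H.U)
    (liftG : ∀ (C : Type) [CStarAlgebra C] (v : Matrix ι ι C), IsOrthogonal v →
      HasSums 1 v → ∃ φ : G.A →⋆ₐ[ℂ] C, G.U.map φ = v)
    (liftH : ∀ (C : Type) [CStarAlgebra C] (v : Matrix κ κ C), IsOrthogonal v →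
      ∃ φ : H.A →⋆ₐ[ℂ] C, H.U.map φ = v) : G.Isomorphic H := by
  -- over every C⋆-algebra, `S` is an isometry onto the complement of the range of `meanMatrix`
  have h1 : ∀ (C : Type) [CStarAlgebra C],
      scalarMatrix C S.transpose * scalarMatrix C S = 1 := fun C _ => by
    rw [← scalarMatrix_mul, hS1, scalarMatrix_one]
  have h2 : ∀ (C : Type) [CStarAlgebra C],
      scalarMatrix C S * scalarMatrix C S.transpose = 1 - meanMatrix C ι := fun C _ => by
    rw [← scalarMatrix_mul, hS2, scalarMatrix_sub, scalarMatrix_one]; rfl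
  have h3 : ∀ (C : Type) [CStarAlgebra C], scalarMatrix C S.transpose * meanMatrix C ι = 0 :=
    fun C _ => by
      rw [← sub_sub_cancel 1 (meanMatrix C ι), ← h2, Matrix.mul_sub, ← Matrix.mul_assoc, h1,
        Matrix.mul_one, Matrix.one_mul, sub_self]
  have h4 : ∀ (C : Type) [CStarAlgebra C], meanMatrix C ι * scalarMatrix C S = 0 :=
    fun C _ => by
      rw [← sub_sub_cancel 1 (meanMatrix C ι), ← h2, Matrix.sub_mul, Matrix.mul_assoc, h1,
        Matrix.mul_one, Matrix.one_mul, sub_self]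
  have h5 : ∀ (C : Type) [CStarAlgebra C], meanMatrix C ι * meanMatrix C ι = meanMatrix C ι :=
    fun C _ => by
      nth_rw 1 [← sub_sub_cancel 1 (meanMatrix C ι)]
      rw [← h2, Matrix.sub_mul, Matrix.mul_assoc, h3, Matrix.mul_zero, Matrix.one_mul, sub_zero]
  have hJstar : ∀ (C : Type) [CStarAlgebra C] (i j : ι),
      star (meanMatrix C ι i j) = meanMatrix C ι i j := fun C _ i j => by
    change star (algebraMap ℂ C _) = algebraMap ℂ C _
    rw [← algebraMap_star_comm]; simp
  have hJH : ∀ (C : Type) [CStarAlgebra C], (meanMatrix C ι).conjTranspose = meanMatrix C ι :=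
    fun C _ => by ext i j; exact hJstar C j i
  have hSH : ∀ (C : Type) [CStarAlgebra C], (scalarMatrix C S).conjTranspose =
      scalarMatrix C S.transpose := fun C _ => scalarMatrix_conjTranspose hSstar
  have hTH : ∀ (C : Type) [CStarAlgebra C], (scalarMatrix C S.transpose).conjTranspose =
      scalarMatrix C S := fun C _ => by rw [← hSH, Matrix.conjTranspose_conjTranspose]
  -- compression to the complement of `(1, …, 1)`, and extension by `1` on `(1, …, 1)`
  let cut : ∀ (C : Type) [CStarAlgebra C], Matrix ι ι C → Matrix κ κ C := fun C _ u =>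
    scalarMatrix C S.transpose * u * scalarMatrix C S
  let extend : ∀ (C : Type) [CStarAlgebra C], Matrix κ κ C → Matrix ι ι C := fun C _ v =>
    meanMatrix C ι + scalarMatrix C S * v * scalarMatrix C S.transpose
  have hcut : ∀ (C : Type) [CStarAlgebra C] (a b : Matrix ι ι C),
      meanMatrix C ι * b = meanMatrix C ι → cut C a * cut C b = cut C (a * b) :=
    fun C _ a b hb => by
      have h : scalarMatrix C S * (scalarMatrix C S.transpose * (b * scalarMatrix C S)) =
          b * scalarMatrix C S := by
        rw [← Matrix.mul_assoc, h2, Matrix.sub_mul, Matrix.one_mul, ← Matrix.mul_assoc, hb, h4,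
          sub_zero]
      simp only [cut, Matrix.mul_assoc, h]
  have hext : ∀ (C : Type) [CStarAlgebra C] (a b : Matrix κ κ C), a * b = 1 →
      extend C a * extend C b = 1 := fun C _ a b hab => by
    have e1 : meanMatrix C ι * (scalarMatrix C S * b * scalarMatrix C S.transpose) = 0 := by
      rw [← Matrix.mul_assoc, ← Matrix.mul_assoc, h4, Matrix.zero_mul, Matrix.zero_mul]
    have e2 : scalarMatrix C S * a * scalarMatrix C S.transpose * meanMatrix C ι = 0 := by
      rw [Matrix.mul_assoc, h3, Matrix.mul_zero]
    have e3 : scalarMatrix C S * a * scalarMatrix C S.transpose *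
        (scalarMatrix C S * b * scalarMatrix C S.transpose) = 1 - meanMatrix C ι := by
      calc _ = scalarMatrix C S * (a * (scalarMatrix C S.transpose * scalarMatrix C S) * b) *
            scalarMatrix C S.transpose := by simp only [Matrix.mul_assoc]
        _ = _ := by rw [h1, Matrix.mul_one, hab, Matrix.mul_one, h2]
    simp only [extend]
    rw [Matrix.add_mul, Matrix.mul_add, Matrix.mul_add, h5, e1, e2, e3, add_zero, zero_add,
      add_sub_cancel]
  have hcutext : ∀ (C : Type) [CStarAlgebra C] (v : Matrix κ κ C), cut C (extend C v) = v :=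
    fun C _ v => by
      simp only [cut, extend]
      rw [Matrix.mul_add, h3, zero_add]
      calc _ = scalarMatrix C S.transpose * scalarMatrix C S * v *
            (scalarMatrix C S.transpose * scalarMatrix C S) := by simp only [Matrix.mul_assoc]
        _ = v := by rw [h1, Matrix.one_mul, Matrix.mul_one]
  have hextcut : ∀ (C : Type) [CStarAlgebra C] (u : Matrix ι ι C), HasSums 1 u →
      extend C (cut C u) = u := fun C _ u hu => by
    obtain ⟨hr, hl⟩ := hasSums_one_iff.mp hu
    simp only [cut, extend]
    calc _ = meanMatrix C ι + scalarMatrix C S * scalarMatrix C S.transpose * u *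
            (scalarMatrix C S * scalarMatrix C S.transpose) := by simp only [Matrix.mul_assoc]
      _ = u := by
        rw [h2, Matrix.sub_mul, hl, Matrix.one_mul, Matrix.mul_sub, Matrix.mul_one,
          Matrix.sub_mul, hr, h5, sub_self, sub_zero, add_sub_cancel]
  have hextsums : ∀ (C : Type) [CStarAlgebra C] (v : Matrix κ κ C), HasSums 1 (extend C v) :=
    fun C _ v => by
      refine hasSums_one_iff.mpr ⟨?_, ?_⟩ <;> simp only [extend]
      · rw [Matrix.add_mul, h5, Matrix.mul_assoc, h3, Matrix.mul_zero, add_zero]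
      · rw [Matrix.mul_add, h5, ← Matrix.mul_assoc, ← Matrix.mul_assoc, h4, Matrix.zero_mul,
          Matrix.zero_mul, add_zero]
  have hcutorth : ∀ (C : Type) [CStarAlgebra C] (u : Matrix ι ι C), IsOrthogonal u →
      HasSums 1 u → IsOrthogonal (cut C u) := fun C _ u hu hu1 => by
    obtain ⟨hr, hl⟩ := hasSums_one_iff.mp hu1
    refine ⟨star_scalarMatrix_conj hSstar hu.1, ?_⟩
    have hs : star (cut C u) = cut C (star u) := by
      simp only [cut, Matrix.star_eq_conjTranspose, Matrix.conjTranspose_mul, hSH, hTH,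
        Matrix.mul_assoc]
    have hl' : meanMatrix C ι * star u = meanMatrix C ι := by
      rw [Matrix.star_eq_conjTranspose, ← hJH, ← Matrix.conjTranspose_mul, hr]
    have h11 : cut C 1 = 1 := by simp only [cut]; rw [Matrix.mul_one, h1]
    rw [Unitary.mem_iff, hs, hcut _ _ _ hl, hcut _ _ _ hl', (Unitary.mem_iff.mp hu.2).1,
      (Unitary.mem_iff.mp hu.2).2]
    exact ⟨h11, h11⟩
  have hextorth : ∀ (C : Type) [CStarAlgebra C] (v : Matrix κ κ C), IsOrthogonal v →
      IsOrthogonal (extend C v) := fun C _ v hv => by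
    refine ⟨fun i j => ?_, ?_⟩
    · have := star_scalarMatrix_conj (S := S.transpose) (fun i j => hSstar j i) hv.1 i j
      rw [Matrix.transpose_transpose] at this
      simp only [extend]
      rw [Matrix.add_apply, star_add, hJstar, this]
    · have hs : star (extend C v) = extend C (star v) := by
        simp only [extend, Matrix.star_eq_conjTranspose, Matrix.conjTranspose_add,
          Matrix.conjTranspose_mul, hSH, hTH, hJH, Matrix.mul_assoc]
      rw [Unitary.mem_iff, hs]
      exact ⟨hext _ _ _ (Unitary.mem_iff.mp hv.2).1, hext _ _ _ (Unitary.mem_iff.mp hv.2).2⟩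
  have hcutmap : ∀ (C D : Type) [CStarAlgebra C] [CStarAlgebra D] (φ : C →⋆ₐ[ℂ] D)
      (u : Matrix ι ι C), (cut C u).map φ = cut D (u.map φ) := fun C D _ _ φ u => by
    simp only [cut]
    rw [Matrix.map_mul, Matrix.map_mul, scalarMatrix_map, scalarMatrix_map]
  have hextmap : ∀ (C D : Type) [CStarAlgebra C] [CStarAlgebra D] (φ : C →⋆ₐ[ℂ] D)
      (v : Matrix κ κ C), (extend C v).map φ = extend D (v.map φ) := fun C D _ _ φ v => by
    simp only [extend]
    rw [Matrix.map_add _ (map_add φ), Matrix.map_mul, Matrix.map_mul, scalarMatrix_map,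
      scalarMatrix_map, meanMatrix, scalarMatrix_map]
    rfl
  obtain ⟨Φ, hΦ⟩ := liftG _ (extend _ H.U) (hextorth _ _ hv) (hextsums _ _)
  obtain ⟨Ψ, hΨ⟩ := liftH _ (cut _ G.U) (hcutorth _ _ hu hu1)
  have hV : (cut _ G.U).map Φ = H.U := by rw [hcutmap, hΦ, hcutext]
  refine isomorphic_of_homs hG Φ Ψ (hom_ext hG.generated ?_) (hom_ext hH.generated ?_)
    (cut _ G.U) hV (fun Δ hΔ => ?_) hH.generated hH.unitary hH.conj_invertible
  · have : (G.U.map Φ).map Ψ = G.U := by rw [hΦ, hextmap, hΨ, hextcut _ _ hu1]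
    exact this
  · have : (H.U.map Ψ).map Φ = H.U := by rw [hΨ, hV]
    exact this
  · rw [isComultiplication_iff] at hΔ
    have hr : HasSums 1 (G.U.map (MinTensor.inr : G.A →⋆ₐ[ℂ] MinTensor G.A G.A)) := by
      simpa using hu1.map MinTensor.inr
    rw [IsCorep, comulMatrix, hcutmap, hcutmap, hcutmap, hcut _ _ _ (hasSums_one_iff.mp hr).2]
    exact congrArg _ hΔ

theorem isomorphic_Ab (m : ℕ) : (Ab (m + 1)).Isomorphic (Ao m) := by
  obtain ⟨S, hS, hS1, hS2⟩ := exists_isometry m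
  exact isomorphic_bistochastic (isCompactMatrixQuantumGroup_Ab _)
    (isCompactMatrixQuantumGroup_Ao _) hS hS1 (by rw [hS2, Fintype.card_fin])
    (isOrthogonal_Ab _) (hasSums_Ab _) (isOrthogonal_Ao _)
    (fun C _ v hv hv1 => exists_hom_universalPair v ⟨hv, hv1⟩)
    (fun C _ v hv => exists_hom_universalPair v hv)

end FreeQG

end

theorem theorem4p1 (n : ℕ) (hn : 1 ≤ n) :
    (FreeQG.Ab n).Isomorphic (FreeQG.Ao (n - 1)) ∧
    (FreeQG.As' n).Isomorphic ((FreeQG.As n).directSum FreeQG.cstarZMod2) ∧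
    (FreeQG.Ab' n).Isomorphic ((FreeQG.Ab n).freeProduct FreeQG.cstarZMod2) ∧
    (FreeQG.Ap n).Isomorphic ((FreeQG.As n).freeProduct FreeQG.circle) ∧
    (FreeQG.Ac n).Isomorphic ((FreeQG.Ab n).freeProduct FreeQG.circle) := by
  have : Nonempty (Fin n) := ⟨⟨0, hn⟩⟩
  refine ⟨?_, ?_, ?_, ?_, ?_⟩
  · obtain ⟨m, rfl⟩ : ∃ m, n = m + 1 := ⟨n - 1, (Nat.sub_add_cancel hn).symm⟩
    exact FreeQG.isomorphic_Ab m
  · obtain ⟨r, hr⟩ := FreeQG.exists_hasSums_As' hn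
    exact FreeQG.isomorphic_directSum_zmod2 (FreeQG.isCompactMatrixQuantumGroup_As' hn)
      (FreeQG.isCompactMatrixQuantumGroup_As n).generated (FreeQG.isOrthogonal_As' n)
      (FreeQG.hasPartialIsometryEntries_As' n) hr (FreeQG.isOrthogonal_As n)
      (FreeQG.hasPartialIsometryEntries_As n) (FreeQG.hasSums_As n)
      (fun C _ v h1 h2 h3 => FreeQG.exists_hom_universalPair v ⟨h1, h2, h3⟩)
      (fun C _ v h1 h2 h3 => FreeQG.exists_hom_universalPair v ⟨h1, h2, h3⟩)
  · obtain ⟨r, hr⟩ := FreeQG.exists_hasSums_Ab' hn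
    exact FreeQG.isomorphic_freeProduct_zmod2 (FreeQG.isCompactMatrixQuantumGroup_Ab' hn)
      (FreeQG.isCompactMatrixQuantumGroup_Ab n).generated (FreeQG.isOrthogonal_Ab' n)
      hr (FreeQG.isOrthogonal_Ab n) (FreeQG.hasSums_Ab n)
      (fun C _ v h1 h2 => FreeQG.exists_hom_universalPair v ⟨h1, h2⟩)
      (fun C _ v h1 h2 => FreeQG.exists_hom_universalPair v ⟨h1, h2⟩)
  · exact FreeQG.isomorphic_freeComplexification (FreeQG.isCompactMatrixQuantumGroup_As n)
      (FreeQG.hasSums_As n)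
  · exact FreeQG.isomorphic_freeComplexification (FreeQG.isCompactMatrixQuantumGroup_Ab n)
      (FreeQG.hasSums_Ab n)
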